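/- **Setting.** Let $\Gamma\subset\mathbb R^2$ be a compact convex set whose boundary is a smooth simple closed curve, and let $\rho(x_{\rm h})=\mathrm{dist}(x_{\rm h},\Gamma)$. Let $\rho_0,H,\beta>0$ and let $\phi:[\rho_0,\infty[\to[0,H]$ be smooth, bounded as well as all its derivatives, with $\phi^{-1}(0)=\{\rho_0\}$. Put $$\mathcal O=\mathbb R^2\setminus\rho^{-1}([0,\rho_0]),\qquad \Omega_\phi=\{(x_{\rm h},z)\in\mathcal O\times\mathbb R:\ -\phi(\rho(x_{\rm h}))<z<0\},$$ and assume that $\{x_{\rm h}\in\mathcal O:\phi'(\rho(x_{\rm h}))=0\}$ is negligible. Let $u_0^\theta:[\rho_0,\infty[\to\mathbb R$ be smooth, such that $u_0=u_0^\theta(\rho)\nabla_{\rm h}^\perp\rho$ and all its derivatives belong to $L^2(\mathcal O)$ and $u_0^\theta/\phi$ is bounded. Here $(v^1,v^2)^\perp=(-v^2,v^1)$. Define $$\lambda_\phi(r)=\frac{\sqrt{2\beta}}{\phi(r)}\,\frac{1+\sqrt[4]{1+\phi'(r)^2}}2,\qquad \overline u^\theta(t,r)=u_0^\theta(r)\,e^{-t\lambda_\phi(r)}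 .$$ **Approximate solutions.** Let $\chi\ge0$ be a smooth function, compactly supported in $[0,1[$, equal to $1$ in a neighbourhood of $[0,1/2]$. Let $k$ be a smooth function, compactly supported in $]-2,0]$, with $k=1$ on $[-1,0]$ and $\int_{-\infty}^0k\,d\zeta=\int_{-\infty}^0\zeta k'(\zeta)\,d\zeta=0$. For $0<a<1$ and $\varepsilon>0$ set $E=2\beta\varepsilon^2$, $\delta=(1+\phi'^2)^{3/4}$, $$u_\varepsilon(t,r)=\Bigl(1-\chi\Bigl(\tfrac{\phi(r)}{4\varepsilon^{1-a}}\Bigr)\Bigr)\overline u^\theta(t,r),\qquad \zeta=\tfrac z{\sqrt E},\quad s=-\tfrac z{\varepsilon^{1-a}},\qquad \zeta'=-\tfrac{z+\phi(\rho)}{\delta(\rho)\sqrt E},\quad s'=\tfrac{z+\phi(\rho)}{\varepsilon^{1-a}},$$ $$K_0(\zeta)=\int_\zeta^0k(\sigma)\,d\sigma,\qquad K_1(\zeta)=\int_\zeta^0\sigma k'(\sigma)\,d\sigma,\qquad D[f]=\mathrm{div}_{\rm h}\bigl(f(\rho)\nabla_{\rm h}\rho\bigr).$$ Let $(p,q,w)$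 denote the vector $p\nabla_{\rm h}\rho+q\nabla^\perp_{\rm h}\rho+w\,e_{\rm z}$. The functions $\phi,\phi',\delta,\delta',\lambda_\phi$ are taken at $\rho(x_{\rm h})$, $u_\varepsilon$ at $(t,\rho(x_{\rm h}))$, and the prime on $\zeta',s'$ is only a label. Put $$U_{0}^{\rm int}=(0,u_\varepsilon,0),\qquad U_0^{\rm surf}=-u_\varepsilon\chi(s)e^{\zeta}(-\sin\zeta,\cos\zeta,0),$$ $$U_0^{\rm bot}=-u_\varepsilon\chi(s')e^{\zeta'}\bigl(-\delta^{-2/3}\sin\zeta',\cos\zeta',\phi'\delta^{-2/3}\sin\zeta'\bigr),$$ $$U_a^{\rm surf}=\tfrac{\sqrt{2\beta}}2u_\varepsilon\chi'(s)e^\zeta(\cos\zeta-\sin\zeta)\,(1,0,0),\qquad U_a^{\rm bot}=\tfrac{\sqrt{2\beta}}2\delta^{1/3}u_\varepsilon\chi'(s')e^{\zeta'}(\cos\zeta'-\sin\zeta')\,(1,0,-\phi'),$$ $$U_1^{\rm int}=\bigl(\lambda_\phi u_\varepsilon,\,0,\,-\tfrac{\sqrt{2\beta}}2D[u_\varepsilon]-z\,D[\lambda_\phi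 u_\varepsilon]\bigr),$$ $$U_1^{\rm surf}=\bigl(-\lambda_\phi u_\varepsilon k(\zeta),\,0,\,\tfrac{\sqrt{2\beta}}2D[u_\varepsilon]\chi(s)e^\zeta(\cos\zeta-\sin\zeta)\bigr),$$ $$U_1^{\rm bot}=\Bigl(-\lambda_\phi u_\varepsilon k(\zeta'),\,0,\,-\tfrac{\sqrt{2\beta}}2D[\delta^{1/3}u_\varepsilon]\chi(s')e^{\zeta'}(\cos\zeta'-\sin\zeta')+u_\varepsilon\bigl(\phi'\lambda_\phi k(\zeta')-\sqrt{2\beta}\,\tfrac{\delta'}{\delta^{2/3}}\chi(s')\zeta'e^{\zeta'}\sin\zeta'\bigr)\Bigr),$$ $$U_2^{\rm surf}=-\sqrt{2\beta}\,D[\lambda_\phi u_\varepsilon]K_0(\zeta)\,e_{\rm z},\qquad U_2^{\rm bot}=\sqrt{2\beta}\,\bigl(\delta\,D[\lambda_\phi u_\varepsilon]K_0(\zeta')-\delta'\lambda_\phi u_\varepsilon K_1(\zeta')\bigr)e_{\rm z},$$ $$U_{{\rm app},\varepsilon}=U_0^{\rm int}+U_0^{\rm surf}+U_0^{\rm bot}+\varepsilon^a(U_a^{\rm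 surf}+U_a^{\rm bot})+\varepsilon(U_1^{\rm int}+U_1^{\rm surf}+U_1^{\rm bot})+\varepsilon^2(U_2^{\rm surf}+U_2^{\rm bot}).$$ **Proposition.** There is $a_0\in\,]0,1[$ such that, for all data as above and every $a\in\,]a_0,1[$, the vector field $U_{{\rm app},\varepsilon}$ is smooth on $\mathbb R^+\times\Omega_\phi$ for every $\varepsilon>0$, and $$\lim_{\varepsilon\to0}\Bigl\|U_{{\rm app},\varepsilon}\cdot\nabla U_{{\rm app},\varepsilon}+\bigl(\overline u^\theta(t,\rho)\bigr)^2\,\Delta_{\rm h}\rho\,\nabla_{\rm h}\rho\Bigr\|_{L^1(\mathbb R^+;L^2(\Omega_\phi))}=0 .$$ -/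

import Mathlib

open Set Filter Topology MeasureTheory
open scoped ENNReal ContDiff Gradient InnerProductSpace

noncomputable section

namespace Ekman

/-- The horizontal plane `ℝ²` with its Euclidean structure. -/
abbrev Plane := EuclideanSpace ℝ (Fin 2)

/-- The space `ℝ³ = ℝ² × ℝ`; a point is `(x_h, z)`, a vector is `(v_h, v^z)`.  Only the
Lebesgue measure and the topology of this product are used; Euclidean lengths of
vectors are written out explicitly. -/
abbrev Space := Plane × ℝ

/-- `(v¹, v²)^⊥ = (-v², v¹)`. -/
def perp (v : Plane) : Plane := !₂[-v 1, v 0]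

/-- The horizontal divergence `div_h v = ∂₁ v¹ + ∂₂ v²`. -/
def divH (v : Plane → Plane) (x : Plane) : ℝ :=
  ∑ i : Fin 2, fderiv ℝ v x (EuclideanSpace.single i 1) i

/-- The nonlinear term `V · ∇ V`, that is the derivative of `V` in the direction `V`. -/
def advection (V : Space → Space) (p : Space) : Space := fderiv ℝ V p (V p)

/-- The norm of `L¹(ℝ⁺; L²(S))` for time dependent vector fields, as an extended
nonnegative number. -/
def normL1L2 (S : Set Space) (F : ℝ → Space → Space) : ℝ≥0∞ :=
  ∫⁻ t in Ioi (0 : ℝ),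
    (∫⁻ p in S, ENNReal.ofReal (‖(F t p).1‖ ^ 2 + (F t p).2 ^ 2)) ^ (1 / 2 : ℝ)

/-- A convex island: a compact convex set of the plane whose boundary is a smooth simple closed
curve, parametrized by arc length (`L` is the length of the curve). -/
structure IsConvexIsland (K : Set Plane) : Prop where
  isCompact : IsCompact K
  convex : Convex ℝ K
  smooth_boundary : ∃ (L : ℝ) (γ : ℝ → Plane), 0 < L ∧ ContDiff ℝ ∞ γ ∧
    (∀ s, γ (s + L) = γ s) ∧ InjOn γ (Ico 0 L) ∧ (∀ s, ‖deriv γ s‖ = 1) ∧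
    range γ = frontier K

/-- A depth profile: a function which is smooth on `[ρ₀, ∞[`, bounded there as well as all its
derivatives, with values in `[0, H]`, and vanishing exactly at `ρ₀`. -/
structure IsDepthProfile (ρ₀ H : ℝ) (φ : ℝ → ℝ) : Prop where
  smooth : ContDiffOn ℝ ∞ φ (Ici ρ₀)
  bounded : ∀ n : ℕ, ∃ C : ℝ, ∀ r ∈ Ici ρ₀, |iteratedDerivWithin n φ (Ici ρ₀) r| ≤ C
  mem_Icc : ∀ r ∈ Ici ρ₀, φ r ∈ Icc 0 H
  eq_zero_iff : ∀ r ∈ Ici ρ₀, (φ r = 0 ↔ r = ρ₀)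

/-- A cut-off function: nonnegative, smooth, compactly supported in `[0, 1[`, and equal to `1` in
a neighbourhood of `[0, 1/2]`.  (Only its values on `[0, ∞[` matter; it is
extended smoothly to the line.) -/
structure IsCutoff (χ : ℝ → ℝ) : Prop where
  smooth : ContDiff ℝ ∞ χ
  nonneg : ∀ s, 0 ≤ χ s
  support : ∃ b < (1 : ℝ), ∀ s, b ≤ s → χ s = 0
  eq_one : ∃ η > (0 : ℝ), ∀ s ∈ Icc 0 (1 / 2 + η), χ s = 1

/-- A smooth profile `k` on `]-∞, 0]`, compactly supported in `]-2, 0]`, equal to `1` on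
`[-1, 0]`, such that `∫ k = ∫ ζ k'(ζ) dζ = 0` over `]-∞, 0]`.  (Only its values on
`]-∞, 0]` matter; it is extended smoothly to the line.) -/
structure IsLayerProfile (k : ℝ → ℝ) : Prop where
  smooth : ContDiff ℝ ∞ k
  support : ∃ b > (-2 : ℝ), ∀ s, s ≤ b → k s = 0
  eq_one : ∀ s ∈ Icc (-1 : ℝ) 0, k s = 1
  integral_eq_zero : ∫ ζ in Iic (0 : ℝ), k ζ = 0
  integral_deriv_eq_zero : ∫ ζ in Iic (0 : ℝ), ζ * deriv k ζ = 0

/-- The data of the problem and of the construction of the approximate solutions. -/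
structure Data where
  /-- the island -/
  island : Set Plane
  /-- the width of the thickening of the island -/
  ρ₀ : ℝ
  /-- an upper bound for the depth -/
  H : ℝ
  /-- the depth, as a function of the distance to the island -/
  φ : ℝ → ℝ
  /-- the viscosity coefficient -/
  β : ℝ
  /-- the angular component of the initial velocity, as a function of the distance -/
  u₀ : ℝ → ℝ
  /-- the cut-off function -/
  χ : ℝ → ℝ
  /-- the profile in the boundary layers of order one -/
  k : ℝ → ℝ
  /-- the exponent of the cut-off: layers are truncated at the distance `ε ^ (1 - a)` -/
  a : ℝ

namespace Data

variable (d : Data)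

/-! ### Geometry -/

/-- The distance `ρ` to the island. -/
def rho (x : Plane) : ℝ := Metric.infDist x d.island

/-- The surface of the ocean, the set of points where `ρ > ρ₀`. -/
def ocean : Set Plane := (d.rho ⁻¹' Icc 0 d.ρ₀)ᶜ

/-- The domain of the fluid: `x_h` in the ocean and `-φ(ρ(x_h)) < z < 0`. -/
def Omega : Set Space := {p | p.1 ∈ d.ocean ∧ -d.φ (d.rho p.1) < p.2 ∧ p.2 < 0}

/-- The vector at a point above `x` whose components in the frame `(∇ρ, ∇^⊥ρ, e_z)` are
`(p, q, w)`. -/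
def frame (x : Plane) (p q w : ℝ) : Space :=
  (p • ∇ d.rho x + q • perp (∇ d.rho x), w)

/-- `div_h (f(ρ) ∇ρ)`. -/
def divRadial (f : ℝ → ℝ) (x : Plane) : ℝ := divH (fun y => f (d.rho y) • ∇ d.rho y) x

/-! ### The limit -/

/-- The horizontal initial velocity `u₀^θ(ρ) ∇^⊥ρ`. -/
def initialVelocity (x : Plane) : Plane := d.u₀ (d.rho x) • perp (∇ d.rho x)

/-- The Ekman pumping coefficient
`λ_φ(r) = (√(2β) / φ(r)) * (1 + (1 + φ'(r)²)^(1/4)) / 2`. -/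
def lam (r : ℝ) : ℝ :=
  √(2 * d.β) / d.φ r * ((1 + (1 + deriv d.φ r ^ 2) ^ (1 / 4 : ℝ)) / 2)

/-- The angular component `u^θ(t, r) = u₀^θ(r) exp(-t λ_φ(r))` of the limit velocity. -/
def uBar (t r : ℝ) : ℝ := d.u₀ r * Real.exp (-(t * d.lam r))

/-- The vector field `(u^θ(t, ρ))² Δ_h ρ ∇_h ρ`. -/
def limitTerm (t : ℝ) (p : Space) : Space :=
  (((d.uBar t (d.rho p.1)) ^ 2 * Laplacian.laplacian d.rho p.1) • ∇ d.rho p.1, 0)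

/-! ### The approximate solutions

Fast variables: `ζ ≤ 0` is the boundary layer variable, and `s ≥ 0` is the cut-off variable. -/

/-- `√E`, where `E = 2 β ε²` is the Ekman number. -/
def sqrtE (ε : ℝ) : ℝ := √(2 * d.β * ε ^ 2)

/-- `δ(r) = (1 + φ'(r)²)^(3/4)`. -/
def delta (r : ℝ) : ℝ := (1 + deriv d.φ r ^ 2) ^ (3 / 4 : ℝ)

/-- The cut-off length `ε^(1-a)`. -/
def cut (ε : ℝ) : ℝ := ε ^ (1 - d.a)

/-- The angular velocity truncated near the shore; it is supported in the region where the depth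
is at least `2 ε^(1-a)`. -/
def uEps (ε t r : ℝ) : ℝ := (1 - d.χ (d.φ r / (4 * d.cut ε))) * d.uBar t r

/-- Boundary layer variable at the surface. -/
def zetaS (ε : ℝ) (p : Space) : ℝ := p.2 / d.sqrtE ε

/-- Cut-off variable at the surface. -/
def cutS (ε : ℝ) (p : Space) : ℝ := -p.2 / d.cut ε

/-- Boundary layer variable at the bottom. -/
def zetaB (ε : ℝ) (p : Space) : ℝ :=
  -((p.2 + d.φ (d.rho p.1)) / (d.delta (d.rho p.1) * d.sqrtE ε))

/-- Cut-off variable at the bottom. -/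
def cutB (ε : ℝ) (p : Space) : ℝ := (p.2 + d.φ (d.rho p.1)) / d.cut ε

/-- The interior term of order `0`. -/
def U0int (ε t : ℝ) (p : Space) : Space := d.frame p.1 0 (d.uEps ε t (d.rho p.1)) 0

/-- The surface boundary layer of order `0`. -/
def U0surf (ε t : ℝ) (p : Space) : Space :=
  let ζ := d.zetaS ε p
  let A := -(d.uEps ε t (d.rho p.1)) * d.χ (d.cutS ε p) * Real.exp ζ
  d.frame p.1 (A * (-Real.sin ζ)) (A * Real.cos ζ) 0

/-- The bottom boundary layer of order `0`. -/
def U0bot (ε t : ℝ) (p : Space) : Space :=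
  let r := d.rho p.1
  let ζ := d.zetaB ε p
  let A := -(d.uEps ε t r) * d.χ (d.cutB ε p) * Real.exp ζ
  let m := d.delta r ^ (-2 / 3 : ℝ)
  d.frame p.1 (A * (-(m * Real.sin ζ))) (A * Real.cos ζ) (A * (deriv d.φ r * m * Real.sin ζ))

/-- The surface boundary layer of order `a`. -/
def Uasurf (ε t : ℝ) (p : Space) : Space :=
  let ζ := d.zetaS ε p
  d.frame p.1
    (√(2 * d.β) / 2 * d.uEps ε t (d.rho p.1) * deriv d.χ (d.cutS ε p) * Real.exp ζ
      * (Real.cos ζ - Real.sin ζ)) 0 0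

/-- The bottom boundary layer of order `a`. -/
def Uabot (ε t : ℝ) (p : Space) : Space :=
  let r := d.rho p.1
  let ζ := d.zetaB ε p
  let A := √(2 * d.β) / 2 * d.delta r ^ (1 / 3 : ℝ) * d.uEps ε t r * deriv d.χ (d.cutB ε p)
    * Real.exp ζ * (Real.cos ζ - Real.sin ζ)
  d.frame p.1 A 0 (-(deriv d.φ r) * A)

/-- The interior term of order `1`. -/
def U1int (ε t : ℝ) (p : Space) : Space :=
  let r := d.rho p.1
  d.frame p.1 (d.lam r * d.uEps ε t r) 0
    (-(√(2 * d.β) / 2) * d.divRadial (d.uEps ε t) p.1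
      - p.2 * d.divRadial (fun s => d.lam s * d.uEps ε t s) p.1)

/-- The surface boundary layer of order `1`. -/
def U1surf (ε t : ℝ) (p : Space) : Space :=
  let r := d.rho p.1
  let ζ := d.zetaS ε p
  d.frame p.1 (-(d.lam r * d.uEps ε t r * d.k ζ)) 0
    (√(2 * d.β) / 2 * d.divRadial (d.uEps ε t) p.1 * d.χ (d.cutS ε p) * Real.exp ζ
      * (Real.cos ζ - Real.sin ζ))

/-- The bottom boundary layer of order `1`. -/
def U1bot (ε t : ℝ) (p : Space) : Space :=
  let r := d.rho p.1
  let ζ := d.zetaB ε p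
  d.frame p.1 (-(d.lam r * d.uEps ε t r * d.k ζ)) 0
    (-(√(2 * d.β) / 2) * d.divRadial (fun s => d.delta s ^ (1 / 3 : ℝ) * d.uEps ε t s) p.1
        * d.χ (d.cutB ε p) * Real.exp ζ * (Real.cos ζ - Real.sin ζ)
      + d.uEps ε t r * (deriv d.φ r * d.lam r * d.k ζ
        - √(2 * d.β) * (deriv d.delta r / d.delta r ^ (2 / 3 : ℝ)) * d.χ (d.cutB ε p)
          * ζ * Real.exp ζ * Real.sin ζ))

/-- `K₀(ζ) = ∫_ζ^0 k`. -/
def K0 (ζ : ℝ) : ℝ := ∫ s in ζ..0, d.k s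

/-- `K₁(ζ) = ∫_ζ^0 s k'(s) ds`. -/
def K1 (ζ : ℝ) : ℝ := ∫ s in ζ..0, s * deriv d.k s

/-- The surface boundary layer of order `2`. -/
def U2surf (ε t : ℝ) (p : Space) : Space :=
  d.frame p.1 0 0
    (-(√(2 * d.β) * d.divRadial (fun s => d.lam s * d.uEps ε t s) p.1 * d.K0 (d.zetaS ε p)))

/-- The bottom boundary layer of order `2`. -/
def U2bot (ε t : ℝ) (p : Space) : Space :=
  let r := d.rho p.1
  let ζ := d.zetaB ε p
  d.frame p.1 0 0
    (√(2 * d.β) * (d.delta r * d.divRadial (fun s => d.lam s * d.uEps ε t s) p.1 * d.K0 ζ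
      - deriv d.delta r * d.lam r * d.uEps ε t r * d.K1 ζ))

/-- The approximate solution. -/
def Uapp (ε t : ℝ) (p : Space) : Space :=
  (d.U0int ε t p + d.U0surf ε t p + d.U0bot ε t p)
    + ε ^ d.a • (d.Uasurf ε t p + d.Uabot ε t p)
    + ε • (d.U1int ε t p + d.U1surf ε t p + d.U1bot ε t p)
    + ε ^ 2 • (d.U2surf ε t p + d.U2bot ε t p)

/-! ### The assumptions on the data -/

/-- The assumptions on the domain, on the viscosity, on the initial velocity and on the auxiliary
functions of the construction. -/
structure Admissible : Prop where
  island : IsConvexIsland d.island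
  ρ₀_pos : 0 < d.ρ₀
  H_pos : 0 < d.H
  depth : IsDepthProfile d.ρ₀ d.H d.φ
  critical_null : volume {x ∈ d.ocean | deriv d.φ (d.rho x) = 0} = 0
  β_pos : 0 < d.β
  u₀_smooth : ContDiffOn ℝ ∞ d.u₀ (Ici d.ρ₀)
  /-- the initial velocity and all its derivatives are square integrable on the ocean -/
  u₀_memLp : ∀ n : ℕ,
    MemLp (iteratedFDeriv ℝ n d.initialVelocity) 2 (volume.restrict d.ocean)
  u₀_div_φ_bounded : ∃ C : ℝ, ∀ r ∈ Ioi d.ρ₀, |d.u₀ r / d.φ r| ≤ C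
  cutoff : IsCutoff d.χ
  profile : IsLayerProfile d.k

end Data

end Ekman

end

/-! ### Plane geometry: nearest points, outer normals and curvature of a convex curve. -/

noncomputable section

namespace Ekman

/-! ### Linear algebra of the plane -/

/-! Write the field as V = (P, Q, W) in the moving frame (∇ρ, ∇^⊥ρ, e_z). The Hessian of ρ is Δρ
∇^⊥ρ ⊗ ∇^⊥ρ, so only the angular component turns the frame, and V·∇V has components V·∇P − Δρ Q²,
V·∇Q + Δρ P Q and V·∇W (`advection_gen`). The term −Δρ Q² balances the limit term up to boundary
layers and truncation; every other term has to be shown to be small.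

The dangerous terms are the derivatives of the boundary layers, which vary on the scale ε. They do
so only across their wall (surface or bottom), and the component of V across the wall is O(ε),
because the terms of order one are tangent to it (`transverse_pb`). Hence V·∇ of a layer is again a
layer of size O(1), decaying like exp(−κ · distance / ε) (`block_db`), and its L² norm in z is
O(ε^(1/2)). The interior angular velocity is of size one, but it varies only radially, so its
derivative along V contains P, which is O(ε) away from the layers.

These sizes hold up to powers of the loss factor (1 + t) / ε^(1-a), caused by the cut-offs, by λ_φ ~
1/φ near the shore and by the derivatives of exp(−tλ_φ). The classes `Symb`, `IsCoef`, `PB` and `DB`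
count these powers; at most eleven occur (`advection_gen_bound`). The squared norm is then governed
by ε^(1 − 22(1−a)), which tends to 0 when a > 21/22, and the powers of 1 + t are absorbed by
exp(−`rate` t), a consequence of λ_φ ≥ √(2β)/H.

The terms are quadratic in u₀, so one factor is put in L^∞ and the other in L². This uses that u₀,
u₀', u₀'' are square integrable on the ocean and that u₀, u₀' are bounded: the former because u₀/φ
and φ are, the latter by a one-dimensional Sobolev argument (`exists_bound_deriv_u₀`).

The two layers never interact. Near the shore, where φ < 2ε^(1-a), the whole field vanishes
(`uApp_eq_zero`); elsewhere, for small ε, each layer lives within ε^(1-a) of its wall, so near every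
point the field agrees with one that has a single layer. Both layers are instances of one formula,
with height σz + ψ(ρ) above the wall: σ = −1, ψ = 0 at the surface and σ = 1, ψ = φ at the bottom.
Replacing the limit velocity by its truncation costs only an error on the columns of depth less than
4ε^(1-a), which are thin.

Convexity of the island enters through its curvature κ ≥ 0: normal coordinates have Jacobian 1 + ρκ
≥ 1, so ρ is smooth off the island, and Δρ = κ / (1 + ρκ) is bounded on the ocean together with its
gradient. -/

/-- The rotation `perp` as a continuous linear map. -/
def perpL : Plane →L[ℝ] Plane :=
  LinearMap.toContinuousLinearMap
    { toFun := perp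
      map_add' := fun u v => by
        ext i; fin_cases i <;> simp [perp]; ring
      map_smul' := fun c v => by
        ext i; fin_cases i <;> simp [perp] }

@[simp] theorem perpL_apply (v : Plane) : perpL v = perp v := rfl

theorem plane_inner (u v : Plane) : ⟪u, v⟫_ℝ = u 0 * v 0 + u 1 * v 1 := by
  simp [PiLp.inner_apply, Fin.sum_univ_two, mul_comm]

theorem plane_norm_sq (u : Plane) : ‖u‖ ^ 2 = u 0 ^ 2 + u 1 ^ 2 := by
  rw [EuclideanSpace.norm_sq_eq]; simp [Fin.sum_univ_two]

@[simp] theorem perp_zero_apply (v : Plane) : perp v 0 = -v 1 := rfl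

@[simp] theorem perp_one_apply (v : Plane) : perp v 1 = v 0 := rfl

theorem perp_smul (c : ℝ) (v : Plane) : perp (c • v) = c • perp v := map_smul perpL c v

theorem perp_zero : perp 0 = 0 := map_zero perpL

theorem perp_perp (v : Plane) : perp (perp v) = -v := by
  ext i; fin_cases i <;> simp

theorem norm_perp (v : Plane) : ‖perp v‖ = ‖v‖ := by
  have : ‖perp v‖ ^ 2 = ‖v‖ ^ 2 := by
    rw [plane_norm_sq, plane_norm_sq]; simp; ring
  exact (sq_eq_sq₀ (norm_nonneg _) (norm_nonneg _)).1 this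

theorem inner_perp_self (v : Plane) : ⟪perp v, v⟫_ℝ = 0 := by
  rw [plane_inner]; simp; ring

theorem inner_self_perp (v : Plane) : ⟪v, perp v⟫_ℝ = 0 := by
  rw [plane_inner]; simp; ring

theorem inner_self_of_unit {n : Plane} (hn : ‖n‖ = 1) : ⟪n, n⟫_ℝ = 1 := by
  rw [real_inner_self_eq_norm_sq, hn, one_pow]

/-- Decomposition of a vector in the orthonormal basis `(n, n^⊥)`. -/
theorem eq_inner_smul_add {n : Plane} (hn : ‖n‖ = 1) (v : Plane) :
    v = ⟪n, v⟫_ℝ • n + ⟪perp n, v⟫_ℝ • perp n := by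
  have h : n 0 ^ 2 + n 1 ^ 2 = 1 := by rw [← plane_norm_sq, hn, one_pow]
  ext i
  fin_cases i
  · simp [plane_inner]
    linear_combination (-v 0) * h
  · simp [plane_inner]
    linear_combination (-v 1) * h

theorem inner_eq_zero_iff_of_unit {n v : Plane} (hn : ‖n‖ = 1) :
    ⟪n, v⟫_ℝ = 0 ↔ v = ⟪perp n, v⟫_ℝ • perp n := by
  constructor
  · intro h
    have := eq_inner_smul_add hn v
    rw [h, zero_smul, zero_add] at this
    exact this
  · intro h
    rw [h, inner_smul_right, inner_self_perp, mul_zero]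

/-! ### Normals to a convex island -/

namespace IsConvexIsland

variable {K : Set Plane}

/-- Pythagoras: in the expansion of ‖y + r n − k‖² the cross term 2r⟪y − k, n⟫ is nonnegative by the
supporting inequality, which leaves at least ‖y − k‖² + r². The uniqueness clause is what makes
normal coordinates injective. -/
theorem infDist_eq_of_supporting {K : Set Plane} {y n : Plane} (hy : y ∈ K) (hn : ‖n‖ = 1)
    (h : ∀ k ∈ K, ⟪n, k - y⟫_ℝ ≤ 0) {r : ℝ} (hr : 0 ≤ r) :
    Metric.infDist (y + r • n) K = r ∧ ∀ k ∈ K, dist (y + r • n) k = r → k = y := by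
  have key : ∀ k ∈ K, ‖y - k‖ ^ 2 + r ^ 2 ≤ dist (y + r • n) k ^ 2 := by
    intro k hk
    have e : y + r • n - k = (y - k) + r • n := by abel
    rw [dist_eq_norm, e, norm_add_sq_real, norm_smul, hn, inner_smul_right]
    have h1 : ⟪y - k, n⟫_ℝ = -⟪n, k - y⟫_ℝ := by
      rw [real_inner_comm, ← inner_neg_right, neg_sub]
    rw [h1]
    have := mul_nonneg hr (neg_nonneg.2 (h k hk))
    rw [Real.norm_eq_abs, mul_one, sq_abs]
    linarith
  refine ⟨le_antisymm ?_ ?_, ?_⟩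
  · calc Metric.infDist (y + r • n) K ≤ dist (y + r • n) y := Metric.infDist_le_dist_of_mem hy
      _ = r := by simp [dist_eq_norm, norm_smul, hn, abs_of_nonneg hr]
  · rw [Metric.le_infDist ⟨y, hy⟩]
    intro k hk
    refine le_of_sq_le_sq ?_ dist_nonneg
    have := key k hk
    nlinarith [sq_nonneg ‖y - k‖]
  · intro k hk hd
    have := key k hk
    rw [hd] at this
    have h0 : ‖y - k‖ = 0 := by
      have : ‖y - k‖ ^ 2 ≤ 0 := by linarith
      exact pow_eq_zero_iff two_ne_zero |>.1 (le_antisymm this (sq_nonneg _))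
    exact (sub_eq_zero.1 (norm_eq_zero.1 h0)).symm

/-- The nearest point of a convex compact set, with its outer normal. -/
theorem exists_nearest {K : Set Plane} (hc : IsCompact K) (hconv : Convex ℝ K) (hne : K.Nonempty)
    {x : Plane} (hx : x ∉ K) :
    ∃ y ∈ frontier K, ∃ n : Plane, ‖n‖ = 1 ∧ (∀ k ∈ K, ⟪n, k - y⟫_ℝ ≤ 0) ∧
      x = y + Metric.infDist x K • n := by
  obtain ⟨y, hy, hxy⟩ := hc.exists_infDist_eq_dist hne x
  have hpos : 0 < Metric.infDist x K := (hc.isClosed.notMem_iff_infDist_pos hne).1 hx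
  have hd : 0 < ‖x - y‖ := by rwa [← dist_eq_norm, ← hxy]
  have hinner : ∀ k ∈ K, ⟪x - y, k - y⟫_ℝ ≤ 0 := by
    rw [← norm_eq_iInf_iff_real_inner_le_zero hconv hy]
    rw [← dist_eq_norm, ← hxy, Metric.infDist_eq_iInf]
    simp_rw [dist_eq_norm]
  have hsupp : ∀ k ∈ K, ⟪‖x - y‖⁻¹ • (x - y), k - y⟫_ℝ ≤ 0 := by
    intro k hk
    rw [real_inner_smul_left]
    exact mul_nonpos_of_nonneg_of_nonpos (by positivity) (hinner k hk)
  have hn : ‖‖x - y‖⁻¹ • (x - y)‖ = 1 := by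
    rw [norm_smul, norm_inv, norm_norm, inv_mul_cancel₀ hd.ne']
  refine ⟨y, ?_, ‖x - y‖⁻¹ • (x - y), hn, hsupp, ?_⟩
  -- If the nearest point were interior, a short step along the normal would stay in K, against the
  -- supporting inequality.
  · rw [hc.isClosed.frontier_eq]
    refine ⟨hy, fun hint => ?_⟩
    have hcont : Tendsto (fun r : ℝ => y + r • (‖x - y‖⁻¹ • (x - y))) (𝓝[>] 0) (𝓝 y) := by
      have : Continuous (fun r : ℝ => y + r • (‖x - y‖⁻¹ • (x - y))) := by fun_prop
      have h := this.tendsto 0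
      simp only [zero_smul, add_zero] at h
      exact h.mono_left nhdsWithin_le_nhds
    have hev := hcont.eventually (mem_interior_iff_mem_nhds.1 hint)
    obtain ⟨r, hrK, hr⟩ := (hev.and self_mem_nhdsWithin).exists
    have h := hsupp _ hrK
    rw [add_sub_cancel_left, inner_smul_right, inner_self_of_unit hn, mul_one] at h
    exact absurd h (not_le.2 hr)
  · rw [hxy, dist_eq_norm, smul_smul, mul_inv_cancel₀ hd.ne', one_smul]
    abel

/-- A boundary point y is a limit of points outside K. Their nearest points also converge to y, and
a cluster point of the corresponding unit normals, which exists by compactness of the circle,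
inherits the supporting inequality. -/
theorem exists_normal {K : Set Plane} (hc : IsCompact K) (hconv : Convex ℝ K)
    {y : Plane} (hy : y ∈ frontier K) :
    ∃ n : Plane, ‖n‖ = 1 ∧ ∀ k ∈ K, ⟪n, k - y⟫_ℝ ≤ 0 := by
  have hyK : y ∈ K := hc.isClosed.frontier_subset hy
  have hne : K.Nonempty := ⟨y, hyK⟩
  have hy' : y ∈ closure Kᶜ := by
    rw [frontier_eq_closure_inter_closure] at hy; exact hy.2
  obtain ⟨x, hxK, hxy⟩ := mem_closure_iff_seq_limit.1 hy'
  choose p hp n hn hsupp hx using fun i => exists_nearest hc hconv hne (hxK i)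
  have hpy : Tendsto p atTop (𝓝 y) := by
    have hle : ∀ i, dist (p i) y ≤ 2 * dist (x i) y := by
      intro i
      have h1 : dist (x i) (p i) ≤ dist (x i) y := by
        have : dist (x i) (p i) = Metric.infDist (x i) K := by
          conv_lhs => rw [hx i]
          simp [dist_eq_norm, norm_smul, hn i, abs_of_nonneg Metric.infDist_nonneg]
        rw [this]
        exact Metric.infDist_le_dist_of_mem hyK
      calc dist (p i) y ≤ dist (p i) (x i) + dist (x i) y := dist_triangle _ _ _
        _ ≤ 2 * dist (x i) y := by rw [dist_comm (p i)]; linarith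
    rw [tendsto_iff_dist_tendsto_zero] at hxy ⊢
    have := hxy.const_mul 2
    rw [mul_zero] at this
    exact squeeze_zero (fun _ => dist_nonneg) hle this
  obtain ⟨ν, hν, φ, hφ, hlim⟩ := (isCompact_sphere (0 : Plane) 1).tendsto_subseq
    (x := n) (fun i => by simp [hn i])
  refine ⟨ν, by simpa using hν, fun k hk => ?_⟩
  have h1 : Tendsto (fun i => ⟪n (φ i), k - p (φ i)⟫_ℝ) atTop (𝓝 ⟪ν, k - y⟫_ℝ) :=
    hlim.inner (tendsto_const_nhds.sub (hpy.comp hφ.tendsto_atTop))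
  exact le_of_tendsto' h1 fun i => hsupp _ k hk

end IsConvexIsland

/-- A parametrization by arc length of the boundary of a convex set, with its outer normal `n`
and its curvature `κ`. -/
structure IsOuterParam (K : Set Plane) (L : ℝ) (γ n : ℝ → Plane) (κ : ℝ → ℝ) : Prop where
  pos : 0 < L
  smooth : ContDiff ℝ ∞ γ
  smooth_normal : ContDiff ℝ ∞ n
  smooth_curvature : ContDiff ℝ ∞ κ
  periodic : ∀ s, κ (s + L) = κ s
  injOn : InjOn γ (Ico 0 L)
  mem : ∀ s, γ s ∈ K
  norm_deriv : ∀ s, ‖deriv γ s‖ = 1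
  norm_normal : ∀ s, ‖n s‖ = 1
  inner_eq_zero : ∀ s, ⟪n s, deriv γ s⟫_ℝ = 0
  hasDerivAt_normal : ∀ s, HasDerivAt n (κ s • deriv γ s) s
  curvature_nonneg : ∀ s, 0 ≤ κ s
  supporting : ∀ s, ∀ k ∈ K, ⟪n s, k - γ s⟫_ℝ ≤ 0
  exists_eq : ∀ x, x ∉ K → ∃ s ∈ Ico 0 L, x = γ s + Metric.infDist x K • n s

/-- The outer normal is ±(γ')^⊥, and the sign cannot change along the curve: the parameters where a
given sign is supporting form a closed set, the two sets are disjoint and cover the line, so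
connectedness leaves only one. The normal is therefore as smooth as γ'. -/
theorem IsConvexIsland.exists_outerParam {K : Set Plane} (hK : IsConvexIsland K) :
    ∃ L γ n κ, IsOuterParam K L γ n κ := by
  obtain ⟨L, γ, hL, hγ, hper, hinj, hunit, hrange⟩ := hK.smooth_boundary
  have hdγ : ∀ s, HasDerivAt γ (deriv γ s) s := fun s =>
    (hγ.differentiable (by simp) s).hasDerivAt
  have hγ' : ContDiff ℝ ∞ (deriv γ) := (contDiff_infty_iff_deriv.1 hγ).2
  have hγ'' : ContDiff ℝ ∞ (deriv (deriv γ)) := (contDiff_infty_iff_deriv.1 hγ').2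
  have hmem : ∀ s, γ s ∈ K := fun s =>
    hK.isCompact.isClosed.frontier_subset (hrange ▸ mem_range_self s)
  have hne : K.Nonempty := ⟨_, hmem 0⟩
  have hper' : ∀ s, deriv γ (s + L) = deriv γ s := by
    intro s
    rw [← deriv_comp_add_const]
    congr 1
    exact funext hper
  have hper'' : ∀ s, deriv (deriv γ) (s + L) = deriv (deriv γ) s := by
    intro s
    rw [← deriv_comp_add_const]
    congr 1
    exact funext hper'
  -- The function s' ↦ ⟪ν, γ s' − γ s⟫ is maximal at s, so a supporting normal is orthogonal to the
  -- tangent.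
  have htan : ∀ s (ν : Plane), ‖ν‖ = 1 → (∀ k ∈ K, ⟪ν, k - γ s⟫_ℝ ≤ 0) →
      ν = perp (deriv γ s) ∨ ν = -perp (deriv γ s) := by
    intro s ν hν hs
    have hmax : IsLocalMax (fun s' => ⟪ν, γ s' - γ s⟫_ℝ) s := by
      refine Filter.Eventually.of_forall fun s' => ?_
      simpa using hs _ (hmem s')
    have hd : HasDerivAt (fun s' => ⟪ν, γ s' - γ s⟫_ℝ) ⟪ν, deriv γ s⟫_ℝ s := by
      have := (hasDerivAt_const s ν).inner ℝ ((hdγ s).sub_const (γ s))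
      simpa using this
    have h0 : ⟪ν, deriv γ s⟫_ℝ = 0 := hmax.hasDerivAt_eq_zero hd
    rw [real_inner_comm] at h0
    have hc := (inner_eq_zero_iff_of_unit (hunit s)).1 h0
    set c := ⟪perp (deriv γ s), ν⟫_ℝ
    have hc1 : |c| = 1 := by
      have := congrArg norm hc
      rw [hν, norm_smul, norm_perp, hunit, mul_one] at this
      exact this.symm
    rcases eq_or_eq_neg_of_abs_eq hc1 with h | h
    · left; rw [hc, h, one_smul]
    · right; rw [hc, h, neg_smul, one_smul]
  let N : ℝ → Set ℝ := fun σ => {s | ∀ k ∈ K, ⟪σ • perp (deriv γ s), k - γ s⟫_ℝ ≤ 0}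
  have hNclosed : ∀ σ, IsClosed (N σ) := by
    intro σ
    simp only [N, ofPred_forall]
    refine isClosed_biInter fun k _ => isClosed_le ?_ continuous_const
    have h1 : Continuous (fun s => perp (deriv γ s)) := perpL.continuous.comp hγ'.continuous
    exact (h1.const_smul σ).inner (continuous_const.sub hγ.continuous)
  have hcover : ∀ s, s ∈ N 1 ∨ s ∈ N (-1) := by
    intro s
    obtain ⟨ν, hν, hs⟩ := IsConvexIsland.exists_normal hK.isCompact hK.convex
      (hrange ▸ mem_range_self s : γ s ∈ frontier K)
    rcases htan s ν hν hs with h | h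
    · left; intro k hk; rw [one_smul, ← h]; exact hs k hk
    · right; intro k hk; rw [neg_smul, one_smul, ← h]; exact hs k hk
  -- If both signs were supporting, K would lie in the tangent line at γ s. By Rolle's theorem over
  -- one period, γ' would somewhere have no component along that line either, hence vanish, against
  -- unit speed.
  have hdisj : ∀ s, s ∈ N 1 → s ∈ N (-1) → False := by
    intro s h1 h2
    have hz : ∀ k ∈ K, ⟪perp (deriv γ s), k - γ s⟫_ℝ = 0 := by
      intro k hk
      have a := h1 k hk
      have b := h2 k hk
      rw [one_smul] at a
      rw [neg_smul, one_smul, inner_neg_left] at b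
      linarith
    have hz' : ∀ s', ⟪perp (deriv γ s), deriv γ s'⟫_ℝ = 0 := by
      intro s'
      have hd : HasDerivAt (fun s' => ⟪perp (deriv γ s), γ s' - γ s⟫_ℝ)
          ⟪perp (deriv γ s), deriv γ s'⟫_ℝ s' := by
        have := (hasDerivAt_const s' (perp (deriv γ s))).inner ℝ ((hdγ s').sub_const (γ s))
        simpa using this
      have he : (fun s' => ⟪perp (deriv γ s), γ s' - γ s⟫_ℝ) = fun _ => 0 :=
        funext fun s' => hz _ (hmem s')
      rw [he] at hd
      exact hd.unique (hasDerivAt_const _ _)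
    have hd : ∀ s', HasDerivAt (fun s' => ⟪deriv γ s, γ s'⟫_ℝ) ⟪deriv γ s, deriv γ s'⟫_ℝ s' := by
      intro s'
      have := (hasDerivAt_const s' (deriv γ s)).inner ℝ (hdγ s')
      simpa using this
    obtain ⟨c, -, hc⟩ := exists_hasDerivAt_eq_zero (f := fun s' => ⟪deriv γ s, γ s'⟫_ℝ)
      (a := s) (b := s + L) (by linarith)
      (fun s' _ => (hd s').continuousAt.continuousWithinAt) (by simp [hper]) (fun s' _ => hd s')
    have := eq_inner_smul_add (hunit s) (deriv γ c)
    rw [hc, hz' c, zero_smul, zero_smul, add_zero] at this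
    have h3 := hunit c
    rw [this, norm_zero] at h3
    exact zero_ne_one h3
  obtain ⟨σ, hσ, hσN, hσN'⟩ : ∃ σ : ℝ, (σ = 1 ∨ σ = -1) ∧ (∀ s, s ∈ N σ) ∧ ∀ s, s ∉ N (-σ) := by
    by_cases h1 : (N 1).Nonempty
    · by_cases h2 : (N (-1)).Nonempty
      · exfalso
        have := isPreconnected_closed_iff.1 (isPreconnected_univ (α := ℝ)) (N 1) (N (-1))
          (hNclosed _) (hNclosed _) (fun s _ => hcover s) (by simpa using h1) (by simpa using h2)
        obtain ⟨s, -, hs1, hs2⟩ := this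
        exact hdisj s hs1 hs2
      · rw [not_nonempty_iff_eq_empty] at h2
        refine ⟨1, Or.inl rfl, fun s => ?_, fun s => by simp [h2]⟩
        rcases hcover s with h | h
        · exact h
        · simp [h2] at h
    · rw [not_nonempty_iff_eq_empty] at h1
      refine ⟨-1, Or.inr rfl, fun s => ?_, fun s => by simp [h1]⟩
      rcases hcover s with h | h
      · simp [h1] at h
      · exact h
  have hσ2 : σ * σ = 1 := by rcases hσ with h | h <;> rw [h] <;> norm_num
  have hσa : |σ| = 1 := by rcases hσ with h | h <;> rw [h] <;> norm_num
  let n : ℝ → Plane := fun s => σ • perp (deriv γ s)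
  let κ : ℝ → ℝ := fun s => -⟪n s, deriv (deriv γ) s⟫_ℝ
  have hn : ContDiff ℝ ∞ n := (perpL.contDiff.comp hγ').const_smul σ
  have hnn : ∀ s, ‖n s‖ = 1 := fun s => by
    simp only [n, norm_smul, norm_perp, hunit, Real.norm_eq_abs, hσa, mul_one]
  have hdγ' : ∀ s, HasDerivAt (deriv γ) (deriv (deriv γ) s) s := fun s =>
    (hγ'.differentiable (by simp) s).hasDerivAt
  have hort : ∀ s, ⟪deriv γ s, deriv (deriv γ) s⟫_ℝ = 0 := by
    intro s
    have h1 := (hdγ' s).inner ℝ (hdγ' s)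
    have he : (fun s => ⟪deriv γ s, deriv γ s⟫_ℝ) = fun _ => 1 :=
      funext fun s' => inner_self_of_unit (hunit s')
    rw [he] at h1
    have h2 := h1.unique (hasDerivAt_const _ _)
    rw [real_inner_comm (deriv γ s)] at h2
    linarith
  have hγγ : ∀ s, deriv (deriv γ) s = -(κ s) • n s := by
    intro s
    have := (inner_eq_zero_iff_of_unit (hunit s)).1 (hort s)
    simp only [κ, n, neg_neg, inner_smul_left, smul_smul]
    simp only [conj_trivial]
    rw [mul_right_comm, hσ2, one_mul]
    exact this
  refine ⟨L, γ, n, κ, ⟨hL, hγ, hn, (hn.inner ℝ hγ'').neg, ?_, hinj, hmem, hunit, hnn, ?_, ?_, ?_,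
    fun s => hσN s, ?_⟩⟩
  · intro s; simp only [κ, n, hper', hper'']
  · intro s; simp only [n, inner_smul_left, inner_perp_self, mul_zero]
  · intro s
    have h1 : HasDerivAt n (σ • perp (deriv (deriv γ) s)) s :=
      (perpL.hasFDerivAt.comp_hasDerivAt s (hdγ' s)).const_smul σ
    convert h1 using 1
    rw [hγγ s, perp_smul, smul_smul]
    simp only [n, perp_smul, perp_perp, smul_smul, smul_neg]
    rw [mul_right_comm, hσ2]
    simp
  · intro s
    -- the second derivative of the support function is nonpositive
    by_contra hneg
    push Not at hneg
    have hcont : ContinuousAt κ s := (hn.inner ℝ hγ'').neg.continuous.continuousAt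
    let f : ℝ → ℝ := fun s' => ⟪n s, γ s' - γ s⟫_ℝ
    have hf1 : ∀ s', HasDerivAt f ⟪n s, deriv γ s'⟫_ℝ s' := by
      intro s'
      have := (hasDerivAt_const s' (n s)).inner ℝ ((hdγ s').sub_const (γ s))
      simpa using this
    have hf2 : HasDerivAt (fun s' => ⟪n s, deriv γ s'⟫_ℝ) ⟪n s, deriv (deriv γ) s⟫_ℝ s := by
      have := (hasDerivAt_const s (n s)).inner ℝ (hdγ' s)
      simpa using this
    have hder : deriv f = fun s' => ⟪n s, deriv γ s'⟫_ℝ := funext fun s' => (hf1 s').deriv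
    -- If κ s < 0, then f has a local minimum at s; since f ≤ 0 = f s by the supporting inequality,
    -- f vanishes near s and its second derivative cannot be positive.
    have hmin := isLocalMin_of_deriv_deriv_pos (f := f) (x₀ := s)
      (by rw [hder, hf2.deriv]; simp only [κ] at hneg; linarith)
      (by rw [hder]; simp only [n, inner_smul_left, inner_perp_self, mul_zero])
      (hf1 s).continuousAt
    have hev : f =ᶠ[𝓝 s] fun _ => 0 := by
      filter_upwards [hmin] with s' hs'
      refine le_antisymm (hσN s _ (hmem s')) ?_
      simpa [f] using hs'
    have h0 : deriv (deriv f) s = 0 := by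
      have h1 : deriv f =ᶠ[𝓝 s] fun _ => 0 := by
        have := hev.deriv
        simpa using this
      rw [h1.deriv_eq]; simp
    rw [hder, hf2.deriv] at h0
    simp only [κ, h0, neg_zero, lt_self_iff_false] at hneg
  · intro x hx
    obtain ⟨y, hy, ν, hν, hsupp, hxy⟩ :=
      IsConvexIsland.exists_nearest hK.isCompact hK.convex hne hx
    rw [← hrange] at hy
    obtain ⟨s, rfl⟩ := hy
    obtain ⟨s', hs', hss'⟩ : ∃ s' ∈ Ico 0 L, γ s' = γ s := by
      have hp : Function.Periodic γ L := hper
      obtain ⟨s', hs', h⟩ := hp.exists_mem_Ico₀ hL s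
      exact ⟨s', hs', h.symm⟩
    rw [← hss'] at hsupp hxy
    refine ⟨s', hs', ?_⟩
    have : ν = n s' := by
      rcases hσ with h | h <;> rcases htan s' ν hν hsupp with h' | h'
      · simp only [n, h, one_smul, h']
      · exact absurd (fun k hk => by rw [h, neg_smul, one_smul, ← h']; exact hsupp k hk) (hσN' s')
      · exact absurd (fun k hk => by rw [h, neg_neg, one_smul, ← h']; exact hsupp k hk) (hσN' s')
      · simp only [n, h, neg_smul, one_smul, h']
    rw [← this]
    exact hxy

end Ekman

end

/-! ### Normal coordinates and the regularity of the distance function. -/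

noncomputable section

namespace Ekman

/-- The coordinates of the plane as continuous linear maps. -/
def coordL (i : Fin 2) : Plane →L[ℝ] ℝ := EuclideanSpace.proj i

@[simp] theorem coordL_apply (i : Fin 2) (v : Plane) : coordL i v = v i := rfl

theorem two_le_infty : (2 : WithTop ℕ∞) ≤ (∞ : WithTop ℕ∞) := WithTop.coe_le_coe.2 le_top

namespace IsOuterParam

variable {K : Set Plane} {L : ℝ} {γ n : ℝ → Plane} {κ : ℝ → ℝ}

/-- The normal coordinates `(s, r) ↦ γ(s) + r n(s)`. -/
def normalMap (γ n : ℝ → Plane) (v : Plane) : Plane := γ (v 0) + v 1 • n (v 0)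

/-- The differential of the normal coordinates. -/
def normalMapDeriv (γ n : ℝ → Plane) (κ : ℝ → ℝ) (v : Plane) : Plane →L[ℝ] Plane :=
  (coordL 0).smulRight
      ((1 + v 1 * κ (v 0)) • deriv γ (v 0))
    + (coordL 1).smulRight (n (v 0))

variable (h : IsOuterParam K L γ n κ)
include h

theorem hasDerivAt_curve (s : ℝ) : HasDerivAt γ (deriv γ s) s :=
  (h.smooth.differentiable (by simp) s).hasDerivAt

theorem contDiff_normalMap : ContDiff ℝ ∞ (normalMap γ n) := by
  have h0 : ContDiff ℝ ∞ (fun v : Plane => v 0) :=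
    (coordL 0).contDiff
  have h1 : ContDiff ℝ ∞ (fun v : Plane => v 1) :=
    (coordL 1).contDiff
  exact (h.smooth.comp h0).add (h1.smul (h.smooth_normal.comp h0))

theorem hasFDerivAt_normalMap (v : Plane) :
    HasFDerivAt (normalMap γ n) (normalMapDeriv γ n κ v) v := by
  have h0 : HasFDerivAt (fun v : Plane => v 0)
      (coordL 0) v :=
    (coordL 0).hasFDerivAt
  have h1 : HasFDerivAt (fun v : Plane => v 1)
      (coordL 1) v :=
    (coordL 1).hasFDerivAt
  have h2 := (h.hasDerivAt_curve (v 0)).hasFDerivAt.comp v h0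
  have h3 := (h.hasDerivAt_normal (v 0)).hasFDerivAt.comp v h0
  have h4 := h2.add (h1.smul h3)
  refine h4.congr_fderiv ?_
  ext w i
  fin_cases i <;> simp [normalMapDeriv] <;> ring

omit h in
theorem det_normalMapDeriv (v : Plane) :
    (normalMapDeriv γ n κ v).det =
      (1 + v 1 * κ (v 0)) * (deriv γ (v 0) 0 * n (v 0) 1 - deriv γ (v 0) 1 * n (v 0) 0) := by
  have : (normalMapDeriv γ n κ v).det = LinearMap.det (normalMapDeriv γ n κ v : Plane →ₗ[ℝ] Plane) :=
    rfl
  rw [this, ← LinearMap.det_toMatrix (EuclideanSpace.basisFun (Fin 2) ℝ).toBasis,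
    Matrix.det_fin_two]
  simp [LinearMap.toMatrix_apply, normalMapDeriv]
  ring

/-- Tangent and normal are orthonormal, so only the stretching factor 1 + rκ remains. Convexity
keeps it at least 1: there are no focal points outside the island. -/
theorem abs_det_normalMapDeriv {v : Plane} (hv : 0 ≤ v 1) :
    |(normalMapDeriv γ n κ v).det| = 1 + v 1 * κ (v 0) := by
  have hp : 0 ≤ 1 + v 1 * κ (v 0) := by
    have := mul_nonneg hv (h.curvature_nonneg (v 0)); linarith
  rw [det_normalMapDeriv, abs_mul, abs_of_nonneg hp]
  have h1 := plane_norm_sq (deriv γ (v 0))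
  have h2 := plane_norm_sq (n (v 0))
  have h3 := h.inner_eq_zero (v 0)
  rw [h.norm_deriv] at h1
  rw [h.norm_normal] at h2
  rw [plane_inner] at h3
  -- Lagrange's identity: the squared determinant is ‖γ'‖²‖n‖² − ⟪n, γ'⟫².
  have : (deriv γ (v 0) 0 * n (v 0) 1 - deriv γ (v 0) 1 * n (v 0) 0) ^ 2 = 1 ^ 2 := by
    linear_combination (-(n (v 0) 0 ^ 2 + n (v 0) 1 ^ 2)) * h1 - h2 -
      (n (v 0) 0 * deriv γ (v 0) 0 + n (v 0) 1 * deriv γ (v 0) 1) * h3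
  rw [sq_eq_sq_iff_abs_eq_abs, abs_one] at this
  rw [this, mul_one]

theorem infDist_normal (s : ℝ) {r : ℝ} (hr : 0 ≤ r) :
    Metric.infDist (γ s + r • n s) K = r :=
  (IsConvexIsland.infDist_eq_of_supporting (h.mem s) (h.norm_normal s) (h.supporting s) hr).1

/-- The coordinate r is recovered as the distance to K and γ(s) as the unique nearest point; s is
then determined within one period. -/
theorem injOn_normalMap : InjOn (normalMap γ n) {v | v 0 ∈ Ico 0 L ∧ 0 < v 1} := by
  rintro v ⟨hv0, hv1⟩ w ⟨hw0, hw1⟩ hvw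
  simp only [normalMap] at hvw
  have h1 : v 1 = w 1 := by
    rw [← h.infDist_normal (v 0) hv1.le, ← h.infDist_normal (w 0) hw1.le, hvw]
  have h2 := (IsConvexIsland.infDist_eq_of_supporting (h.mem (v 0)) (h.norm_normal (v 0))
    (h.supporting (v 0)) hv1.le).2 (γ (w 0)) (h.mem _) (by
      rw [hvw, dist_eq_norm, add_sub_cancel_left, norm_smul, h.norm_normal, mul_one,
        Real.norm_eq_abs, abs_of_pos hw1, h1])
  have h3 : w 0 = v 0 := h.injOn hw0 hv0 h2
  ext i; fin_cases i
  · exact h3.symm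
  · exact h1

/-- Near the point the distance is the second coordinate of a local inverse of `normalMap`. The
inverse function theorem applies because 1 + rκ does not vanish, and `infDist_normal` identifies the
coordinate with the distance. -/
theorem contDiffAt_infDist_normal (s : ℝ) {r : ℝ} (hr : 0 < r) :
    ContDiffAt ℝ ∞ (fun x => Metric.infDist x K) (γ s + r • n s) := by
  set v : Plane := !₂[s, r] with hv
  have hv0 : v 0 = s := rfl
  have hv1 : v 1 = r := rfl
  have hdet : (normalMapDeriv γ n κ v).det ≠ 0 := by
    intro h0
    have := h.abs_det_normalMapDeriv (v := v) (by rw [hv1]; exact hr.le)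
    rw [h0, abs_zero] at this
    have h2 := mul_nonneg hr.le (h.curvature_nonneg s)
    rw [hv1, hv0] at this
    linarith
  let A := (normalMapDeriv γ n κ v).toContinuousLinearEquivOfDetNeZero hdet
  have hA : HasFDerivAt (normalMap γ n) (A : Plane →L[ℝ] Plane) v := by
    simp only [A, ContinuousLinearMap.coe_toContinuousLinearEquivOfDetNeZero]
    exact h.hasFDerivAt_normalMap v
  have hsm : ContDiffAt ℝ ∞ (normalMap γ n) v := h.contDiff_normalMap.contDiffAt
  have hinv := hsm.to_localInverse hA (by simp)
  have hx : normalMap γ n v = γ s + r • n s := rfl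
  have hst := hsm.hasStrictFDerivAt' hA (by simp)
  have hright := hst.eventually_right_inverse
  have hg0 : hst.localInverse _ _ _ (normalMap γ n v) = v := hst.localInverse_apply_image
  rw [hx] at hright hg0
  have hsmg : ContDiffAt ℝ ∞ (hst.localInverse _ _ _) (γ s + r • n s) := hinv
  have hproj : ContDiffAt ℝ ∞ (fun x => hst.localInverse _ _ _ x 1) (γ s + r • n s) :=
    (coordL 1).contDiff.contDiffAt.comp _ hsmg
  refine hproj.congr_of_eventuallyEq ?_
  have hpos : ∀ᶠ x in 𝓝 (γ s + r • n s), 0 < hst.localInverse _ _ _ x 1 := by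
    refine hproj.continuousAt.eventually (lt_mem_nhds ?_)
    change 0 < hst.localInverse _ _ _ (γ s + r • n s) 1
    rw [hg0]; exact hr
  filter_upwards [hright, hpos] with x hx1 hx2
  conv_lhs => rw [← hx1]
  exact h.infDist_normal _ hx2.le

theorem hasDerivAt_normal_curve (s r : ℝ) :
    HasDerivAt (fun s' => γ s' + r • n s') ((1 + r * κ s) • deriv γ s) s := by
  have := (h.hasDerivAt_curve s).add ((h.hasDerivAt_normal s).const_smul r)
  refine this.congr_deriv ?_
  rw [add_smul, one_smul, smul_smul]

theorem perp_normal (s : ℝ) : ∃ c : ℝ, |c| = 1 ∧ deriv γ s = c • perp (n s) := by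
  have h1 := (inner_eq_zero_iff_of_unit (h.norm_normal s)).1 (h.inner_eq_zero s)
  refine ⟨_, ?_, h1⟩
  have := congrArg norm h1
  rw [h.norm_deriv, norm_smul, norm_perp, h.norm_normal, mul_one] at this
  exact this.symm

theorem one_add_pos (s : ℝ) {r : ℝ} (hr : 0 ≤ r) : 0 < 1 + r * κ s := by
  have := mul_nonneg hr (h.curvature_nonneg s); linarith

/-- Two linear maps which agree on the tangent and normal vectors are equal. -/
theorem clm_ext {F : Type*} [NormedAddCommGroup F] [NormedSpace ℝ F] {A B : Plane →L[ℝ] F} (s : ℝ)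
    {r : ℝ} (hr : 0 ≤ r) (h1 : A ((1 + r * κ s) • deriv γ s) = B ((1 + r * κ s) • deriv γ s))
    (h2 : A (n s) = B (n s)) : A = B := by
  obtain ⟨c, hc, hp⟩ := h.perp_normal s
  have hc0 : c ≠ 0 := by intro h0; rw [h0, abs_zero] at hc; exact zero_ne_one hc
  have h3 : A (perp (n s)) = B (perp (n s)) := by
    rw [hp, smul_smul, map_smul, map_smul] at h1
    exact smul_right_injective F (mul_ne_zero (h.one_add_pos s hr).ne' hc0) h1
  ext v
  rw [eq_inner_smul_add (h.norm_normal s) v]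
  simp only [map_add, map_smul, h2, h3]

/-- The distance is constant along the parallel curves and grows at unit speed along the normals;
these two directions determine its differential. -/
theorem gradient_normal (s : ℝ) {r : ℝ} (hr : 0 < r) :
    ∇ (fun x => Metric.infDist x K) (γ s + r • n s) = n s := by
  have hd : HasFDerivAt (fun x => Metric.infDist x K) _ (γ s + r • n s) :=
    ((h.contDiffAt_infDist_normal s hr).differentiableAt (by simp)).hasFDerivAt
  have e : fderiv ℝ (fun x => Metric.infDist x K) (γ s + r • n s) = innerSL ℝ (n s) := by
    refine h.clm_ext s hr.le ?_ ?_
    · have h1 := hd.comp_hasDerivAt s (h.hasDerivAt_normal_curve s r)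
      have h2 : (fun x => Metric.infDist x K) ∘ (fun s' => γ s' + r • n s') = fun _ => r :=
        funext fun s' => h.infDist_normal s' hr.le
      rw [h2] at h1
      rw [h1.unique (hasDerivAt_const _ _)]
      simp [h.inner_eq_zero]
    · have h0 : HasDerivAt (fun r' : ℝ => γ s + r' • n s) (n s) r := by
        simpa using ((hasDerivAt_id r).smul_const (n s)).const_add (γ s)
      have h1 := hd.comp_hasDerivAt r h0
      have h2 : (fun x => Metric.infDist x K) ∘ (fun r' : ℝ => γ s + r' • n s) =ᶠ[𝓝 r] fun r' => r' := by
        filter_upwards [lt_mem_nhds hr] with r' hr'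
        exact h.infDist_normal s hr'.le
      rw [(h1.congr_of_eventuallyEq h2.symm).unique (hasDerivAt_id r)]
      simp [h.norm_normal]
  rw [gradient, e]
  exact (InnerProductSpace.toDual ℝ Plane).symm_apply_apply (n s)

theorem contDiffAt_gradient_normal (s : ℝ) {r : ℝ} (hr : 0 < r) :
    ContDiffAt ℝ ∞ (fun x => ∇ (fun x => Metric.infDist x K) x) (γ s + r • n s) := by
  have h1 : ContDiffAt ℝ ∞ (fderiv ℝ (fun x => Metric.infDist x K)) (γ s + r • n s) :=
    (h.contDiffAt_infDist_normal s hr).fderiv_right (by simp)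
  exact (InnerProductSpace.toDual ℝ Plane).symm.toContinuousLinearEquiv.contDiff.contDiffAt.comp _ h1

/-- The gradient is constant along a normal. Along the parallel curve at distance r, which has speed
1 + rκ, it equals n, and n' = κγ'. Hence the Hessian is of rank one, with eigenvalue κ / (1 + rκ) on
the tangent. -/
theorem fderiv_gradient_normal (s : ℝ) {r : ℝ} (hr : 0 < r) (v : Plane) :
    fderiv ℝ (fun x => ∇ (fun x => Metric.infDist x K) x) (γ s + r • n s) v =
      (κ s / (1 + r * κ s)) • ⟪perp (n s), v⟫_ℝ • perp (n s) := by
  have hd : HasFDerivAt (fun x => ∇ (fun x => Metric.infDist x K) x) _ (γ s + r • n s) :=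
    ((h.contDiffAt_gradient_normal s hr).differentiableAt (by simp)).hasFDerivAt
  have hp := h.one_add_pos s hr.le
  have e : fderiv ℝ (fun x => ∇ (fun x => Metric.infDist x K) x) (γ s + r • n s) =
      (κ s / (1 + r * κ s)) • (innerSL ℝ (perp (n s))).smulRight (perp (n s)) := by
    refine h.clm_ext s hr.le ?_ ?_
    · have h1 := hd.comp_hasDerivAt s (h.hasDerivAt_normal_curve s r)
      have h2 : (fun x => ∇ (fun x => Metric.infDist x K) x) ∘ (fun s' => γ s' + r • n s') = n :=
        funext fun s' => h.gradient_normal s' hr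
      rw [h2] at h1
      rw [h1.unique (h.hasDerivAt_normal s)]
      obtain ⟨c, hc, hcp⟩ := h.perp_normal s
      simp [hcp, norm_perp, h.norm_normal, smul_smul]
      congr 1
      rw [mul_comm r] at hp
      have hp' := hp.ne'
      field_simp
    · have h0 : HasDerivAt (fun r' : ℝ => γ s + r' • n s) (n s) r := by
        simpa using ((hasDerivAt_id r).smul_const (n s)).const_add (γ s)
      have h1 := hd.comp_hasDerivAt r h0
      have h2 : (fun x => ∇ (fun x => Metric.infDist x K) x) ∘ (fun r' : ℝ => γ s + r' • n s)
          =ᶠ[𝓝 r] fun r' => n s := by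
        filter_upwards [lt_mem_nhds hr] with r' hr'
        exact h.gradient_normal s hr'
      rw [(h1.congr_of_eventuallyEq h2.symm).unique (hasDerivAt_const r _)]
      simp [inner_perp_self]
  rw [e]
  simp

end IsOuterParam

/-- The divergence of a gradient is the Laplacian. -/
theorem divH_gradient {f : Plane → ℝ} {x : Plane} (hf : ContDiffAt ℝ 2 f x) :
    divH (fun y => ∇ f y) x = Laplacian.laplacian f x := by
  rw [InnerProductSpace.laplacian_eq_iteratedFDeriv_orthonormalBasis f
    (EuclideanSpace.basisFun (Fin 2) ℝ)]
  simp only [divH]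
  refine Finset.sum_congr rfl fun i _ => ?_
  rw [iteratedFDeriv_two_apply]
  have h1 : ContDiffAt ℝ 1 (fderiv ℝ f) x := hf.fderiv_right (m := 1) (by norm_num)
  have h2 : DifferentiableAt ℝ (fun y => ∇ f y) x :=
    ((InnerProductSpace.toDual ℝ Plane).symm.toContinuousLinearEquiv.contDiff.contDiffAt.comp _
      h1).differentiableAt (by simp)
  have h3 : (fun y => coordL i (∇ f y)) = fun y => fderiv ℝ f y (EuclideanSpace.single i 1) := by
    funext y
    have h4 : ⟪∇ f y, EuclideanSpace.single i (1 : ℝ)⟫_ℝ = fderiv ℝ f y (EuclideanSpace.single i 1) :=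
      InnerProductSpace.toDual_symm_apply
    rw [← h4, EuclideanSpace.inner_single_right]
    simp
  have h5 := (coordL i).hasFDerivAt.comp x h2.hasFDerivAt
  have h6 := (h1.differentiableAt (by simp)).hasFDerivAt.clm_apply
    (hasFDerivAt_const (EuclideanSpace.single i (1 : ℝ)) x)
  have h7 : (coordL i ∘ fun y => ∇ f y) = fun y => fderiv ℝ f y (EuclideanSpace.single i 1) := h3
  rw [h7] at h5
  have h8 := congrArg (fun A => A (EuclideanSpace.single i 1)) (h5.unique h6)
  simpa using h8

namespace IsOuterParam

variable {K : Set Plane} {L : ℝ} {γ n : ℝ → Plane} {κ : ℝ → ℝ} (h : IsOuterParam K L γ n κ)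
include h

theorem laplacian_normal (s : ℝ) {r : ℝ} (hr : 0 < r) :
    Laplacian.laplacian (fun x => Metric.infDist x K) (γ s + r • n s) = κ s / (1 + r * κ s) := by
  rw [← divH_gradient ((h.contDiffAt_infDist_normal s hr).of_le two_le_infty)]
  simp only [divH, h.fderiv_gradient_normal s hr, Fin.sum_univ_two]
  have h2 := plane_norm_sq (n s)
  rw [h.norm_normal] at h2
  simp [plane_inner]
  linear_combination (-(κ s / (1 + r * κ s))) * h2

theorem exists_pos {x : Plane} (hx : x ∉ K) :
    ∃ s r, 0 < r ∧ r = Metric.infDist x K ∧ x = γ s + r • n s := by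
  obtain ⟨s, -, hs⟩ := h.exists_eq x hx
  refine ⟨s, _, ?_, rfl, hs⟩
  refine lt_of_le_of_ne Metric.infDist_nonneg fun h0 => hx ?_
  rw [hs, ← h0, zero_smul, add_zero]
  exact h.mem s

theorem exists_bound_deriv_curvature : ∃ C, 0 ≤ C ∧ ∀ s, |deriv κ s| ≤ C := by
  have hc : Continuous (deriv κ) := h.smooth_curvature.continuous_deriv (by simp)
  have hp : Function.Periodic (deriv κ) L := by
    intro s
    rw [← deriv_comp_add_const]
    congr 1
    exact funext h.periodic
  obtain ⟨C, hC⟩ := isCompact_Icc.exists_bound_of_continuousOn (s := Icc 0 L) hc.continuousOn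
  refine ⟨max C 0, le_max_right _ _, fun s => ?_⟩
  obtain ⟨s', hs', he⟩ := hp.exists_mem_Ico₀ h.pos s
  rw [he]
  exact (hC s' ⟨hs'.1, hs'.2.le⟩).trans (le_max_left _ _)

end IsOuterParam

/-! ### The distance to a convex island -/

namespace IsConvexIsland

variable {K : Set Plane} (hK : IsConvexIsland K)
include hK

theorem isOpen_compl : IsOpen Kᶜ := hK.isCompact.isClosed.isOpen_compl

theorem contDiffAt_infDist {x : Plane} (hx : x ∉ K) :
    ContDiffAt ℝ ∞ (fun x => Metric.infDist x K) x := by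
  obtain ⟨L, γ, n, κ, h⟩ := hK.exists_outerParam
  obtain ⟨s, r, hr, -, rfl⟩ := h.exists_pos hx
  exact h.contDiffAt_infDist_normal s hr

theorem contDiffAt_gradient {x : Plane} (hx : x ∉ K) :
    ContDiffAt ℝ ∞ (fun x => ∇ (fun x => Metric.infDist x K) x) x := by
  obtain ⟨L, γ, n, κ, h⟩ := hK.exists_outerParam
  obtain ⟨s, r, hr, -, rfl⟩ := h.exists_pos hx
  exact h.contDiffAt_gradient_normal s hr

theorem norm_gradient {x : Plane} (hx : x ∉ K) :
    ‖∇ (fun x => Metric.infDist x K) x‖ = 1 := by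
  obtain ⟨L, γ, n, κ, h⟩ := hK.exists_outerParam
  obtain ⟨s, r, hr, -, rfl⟩ := h.exists_pos hx
  rw [h.gradient_normal s hr, h.norm_normal]

theorem fderiv_gradient {x : Plane} (hx : x ∉ K) (v : Plane) :
    fderiv ℝ (fun x => ∇ (fun x => Metric.infDist x K) x) x v =
      Laplacian.laplacian (fun x => Metric.infDist x K) x •
        ⟪perp (∇ (fun x => Metric.infDist x K) x), v⟫_ℝ •
          perp (∇ (fun x => Metric.infDist x K) x) := by
  obtain ⟨L, γ, n, κ, h⟩ := hK.exists_outerParam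
  obtain ⟨s, r, hr, -, rfl⟩ := h.exists_pos hx
  rw [h.gradient_normal s hr, h.fderiv_gradient_normal s hr, h.laplacian_normal s hr]

theorem abs_laplacian_le {x : Plane} (hx : x ∉ K) :
    |Laplacian.laplacian (fun x => Metric.infDist x K) x| ≤ (Metric.infDist x K)⁻¹ := by
  obtain ⟨L, γ, n, κ, h⟩ := hK.exists_outerParam
  obtain ⟨s, r, hr, he, rfl⟩ := h.exists_pos hx
  rw [← he, h.laplacian_normal s hr]
  have hκ := h.curvature_nonneg s
  rw [abs_of_nonneg (div_nonneg hκ (h.one_add_pos s hr.le).le), div_le_iff₀ (h.one_add_pos s hr.le)]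
  field_simp
  linarith

theorem contDiffAt_laplacian {x : Plane} (hx : x ∉ K) :
    ContDiffAt ℝ ∞ (Laplacian.laplacian (fun x => Metric.infDist x K)) x := by
  have h1 : (Laplacian.laplacian (fun x => Metric.infDist x K)) =ᶠ[𝓝 x]
      divH (fun y => ∇ (fun x => Metric.infDist x K) y) := by
    filter_upwards [hK.isOpen_compl.mem_nhds hx] with y hy
    exact (divH_gradient ((hK.contDiffAt_infDist hy).of_le two_le_infty)).symm
  refine ContDiffAt.congr_of_eventuallyEq ?_ h1
  unfold divH
  refine ContDiffAt.sum fun i _ => ?_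
  have h2 : ContDiffAt ℝ ∞ (fderiv ℝ (fun x => ∇ (fun x => Metric.infDist x K) x)) x :=
    (hK.contDiffAt_gradient hx).fderiv_right (by simp)
  exact (coordL i).contDiff.contDiffAt.comp _
    (h2.clm_apply contDiffAt_const)

/-- Along a normal, κ / (1 + rκ) has derivative −(κ / (1 + rκ))², of size at most 1/r². In the unit
tangent direction its derivative is κ' / (1 + rκ)³, and κ' is bounded by periodicity. -/
theorem exists_bound_fderiv_laplacian :
    ∃ C, ∀ x, x ∉ K → ∀ v : Plane,
      |fderiv ℝ (Laplacian.laplacian (fun x => Metric.infDist x K)) x v| ≤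
        (C + (Metric.infDist x K)⁻¹ ^ 2) * ‖v‖ := by
  obtain ⟨L, γ, n, κ, h⟩ := hK.exists_outerParam
  obtain ⟨C, hC0, hC⟩ := h.exists_bound_deriv_curvature
  refine ⟨C, fun x hx v => ?_⟩
  have hsm := hK.contDiffAt_laplacian hx
  obtain ⟨s, r, hr, he, rfl⟩ := h.exists_pos hx
  rw [← he]
  have hp := h.one_add_pos s hr.le
  have hκ := h.curvature_nonneg s
  set A := fderiv ℝ (Laplacian.laplacian (fun x => Metric.infDist x K)) (γ s + r • n s) with hA
  have hd : HasFDerivAt (Laplacian.laplacian (fun x => Metric.infDist x K)) A (γ s + r • n s) :=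
    (hsm.differentiableAt (by simp)).hasFDerivAt
  have h1p : 1 ≤ 1 + r * κ s := by have := mul_nonneg hr.le hκ; linarith
  have hn : |A (n s)| ≤ r⁻¹ ^ 2 := by
    have h0 : HasDerivAt (fun r' : ℝ => γ s + r' • n s) (n s) r := by
      simpa using ((hasDerivAt_id r).smul_const (n s)).const_add (γ s)
    have h1 := hd.comp_hasDerivAt r h0
    have h2 : (Laplacian.laplacian (fun x => Metric.infDist x K)) ∘
        (fun r' : ℝ => γ s + r' • n s) =ᶠ[𝓝 r] fun r' => κ s / (1 + r' * κ s) := by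
      filter_upwards [lt_mem_nhds hr] with r' hr'
      exact h.laplacian_normal s hr'
    have h3 : HasDerivAt (fun r' : ℝ => κ s / (1 + r' * κ s))
        ((0 * (1 + r * κ s) - κ s * κ s) / (1 + r * κ s) ^ 2) r := by
      refine (hasDerivAt_const r (κ s)).div ?_ hp.ne'
      simpa using ((hasDerivAt_id r).mul_const (κ s)).const_add 1
    rw [(h1.congr_of_eventuallyEq h2.symm).unique h3, zero_mul, zero_sub, neg_div, abs_neg,
      abs_of_nonneg (by positivity), div_le_iff₀ (by positivity), ← mul_pow]
    rw [← pow_two]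
    refine pow_le_pow_left₀ hκ ?_ 2
    have h4 : r⁻¹ * (1 + r * κ s) = r⁻¹ + κ s := by field_simp
    rw [h4]
    have := inv_pos.2 hr
    linarith
  have ht : |A (deriv γ s)| ≤ C := by
    have h1 := hd.comp_hasDerivAt s (h.hasDerivAt_normal_curve s r)
    have h2 : (Laplacian.laplacian (fun x => Metric.infDist x K)) ∘ (fun s' => γ s' + r • n s') =
        fun s' => κ s' / (1 + r * κ s') := funext fun s' => h.laplacian_normal s' hr
    rw [h2] at h1
    have hκd : HasDerivAt κ (deriv κ s) s :=
      (h.smooth_curvature.differentiable (by simp) s).hasDerivAt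
    have h3 : HasDerivAt (fun s' => κ s' / (1 + r * κ s'))
        ((deriv κ s * (1 + r * κ s) - κ s * (r * deriv κ s)) / (1 + r * κ s) ^ 2) s :=
      hκd.div ((hκd.const_mul r).const_add 1) hp.ne'
    have h4 := h1.unique h3
    rw [map_smul, smul_eq_mul] at h4
    have h5 : A (deriv γ s) = deriv κ s / (1 + r * κ s) ^ 3 := by
      rw [eq_div_iff (by positivity)]
      rw [eq_div_iff (by positivity)] at h4
      linear_combination h4
    rw [h5, abs_div, abs_of_nonneg (by positivity : 0 ≤ (1 + r * κ s) ^ 3)]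
    exact (div_le_self (abs_nonneg _) (one_le_pow₀ h1p)).trans (hC s)
  obtain ⟨c, hc, hcp⟩ := h.perp_normal s
  have ht' : |A (perp (n s))| ≤ C := by
    rw [hcp, map_smul, smul_eq_mul, abs_mul, hc, one_mul] at ht
    exact ht
  have hv := eq_inner_smul_add (h.norm_normal s) v
  have e1 : |⟪n s, v⟫_ℝ| ≤ ‖v‖ := by
    simpa [h.norm_normal] using abs_real_inner_le_norm (n s) v
  have e2 : |⟪perp (n s), v⟫_ℝ| ≤ ‖v‖ := by
    simpa [h.norm_normal, norm_perp] using abs_real_inner_le_norm (perp (n s)) v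
  rw [hv, map_add, map_smul, map_smul, smul_eq_mul, smul_eq_mul, ← hv]
  calc |⟪n s, v⟫_ℝ * A (n s) + ⟪perp (n s), v⟫_ℝ * A (perp (n s))|
      ≤ |⟪n s, v⟫_ℝ| * |A (n s)| + |⟪perp (n s), v⟫_ℝ| * |A (perp (n s))| := by
        rw [← abs_mul, ← abs_mul]; exact abs_add_le _ _
    _ ≤ ‖v‖ * r⁻¹ ^ 2 + ‖v‖ * C := by gcongr
    _ = _ := by ring

end IsConvexIsland

end Ekman

end

/-! ### The ocean: radial integrals, moving frame, bounds on the initial velocity. -/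

noncomputable section

namespace Ekman

/-! ### Integrals of radial functions -/

theorem lintegral_plane_strip {L ρ₀ : ℝ} {f : ℝ → ℝ≥0∞} (hf : Measurable f) :
    ∫⁻ v in {v : Plane | v 0 ∈ Ico 0 L ∧ ρ₀ < v 1}, f (v 1) =
      ENNReal.ofReal L * ∫⁻ r in Ioi ρ₀, f r := by
  let e : Plane ≃ᵐ ℝ × ℝ :=
    (MeasurableEquiv.toLp 2 (Fin 2 → ℝ)).symm.trans MeasurableEquiv.finTwoArrow
  have he : MeasurePreserving e volume volume :=
    (volume_preserving_finTwoArrow ℝ).comp (EuclideanSpace.volume_preserving_symm_measurableEquiv_toLp (Fin 2))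
  have h1 : {v : Plane | v 0 ∈ Ico 0 L ∧ ρ₀ < v 1} = e ⁻¹' (Ico 0 L ×ˢ Ioi ρ₀) := by
    ext v; rfl
  have h2 : (fun v : Plane => f (v 1)) = fun v => (fun q : ℝ × ℝ => f q.2) (e v) := rfl
  have hf' : Measurable (fun q : ℝ × ℝ => f q.2) := hf.comp measurable_snd
  rw [h1, h2, he.setLIntegral_comp_preimage (measurableSet_Ico.prod measurableSet_Ioi) hf']
  rw [Measure.volume_eq_prod, ← Measure.prod_restrict, lintegral_prod _ (by fun_prop)]
  simp [mul_comm]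

/-- The level sets of the distance to a convex island are at least as long as its boundary. -/
theorem IsConvexIsland.exists_le_lintegral_infDist {K : Set Plane} (hK : IsConvexIsland K)
    {ρ₀ : ℝ} (hρ₀ : 0 ≤ ρ₀) : ∃ L : ℝ, 0 < L ∧ ∀ f : ℝ → ℝ≥0∞, Measurable f →
      ENNReal.ofReal L * ∫⁻ r in Ioi ρ₀, f r ≤
        ∫⁻ x in {x | ρ₀ < Metric.infDist x K}, f (Metric.infDist x K) := by
  obtain ⟨L, γ, n, κ, h⟩ := hK.exists_outerParam
  refine ⟨L, h.pos, fun f hf => ?_⟩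
  set S := {v : Plane | v 0 ∈ Ico 0 L ∧ ρ₀ < v 1} with hS
  have hSm : MeasurableSet S :=
    MeasurableSet.inter (s₁ := {v : Plane | v 0 ∈ Ico 0 L}) (s₂ := {v : Plane | ρ₀ < v 1})
      ((coordL 0).continuous.measurable measurableSet_Ico)
      ((coordL 1).continuous.measurable measurableSet_Ioi)
  have hpos : ∀ v ∈ S, 0 < v 1 := fun v hv => hρ₀.trans_lt hv.2
  have hρ : ∀ v ∈ S, Metric.infDist (IsOuterParam.normalMap γ n v) K = v 1 := fun v hv =>
    h.infDist_normal _ (hpos v hv).le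
  have hinj : InjOn (IsOuterParam.normalMap γ n) S :=
    h.injOn_normalMap.mono (by intro v hv; exact ⟨hv.1, hpos v hv⟩)
  calc ENNReal.ofReal L * ∫⁻ r in Ioi ρ₀, f r = ∫⁻ v in S, f (v 1) :=
        (lintegral_plane_strip hf).symm
    _ ≤ ∫⁻ v in S, ENNReal.ofReal |(IsOuterParam.normalMapDeriv γ n κ v).det| *
          f (Metric.infDist (IsOuterParam.normalMap γ n v) K) := by
        -- The Jacobian 1 + rκ is at least 1, which is all that is needed to dominate a
        -- one-dimensional integral by a plane one.
        refine setLIntegral_mono' hSm fun v hv => ?_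
        rw [hρ v hv, h.abs_det_normalMapDeriv (hpos v hv).le]
        refine le_mul_of_one_le_left' ?_
        rw [ENNReal.one_le_ofReal]
        have := mul_nonneg (hpos v hv).le (h.curvature_nonneg (v 0))
        linarith
    _ = ∫⁻ x in IsOuterParam.normalMap γ n '' S, f (Metric.infDist x K) :=
        (lintegral_image_eq_lintegral_abs_det_fderiv_mul volume hSm
          (fun v _ => (h.hasFDerivAt_normalMap v).hasFDerivWithinAt) hinj (fun x => f (Metric.infDist x K))).symm
    _ ≤ _ := by
        refine lintegral_mono_set ?_
        rintro _ ⟨v, hv, rfl⟩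
        change ρ₀ < Metric.infDist _ K
        rw [hρ v hv]
        exact hv.2

namespace Data

variable {d : Data}

theorem mem_ocean {x : Plane} : x ∈ d.ocean ↔ d.ρ₀ < d.rho x := by
  simp only [ocean, mem_compl_iff, mem_preimage, mem_Icc, not_and, not_le]
  exact ⟨fun h => h Metric.infDist_nonneg, fun h _ => h⟩

theorem ocean_eq : d.ocean = {x | d.ρ₀ < Metric.infDist x d.island} := by
  ext x; exact mem_ocean

theorem continuous_rho : Continuous d.rho := Metric.continuous_infDist_pt _

theorem isOpen_ocean : IsOpen d.ocean := by
  rw [ocean_eq]; exact isOpen_lt continuous_const continuous_rho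

/-- The curvature of the level curves of `ρ`. -/
def curv (d : Data) (x : Plane) : ℝ := Laplacian.laplacian d.rho x

namespace Admissible

variable (hd : d.Admissible)
include hd

theorem notMem_island {x : Plane} (hx : x ∈ d.ocean) : x ∉ d.island := by
  intro h
  have := mem_ocean.1 hx
  rw [rho, Metric.infDist_zero_of_mem h] at this
  exact absurd hd.ρ₀_pos (not_lt.2 this.le)

theorem contDiffAt_rho {x : Plane} (hx : x ∈ d.ocean) : ContDiffAt ℝ ∞ d.rho x :=
  hd.island.contDiffAt_infDist (hd.notMem_island hx)

theorem contDiffAt_gradient {x : Plane} (hx : x ∈ d.ocean) :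
    ContDiffAt ℝ ∞ (fun x => ∇ d.rho x) x :=
  hd.island.contDiffAt_gradient (hd.notMem_island hx)

theorem norm_gradient {x : Plane} (hx : x ∈ d.ocean) : ‖∇ d.rho x‖ = 1 :=
  hd.island.norm_gradient (hd.notMem_island hx)

theorem contDiffAt_curv {x : Plane} (hx : x ∈ d.ocean) : ContDiffAt ℝ ∞ d.curv x :=
  hd.island.contDiffAt_laplacian (hd.notMem_island hx)

theorem hasFDerivAt_rho {x : Plane} (hx : x ∈ d.ocean) :
    HasFDerivAt d.rho (innerSL ℝ (∇ d.rho x)) x := by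
  have h := ((hd.contDiffAt_rho hx).differentiableAt (by simp)).hasGradientAt.hasFDerivAt
  exact h

theorem hasFDerivAt_gradient {x : Plane} (hx : x ∈ d.ocean) :
    HasFDerivAt (fun x => ∇ d.rho x)
      (d.curv x • (innerSL ℝ (perp (∇ d.rho x))).smulRight (perp (∇ d.rho x))) x := by
  have h := ((hd.contDiffAt_gradient hx).differentiableAt (by simp)).hasFDerivAt
  refine h.congr_fderiv ?_
  ext1 v
  rw [show fderiv ℝ (fun x => ∇ d.rho x) x v = _ from
    hd.island.fderiv_gradient (hd.notMem_island hx) v]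
  rfl

theorem abs_curv_le {x : Plane} (hx : x ∈ d.ocean) : |d.curv x| ≤ d.ρ₀⁻¹ := by
  refine (hd.island.abs_laplacian_le (hd.notMem_island hx)).trans ?_
  exact inv_anti₀ hd.ρ₀_pos (mem_ocean.1 hx).le

theorem exists_bound_fderiv_curv : ∃ C, 0 ≤ C ∧ ∀ x ∈ d.ocean, ∀ v : Plane,
    |fderiv ℝ d.curv x v| ≤ C * ‖v‖ := by
  obtain ⟨C, hC⟩ := hd.island.exists_bound_fderiv_laplacian
  refine ⟨max (C + d.ρ₀⁻¹ ^ 2) 0, le_max_right _ _, fun x hx v => ?_⟩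
  refine (hC x (hd.notMem_island hx) v).trans ?_
  refine mul_le_mul_of_nonneg_right (le_trans ?_ (le_max_left _ _)) (norm_nonneg _)
  have h1 : (Metric.infDist x d.island)⁻¹ ≤ d.ρ₀⁻¹ :=
    inv_anti₀ hd.ρ₀_pos (mem_ocean.1 hx).le
  have h2 : 0 ≤ (Metric.infDist x d.island)⁻¹ := inv_nonneg.2 Metric.infDist_nonneg
  gcongr

/-- `div (f(ρ) ∇ρ) = f'(ρ) + f(ρ) Δρ`. -/
theorem divRadial_eq {x : Plane} (hx : x ∈ d.ocean) {f : ℝ → ℝ}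
    (hf : DifferentiableAt ℝ f (d.rho x)) :
    d.divRadial f x = deriv f (d.rho x) + f (d.rho x) * d.curv x := by
  have h1 := (hf.hasDerivAt.comp_hasFDerivAt x (hd.hasFDerivAt_rho hx)).smul
    (hd.hasFDerivAt_gradient hx)
  have h2 := plane_norm_sq (∇ d.rho x)
  rw [hd.norm_gradient hx] at h2
  unfold divRadial divH
  rw [HasFDerivAt.fderiv (f := fun y => f (d.rho y) • ∇ d.rho y) h1, Fin.sum_univ_two]
  simp [plane_inner, -inner_gradient_left]
  linear_combination (-(deriv f (d.rho x) + f (d.rho x) * d.curv x)) * h2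

/-! ### The initial velocity -/

theorem exists_hasFDerivAt_angular {x : Plane} (hx : x ∈ d.ocean) {f : ℝ → ℝ}
    (hf : DifferentiableAt ℝ f (d.rho x)) :
    ∃ A : Plane →L[ℝ] Plane, HasFDerivAt (fun y => f (d.rho y) • perp (∇ d.rho y)) A x ∧
      A (∇ d.rho x) = deriv f (d.rho x) • perp (∇ d.rho x) := by
  have h1 := (hf.hasDerivAt.comp_hasFDerivAt x (hd.hasFDerivAt_rho hx)).smul
    (perpL.hasFDerivAt.comp x (hd.hasFDerivAt_gradient hx))
  refine ⟨_, h1, ?_⟩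
  simp [inner_perp_self, perp_zero, -inner_gradient_left, -inner_gradient_right, hd.norm_gradient hx]

theorem contDiffAt_u₀ {r : ℝ} (hr : d.ρ₀ < r) : ContDiffAt ℝ ∞ d.u₀ r :=
  hd.u₀_smooth.contDiffAt (Ici_mem_nhds hr)

theorem abs_u₀_le {x : Plane} (hx : x ∈ d.ocean) :
    |d.u₀ (d.rho x)| ≤ ‖iteratedFDeriv ℝ 0 d.initialVelocity x‖ := by
  rw [norm_iteratedFDeriv_zero, initialVelocity, norm_smul, norm_perp, hd.norm_gradient hx, mul_one,
    Real.norm_eq_abs]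

theorem fderiv_initialVelocity {x : Plane} (hx : x ∈ d.ocean) :
    fderiv ℝ d.initialVelocity x (∇ d.rho x) = deriv d.u₀ (d.rho x) • perp (∇ d.rho x) := by
  obtain ⟨A, hA, h⟩ := hd.exists_hasFDerivAt_angular hx
    ((hd.contDiffAt_u₀ (mem_ocean.1 hx)).differentiableAt (by simp))
  rw [← h, HasFDerivAt.fderiv (f := d.initialVelocity) hA]

theorem abs_deriv_u₀_le {x : Plane} (hx : x ∈ d.ocean) :
    |deriv d.u₀ (d.rho x)| ≤ ‖iteratedFDeriv ℝ 1 d.initialVelocity x‖ := by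
  have h := (fderiv ℝ d.initialVelocity x).le_opNorm (∇ d.rho x)
  rwa [hd.fderiv_initialVelocity hx, norm_smul, norm_perp, hd.norm_gradient hx, mul_one,
    mul_one, Real.norm_eq_abs, ← norm_iteratedFDeriv_one] at h

/-- The Hessian of ρ annihilates ∇ρ, so differentiating Dv(∇ρ) = u₀'(ρ) ∇^⊥ρ along ∇ρ gives D²v(∇ρ,
∇ρ) = u₀''(ρ) ∇^⊥ρ, without terms of lower order. -/
theorem abs_deriv_deriv_u₀_le {x : Plane} (hx : x ∈ d.ocean) :
    |deriv (deriv d.u₀) (d.rho x)| ≤ ‖iteratedFDeriv ℝ 2 d.initialVelocity x‖ := by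
  have hu := hd.contDiffAt_u₀ (mem_ocean.1 hx)
  have hv : ContDiffAt ℝ ∞ d.initialVelocity x :=
    (hu.comp x (hd.contDiffAt_rho hx)).smul
      (perpL.contDiff.contDiffAt.comp x (hd.contDiffAt_gradient hx))
  have hv1 : ContDiffAt ℝ ∞ (fderiv ℝ d.initialVelocity) x := hv.fderiv_right (by simp)
  have hu1 : ContDiffAt ℝ ∞ (deriv d.u₀) (d.rho x) :=
    (hu.fderiv_right (m := ∞) (by simp)).clm_apply contDiffAt_const
  obtain ⟨A, hA, h⟩ := hd.exists_hasFDerivAt_angular hx (hu1.differentiableAt (by simp))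
  have h1 := (hv1.differentiableAt (by simp)).hasFDerivAt.clm_apply (hd.hasFDerivAt_gradient hx)
  have h2 : (fun y => fderiv ℝ d.initialVelocity y (∇ d.rho y)) =ᶠ[𝓝 x]
      fun y => deriv d.u₀ (d.rho y) • perp (∇ d.rho y) := by
    filter_upwards [isOpen_ocean.mem_nhds hx] with y hy
    exact hd.fderiv_initialVelocity hy
  have h3 := congrArg (fun A => A (∇ d.rho x)) ((h1.congr_of_eventuallyEq h2.symm).unique hA)
  simp only [h] at h3
  simp [inner_perp_self, -inner_gradient_right, -inner_gradient_left] at h3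
  have h4 := (fderiv ℝ (fderiv ℝ d.initialVelocity) x).le_opNorm₂ (∇ d.rho x) (∇ d.rho x)
  rw [h3, norm_smul, norm_perp, hd.norm_gradient hx, mul_one, mul_one, mul_one,
    Real.norm_eq_abs, ← norm_iteratedFDeriv_one, norm_iteratedFDeriv_fderiv] at h4
  exact h4

/-- A majorant of the initial velocity and of its first two radial derivatives. -/
def _root_.Ekman.Data.major (d : Data) (r : ℝ) : ℝ :=
  |d.u₀ r| + |deriv d.u₀ r| + |deriv (deriv d.u₀) r|

theorem lintegral_deriv_sq_lt_top (n : ℕ) :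
    ∫⁻ x in d.ocean, ENNReal.ofReal (‖iteratedFDeriv ℝ n d.initialVelocity x‖ ^ 2) < ⊤ := by
  have h := (hd.u₀_memLp n).integrable_norm_pow (p := 2) (by norm_num)
  exact h.lintegral_lt_top

theorem lintegral_major_sq_lt_top :
    ∫⁻ x in d.ocean, ENNReal.ofReal (d.major (d.rho x) ^ 2) < ⊤ := by
  have hle : ∀ x ∈ d.ocean, ENNReal.ofReal (d.major (d.rho x) ^ 2) ≤
      ENNReal.ofReal 3 * (ENNReal.ofReal (‖iteratedFDeriv ℝ 0 d.initialVelocity x‖ ^ 2)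
        + ENNReal.ofReal (‖iteratedFDeriv ℝ 1 d.initialVelocity x‖ ^ 2)
        + ENNReal.ofReal (‖iteratedFDeriv ℝ 2 d.initialVelocity x‖ ^ 2)) := by
    intro x hx
    rw [← ENNReal.ofReal_add (by positivity) (by positivity),
      ← ENNReal.ofReal_add (by positivity) (by positivity), ← ENNReal.ofReal_mul (by norm_num)]
    refine ENNReal.ofReal_le_ofReal ?_
    have h0 := hd.abs_u₀_le hx
    have h1 := hd.abs_deriv_u₀_le hx
    have h2 := hd.abs_deriv_deriv_u₀_le hx
    have h3 : d.major (d.rho x) ≤ ‖iteratedFDeriv ℝ 0 d.initialVelocity x‖ +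
      ‖iteratedFDeriv ℝ 1 d.initialVelocity x‖ + ‖iteratedFDeriv ℝ 2 d.initialVelocity x‖ :=
      add_le_add (add_le_add h0 h1) h2
    have h4 : 0 ≤ d.major (d.rho x) := by unfold major; positivity
    refine (pow_le_pow_left₀ h4 h3 2).trans ?_
    set a := ‖iteratedFDeriv ℝ 0 d.initialVelocity x‖
    set b := ‖iteratedFDeriv ℝ 1 d.initialVelocity x‖
    set c := ‖iteratedFDeriv ℝ 2 d.initialVelocity x‖
    nlinarith [sq_nonneg (a - b), sq_nonneg (a - c), sq_nonneg (b - c)]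
  refine (setLIntegral_mono' isOpen_ocean.measurableSet hle).trans_lt ?_
  have hm : ∀ n, AEMeasurable (fun x => ENNReal.ofReal
      (‖iteratedFDeriv ℝ n d.initialVelocity x‖ ^ 2)) (volume.restrict d.ocean) := fun n =>
    ((hd.u₀_memLp n).1.norm.aemeasurable.pow_const 2).ennreal_ofReal
  rw [lintegral_const_mul' _ _ ENNReal.ofReal_ne_top,
    lintegral_add_right' _ (hm 2), lintegral_add_right' _ (hm 1)]
  refine ENNReal.mul_lt_top ENNReal.ofReal_lt_top ?_
  exact ENNReal.add_lt_top.2 ⟨ENNReal.add_lt_top.2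
    ⟨hd.lintegral_deriv_sq_lt_top 0, hd.lintegral_deriv_sq_lt_top 1⟩,
    hd.lintegral_deriv_sq_lt_top 2⟩

/-- Write u₀ = (u₀/φ) φ with φ ≤ H. -/
theorem exists_bound_u₀ : ∃ C, 0 ≤ C ∧ ∀ r, d.ρ₀ < r → |d.u₀ r| ≤ C := by
  obtain ⟨C, hC⟩ := hd.u₀_div_φ_bounded
  have hC0 : 0 ≤ C := (abs_nonneg _).trans (hC (d.ρ₀ + 1) (by simp))
  refine ⟨C * d.H, mul_nonneg hC0 hd.H_pos.le, fun r hr => ?_⟩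
  have h1 := hd.depth.mem_Icc r (le_of_lt hr)
  have h2 : d.φ r ≠ 0 := fun h => hr.ne' ((hd.depth.eq_zero_iff r (le_of_lt hr)).1 h)
  have h3 := hC r hr
  rw [abs_div, abs_of_nonneg h1.1, div_le_iff₀ (lt_of_le_of_ne h1.1 h2.symm)] at h3
  exact h3.trans (mul_le_mul_of_nonneg_left h1.2 hC0)

/-- `exists_le_lintegral_infDist` transfers square integrability from the ocean to the half line of
radii. -/
theorem lintegral_deriv_deriv_lt_top :
    ∫⁻ r in Ioi d.ρ₀, ENNReal.ofReal (deriv (deriv d.u₀) r ^ 2) < ⊤ := by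
  obtain ⟨L, hL, h⟩ := hd.island.exists_le_lintegral_infDist hd.ρ₀_pos.le
  have h1 := h (fun r => ENNReal.ofReal (deriv (deriv d.u₀) r ^ 2))
    ((measurable_deriv _).pow_const 2).ennreal_ofReal
  have h2 : ∫⁻ x in {x | d.ρ₀ < Metric.infDist x d.island},
      ENNReal.ofReal (deriv (deriv d.u₀) (Metric.infDist x d.island) ^ 2) < ⊤ := by
    rw [← ocean_eq]
    refine lt_of_le_of_lt (lintegral_mono fun x => ENNReal.ofReal_le_ofReal ?_)
      hd.lintegral_major_sq_lt_top
    rw [← sq_abs]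
    refine pow_le_pow_left₀ (abs_nonneg _) ?_ 2
    unfold major
    have a1 := abs_nonneg (d.u₀ (d.rho x))
    have a2 := abs_nonneg (deriv d.u₀ (d.rho x))
    change |deriv (deriv d.u₀) (d.rho x)| ≤ _
    linarith
  have h3 := h1.trans_lt h2
  by_contra h4
  rw [not_lt, top_le_iff] at h4
  rw [h4, ENNReal.mul_top (by simpa using hL)] at h3
  exact lt_irrefl _ h3

/-- Somewhere in [r, r + 1] the slope is controlled by sup |u₀|, and from there u₀' varies by at
most ∫ |u₀''| ≤ 1 + ∫ |u₀''|². This supplies the bounded factor in the quadratic terms where u₀ is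
differentiated. -/
theorem exists_bound_deriv_u₀ : ∃ C, 0 ≤ C ∧ ∀ r, d.ρ₀ < r → |deriv d.u₀ r| ≤ C := by
  obtain ⟨C, hC0, hC⟩ := hd.exists_bound_u₀
  have hsm : ∀ r, d.ρ₀ < r → ContDiffAt ℝ ∞ (deriv d.u₀) r := fun r hr =>
    ((hd.contDiffAt_u₀ hr).fderiv_right (m := ∞) (by simp)).clm_apply contDiffAt_const
  have hsm2 : ∀ r, d.ρ₀ < r → ContDiffAt ℝ ∞ (deriv (deriv d.u₀)) r := fun r hr =>
    ((hsm r hr).fderiv_right (m := ∞) (by simp)).clm_apply contDiffAt_const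
  set I := (∫⁻ r in Ioi d.ρ₀, ENNReal.ofReal (deriv (deriv d.u₀) r ^ 2)).toReal with hI
  refine ⟨2 * C + (1 + I), by positivity, fun r hr => ?_⟩
  -- mean value theorem, then integrate the second derivative
  have hr' : ∀ s ∈ Icc r (r + 1), d.ρ₀ < s := fun s hs => hr.trans_le hs.1
  obtain ⟨c, hc, hcd⟩ := exists_deriv_eq_slope d.u₀ (show r < r + 1 by linarith)
    (fun s hs => (hd.contDiffAt_u₀ (hr' s hs)).continuousAt.continuousWithinAt)
    (fun s hs => ((hd.contDiffAt_u₀ (hr' s ⟨hs.1.le, hs.2.le⟩)).differentiableAt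
      (by simp)).differentiableWithinAt)
  have hslope : |deriv d.u₀ c| ≤ 2 * C := by
    rw [hcd, add_sub_cancel_left, div_one]
    have a1 := hC r hr
    have a2 := hC (r + 1) (by linarith)
    calc |d.u₀ (r + 1) - d.u₀ r| ≤ |d.u₀ (r + 1)| + |d.u₀ r| := abs_sub _ _
      _ ≤ _ := by linarith
  have hsub : Icc r c ⊆ Icc r (r + 1) := Icc_subset_Icc_right hc.2.le
  have hcont : ContinuousOn (deriv (deriv d.u₀)) (Icc r c) := fun s hs =>
    (hsm2 s (hr' s (hsub hs))).continuousAt.continuousWithinAt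
  have hint : ∫ s in r..c, deriv (deriv d.u₀) s = deriv d.u₀ c - deriv d.u₀ r := by
    refine intervalIntegral.integral_deriv_eq_sub (fun s hs => ?_) ?_
    · rw [uIcc_of_le hc.1.le] at hs
      exact (hsm s (hr' s (hsub hs))).differentiableAt (by simp)
    · exact (hcont.mono (by rw [uIcc_of_le hc.1.le])).intervalIntegrable
  have hsq : IntegrableOn (fun s => deriv (deriv d.u₀) s ^ 2) (Ioi d.ρ₀) := by
    refine ⟨((measurable_deriv _).pow_const 2).aestronglyMeasurable, ?_⟩
    rw [hasFiniteIntegral_iff_ofReal (Eventually.of_forall fun _ => sq_nonneg _)]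
    exact hd.lintegral_deriv_deriv_lt_top
  have hI' : I = ∫ s in Ioi d.ρ₀, deriv (deriv d.u₀) s ^ 2 := by
    rw [integral_eq_lintegral_of_nonneg_ae (Eventually.of_forall fun _ => sq_nonneg _)
      ((measurable_deriv _).pow_const 2).aestronglyMeasurable]
  have hbd : |∫ s in r..c, deriv (deriv d.u₀) s| ≤ 1 + I := by
    calc |∫ s in r..c, deriv (deriv d.u₀) s| ≤ ∫ s in r..c, (1 + deriv (deriv d.u₀) s ^ 2) := by
          rw [← Real.norm_eq_abs]
          refine intervalIntegral.norm_integral_le_of_norm_le hc.1.le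
            (Eventually.of_forall fun s _ => ?_) ?_
          · rw [Real.norm_eq_abs, abs_le]
            constructor <;> nlinarith [sq_nonneg (deriv (deriv d.u₀) s - 1),
              sq_nonneg (deriv (deriv d.u₀) s + 1)]
          · exact ((continuousOn_const.add (hcont.pow 2)).mono
              (by rw [uIcc_of_le hc.1.le])).intervalIntegrable
      _ = (c - r) + ∫ s in r..c, deriv (deriv d.u₀) s ^ 2 := by
          rw [intervalIntegral.integral_add]
          · simp
          · exact intervalIntegrable_const
          · exact ((hcont.pow 2).mono (by rw [uIcc_of_le hc.1.le])).intervalIntegrable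
      _ ≤ 1 + I := by
          refine add_le_add (by linarith [hc.2]) ?_
          rw [intervalIntegral.integral_of_le hc.1.le, hI']
          refine setIntegral_mono_set hsq (Eventually.of_forall fun _ => sq_nonneg _) ?_
          exact LE.le.eventuallyLE fun s hs => hr.trans hs.1
  have : deriv d.u₀ r = deriv d.u₀ c - ∫ s in r..c, deriv (deriv d.u₀) s := by rw [hint]; ring
  rw [this]
  exact (abs_sub _ _).trans (add_le_add hslope hbd)

end Admissible

end Data

end Ekman

end

/-! ### Symbol calculus: powers of the loss factor under products, derivatives and composition. -/

noncomputable section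

namespace Ekman

namespace Data

/-! ### Symbols: families of radial functions with polynomial bounds -/

section Symbols

variable (d : Data)

/-- The range of parameters in which the approximate solution does not vanish. -/
structure Reg (ε t r : ℝ) : Prop where
  pos : 0 < ε
  le_one : ε ≤ 1
  nonneg : 0 ≤ t
  ocean : d.ρ₀ < r
  depth : 2 * d.cut ε ≤ d.φ r

/-- The loss factor `(1 + t) / ε^(1-a)`. -/
def loss (ε t : ℝ) : ℝ := (1 + t) / d.cut ε

/-- Joint smoothness in time and radius. -/
def Sm (f : ℝ → ℝ → ℝ → ℝ) : Prop :=
  ∀ ε, 0 < ε → ContDiffOn ℝ ∞ (fun q : ℝ × ℝ => f ε q.1 q.2) (univ ×ˢ Ioi d.ρ₀)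

/-- The radial derivative of a family. -/
def dr (f : ℝ → ℝ → ℝ → ℝ) : ℝ → ℝ → ℝ → ℝ := fun ε t => deriv (f ε t)

/-- Weights: nonnegative and nondecreasing in the order of derivation. -/
structure IsWeight (g : ℕ → ℝ → ℝ → ℝ) : Prop where
  nonneg : ∀ i t r, 0 ≤ g i t r
  mono : ∀ i t r, g i t r ≤ g (i + 1) t r

/-- The trivial weight. -/
def unitWeight : ℕ → ℝ → ℝ → ℝ := fun _ _ _ => 1

/-- `k` derivatives of `f` are bounded by `g`, up to powers of the loss factor: `n` of them, and
`l` more for each derivative. -/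
def SB (g : ℕ → ℝ → ℝ → ℝ) (l : ℕ) : ℕ → ℕ → (ℝ → ℝ → ℝ → ℝ) → Prop
  | 0, n, f => ∃ C, ∀ ε t r, d.Reg ε t r → |f ε t r| ≤ C * d.loss ε t ^ n * g 0 t r
  | k + 1, n, f => (∃ C, ∀ ε t r, d.Reg ε t r → |f ε t r| ≤ C * d.loss ε t ^ n * g 0 t r) ∧
      SB (fun i => g (i + 1)) l k (n + l) (dr f)

/-- Symbols of order `n`, with weight `g` and a loss of `l` for each derivative. -/
structure Symb (g : ℕ → ℝ → ℝ → ℝ) (l n : ℕ) (f : ℝ → ℝ → ℝ → ℝ) : Prop where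
  sm : d.Sm f
  bd : ∀ k, d.SB g l k n f

variable {d}

theorem isWeight_unit : IsWeight unitWeight := ⟨fun _ _ _ => zero_le_one, fun _ _ _ => le_rfl⟩

theorem IsWeight.shift {g : ℕ → ℝ → ℝ → ℝ} (hg : IsWeight g) : IsWeight fun i => g (i + 1) :=
  ⟨fun i => hg.nonneg (i + 1), fun i => hg.mono (i + 1)⟩

theorem cut_pos {ε : ℝ} (hε : 0 < ε) : 0 < d.cut ε := Real.rpow_pos_of_pos hε _

theorem cut_le_one (ha : d.a < 1) {ε : ℝ} (hε : 0 < ε) (hε1 : ε ≤ 1) : d.cut ε ≤ 1 :=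
  Real.rpow_le_one hε.le hε1 (by linarith)

theorem one_le_loss (ha : d.a < 1) {ε t : ℝ} (hε : 0 < ε) (hε1 : ε ≤ 1) (ht : 0 ≤ t) :
    1 ≤ d.loss ε t := by
  rw [loss, one_le_div (cut_pos hε)]
  linarith [cut_le_one ha hε hε1]

theorem Reg.one_le_loss (ha : d.a < 1) {ε t r : ℝ} (h : d.Reg ε t r) : 1 ≤ d.loss ε t :=
  Data.one_le_loss ha h.pos h.le_one h.nonneg

/-! #### Smoothness -/

theorem isOpen_strip : IsOpen ((univ : Set ℝ) ×ˢ Ioi d.ρ₀) := isOpen_univ.prod isOpen_Ioi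

theorem Sm.contDiffAt {f} (hf : d.Sm f) {ε t r : ℝ} (hε : 0 < ε) (hr : d.ρ₀ < r) :
    ContDiffAt ℝ ∞ (fun q : ℝ × ℝ => f ε q.1 q.2) (t, r) :=
  (hf ε hε).contDiffAt (isOpen_strip.mem_nhds ⟨mem_univ _, hr⟩)

theorem Sm.contDiffAt_radial {f} (hf : d.Sm f) {ε t r : ℝ} (hε : 0 < ε) (hr : d.ρ₀ < r) :
    ContDiffAt ℝ ∞ (f ε t) r :=
  (hf.contDiffAt hε hr (t := t)).comp r (contDiffAt_const.prodMk contDiffAt_id)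

theorem Sm.hasDerivAt {f} (hf : d.Sm f) {ε t r : ℝ} (hε : 0 < ε) (hr : d.ρ₀ < r) :
    HasDerivAt (f ε t) (dr f ε t r) r :=
  ((hf.contDiffAt_radial hε hr).differentiableAt (by simp)).hasDerivAt

theorem Sm.dr {f} (hf : d.Sm f) : d.Sm (dr f) := by
  intro ε hε
  have h1 : ContDiffOn ℝ ∞ (fun q : ℝ × ℝ =>
      fderiv ℝ (fun q : ℝ × ℝ => f ε q.1 q.2) q ((0 : ℝ), (1 : ℝ))) (univ ×ˢ Ioi d.ρ₀) :=
    ((hf ε hε).fderiv_of_isOpen isOpen_strip (by simp)).clm_apply contDiffOn_const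
  refine h1.congr ?_
  rintro ⟨t, r⟩ ⟨-, hr⟩
  have h2 := ((hf.contDiffAt hε hr (t := t)).differentiableAt (by simp)).hasFDerivAt
  have h3 : HasDerivAt (fun r' : ℝ => (t, r')) ((0 : ℝ), (1 : ℝ)) r :=
    (hasDerivAt_const r t).prodMk (hasDerivAt_id r)
  exact (h2.comp_hasDerivAt r h3).deriv

theorem Sm.add {f g} (hf : d.Sm f) (hg : d.Sm g) : d.Sm fun ε t r => f ε t r + g ε t r :=
  fun ε hε => (hf ε hε).add (hg ε hε)

theorem Sm.mul {f g} (hf : d.Sm f) (hg : d.Sm g) : d.Sm fun ε t r => f ε t r * g ε t r :=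
  fun ε hε => (hf ε hε).mul (hg ε hε)

theorem Sm.congr {f g} (hf : d.Sm f) (h : ∀ ε t r, 0 < ε → d.ρ₀ < r → g ε t r = f ε t r) :
    d.Sm g :=
  fun ε hε => (hf ε hε).congr fun q hq => h ε q.1 q.2 hε hq.2

theorem Sm.comp {X : ℝ → ℝ} {f} (hX : ContDiff ℝ ∞ X) (hf : d.Sm f) :
    d.Sm fun ε t r => X (f ε t r) :=
  fun ε hε => hX.comp_contDiffOn (hf ε hε)

theorem Sm.param (c : ℝ → ℝ) : d.Sm fun ε _ _ => c ε := fun _ _ => contDiffOn_const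

theorem Sm.time : d.Sm fun _ t _ => t := fun _ _ => contDiffOn_fst

theorem Sm.radial {f : ℝ → ℝ} (hf : ContDiffOn ℝ ∞ f (Ioi d.ρ₀)) : d.Sm fun _ _ => f :=
  fun _ _ => hf.comp contDiffOn_snd fun _ hq => hq.2

/-! #### Bounds -/

theorem SB.bound {g : ℕ → ℝ → ℝ → ℝ} {l k n : ℕ} {f} (h : d.SB g l k n f) :
    ∃ C, ∀ ε t r, d.Reg ε t r → |f ε t r| ≤ C * d.loss ε t ^ n * g 0 t r := by
  cases k with
  | zero => exact h
  | succ k => exact h.1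

theorem SB.of_succ {g : ℕ → ℝ → ℝ → ℝ} {l k n : ℕ} {f} (h : d.SB g l (k + 1) n f) :
    d.SB g l k n f := by
  induction k generalizing g n f with
  | zero => exact h.1
  | succ k ih => exact ⟨h.1, ih h.2⟩

theorem SB.congr {g : ℕ → ℝ → ℝ → ℝ} {l k n : ℕ} {f f'} (h : d.SB g l k n f)
    (he : ∀ ε t r, 0 < ε → d.ρ₀ < r → f' ε t r = f ε t r) : d.SB g l k n f' := by
  have hb : (∃ C, ∀ ε t r, d.Reg ε t r → |f' ε t r| ≤ C * d.loss ε t ^ n * g 0 t r) := by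
    obtain ⟨C, hC⟩ := h.bound
    exact ⟨C, fun ε t r hr => by rw [he ε t r hr.pos hr.ocean]; exact hC ε t r hr⟩
  induction k generalizing g n f f' with
  | zero => exact hb
  | succ k ih =>
    have he' : ∀ ε t r, 0 < ε → d.ρ₀ < r → dr f' ε t r = dr f ε t r := by
      intro ε t r hε hr
      refine Filter.EventuallyEq.deriv_eq ?_
      filter_upwards [lt_mem_nhds hr] with s hs
      exact he ε t s hε hs
    refine ⟨hb, ih h.2 he' ?_⟩
    obtain ⟨C, hC⟩ := h.2.bound
    exact ⟨C, fun ε t r hr => by rw [he' ε t r hr.pos hr.ocean]; exact hC ε t r hr⟩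

theorem bound_mono (ha : d.a < 1) {g g' : ℝ → ℝ → ℝ} {n m : ℕ} (hnm : n ≤ m)
    (hgg : ∀ t r, 0 ≤ t → d.ρ₀ < r → g t r ≤ g' t r) (hg : ∀ t r, 0 ≤ g t r) {f : ℝ → ℝ → ℝ → ℝ}
    (h : ∃ C, ∀ ε t r, d.Reg ε t r → |f ε t r| ≤ C * d.loss ε t ^ n * g t r) :
    ∃ C, ∀ ε t r, d.Reg ε t r → |f ε t r| ≤ C * d.loss ε t ^ m * g' t r := by
  obtain ⟨C, hC⟩ := h
  refine ⟨|C|, fun ε t r hr => (hC ε t r hr).trans ?_⟩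
  have hw := hr.one_le_loss ha
  have hw0 : 0 ≤ d.loss ε t := zero_le_one.trans hw
  exact mul_le_mul (mul_le_mul (le_abs_self C) (pow_le_pow_right₀ hw hnm) (by positivity)
    (by positivity)) (hgg t r hr.nonneg hr.ocean) (hg t r) (by positivity)

theorem SB.mono (ha : d.a < 1) {g g' : ℕ → ℝ → ℝ → ℝ} (hg : ∀ i t r, 0 ≤ g i t r)
    (hgg : ∀ i t r, 0 ≤ t → d.ρ₀ < r → g i t r ≤ g' i t r) {l l' : ℕ} (hl : l ≤ l') {k n m : ℕ}
    (hnm : n ≤ m) {f} (h : d.SB g l k n f) : d.SB g' l' k m f := by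
  induction k generalizing g g' n m f with
  | zero => exact bound_mono ha hnm (hgg 0) (hg 0) h
  | succ k ih =>
    exact ⟨bound_mono ha hnm (hgg 0) (hg 0) h.1,
      ih (fun i => hg (i + 1)) (fun i => hgg (i + 1)) (add_le_add hnm hl) h.2⟩

theorem SB.add {g : ℕ → ℝ → ℝ → ℝ} {l k n : ℕ} {f f'} (hf : d.Sm f) (hf' : d.Sm f')
    (h : d.SB g l k n f) (h' : d.SB g l k n f') : d.SB g l k n fun ε t r => f ε t r + f' ε t r := by
  have hb : ∃ C, ∀ ε t r, d.Reg ε t r → |f ε t r + f' ε t r| ≤ C * d.loss ε t ^ n * g 0 t r := by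
    obtain ⟨C, hC⟩ := h.bound
    obtain ⟨C', hC'⟩ := h'.bound
    refine ⟨C + C', fun ε t r hr => (abs_add_le _ _).trans ?_⟩
    rw [add_mul, add_mul]
    exact add_le_add (hC ε t r hr) (hC' ε t r hr)
  induction k generalizing g n f f' with
  | zero => exact hb
  | succ k ih =>
    have he : ∀ ε t r, 0 < ε → d.ρ₀ < r →
        dr (fun ε t r => f ε t r + f' ε t r) ε t r = dr f ε t r + dr f' ε t r :=
      fun ε t r hε hr => ((hf.hasDerivAt hε hr).add (hf'.hasDerivAt hε hr)).deriv
    refine ⟨hb, SB.congr (ih hf.dr hf'.dr h.2 h'.2 ?_) he⟩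
    obtain ⟨C, hC⟩ := h.2.bound
    obtain ⟨C', hC'⟩ := h'.2.bound
    refine ⟨C + C', fun ε t r hr => (abs_add_le _ _).trans ?_⟩
    rw [add_mul, add_mul]
    exact add_le_add (hC ε t r hr) (hC' ε t r hr)

/-- Leibniz rule, by induction on the number of derivatives. Only one factor carries the weight of
the initial velocity; the other must be bounded up to losses, because a product of two weights is
not a weight. -/
theorem SB.mul (ha : d.a < 1) {g : ℕ → ℝ → ℝ → ℝ} (hg : IsWeight g) {l k n m : ℕ} {f f'}
    (hf : d.Sm f) (hf' : d.Sm f') (h : d.SB unitWeight l k n f) (h' : d.SB g l k m f') :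
    d.SB g l k (n + m) fun ε t r => f ε t r * f' ε t r := by
  have hb : ∃ C, ∀ ε t r, d.Reg ε t r →
      |f ε t r * f' ε t r| ≤ C * d.loss ε t ^ (n + m) * g 0 t r := by
    obtain ⟨C, hC⟩ := h.bound
    obtain ⟨C', hC'⟩ := h'.bound
    refine ⟨C * C', fun ε t r hr => ?_⟩
    have h1 := hC ε t r hr
    simp only [unitWeight, mul_one] at h1
    calc |f ε t r * f' ε t r| = |f ε t r| * |f' ε t r| := abs_mul _ _
      _ ≤ (C * d.loss ε t ^ n) * (C' * d.loss ε t ^ m * g 0 t r) :=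
        mul_le_mul h1 (hC' ε t r hr) (abs_nonneg _) ((abs_nonneg _).trans h1)
      _ = _ := by ring
  induction k generalizing g n m f f' with
  | zero => exact hb
  | succ k ih =>
    have he : ∀ ε t r, 0 < ε → d.ρ₀ < r → dr (fun ε t r => f ε t r * f' ε t r) ε t r =
        dr f ε t r * f' ε t r + f ε t r * dr f' ε t r :=
      fun ε t r hε hr => ((hf.hasDerivAt hε hr).mul (hf'.hasDerivAt hε hr)).deriv
    -- When the derivative falls on the unweighted factor, the other one keeps its lower weight,
    -- which is raised to the next one by monotonicity.
    have hshift : d.SB (fun i => g (i + 1)) l k m f' :=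
      h'.of_succ.mono ha hg.nonneg (fun i t r _ _ => hg.mono i t r) le_rfl le_rfl
    have key : ∀ {n m f f'}, d.Sm f → d.Sm f' → d.SB unitWeight l k n f →
        d.SB (fun i => g (i + 1)) l k m f' →
        d.SB (fun i => g (i + 1)) l k (n + m) fun ε t r => f ε t r * f' ε t r := by
      intro n m f f' hf hf' h h'
      refine ih hg.shift hf hf' h h' ?_
      obtain ⟨C, hC⟩ := h.bound
      obtain ⟨C', hC'⟩ := h'.bound
      refine ⟨C * C', fun ε t r hr => ?_⟩
      have h1 := hC ε t r hr
      simp only [unitWeight, mul_one] at h1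
      calc |f ε t r * f' ε t r| = |f ε t r| * |f' ε t r| := abs_mul _ _
        _ ≤ (C * d.loss ε t ^ n) * (C' * d.loss ε t ^ m * g (0 + 1) t r) :=
          mul_le_mul h1 (hC' ε t r hr) (abs_nonneg _) ((abs_nonneg _).trans h1)
        _ = _ := by ring
    have h1 := key hf.dr hf' h.2 hshift
    have h2 := key hf hf'.dr h.of_succ h'.2
    refine ⟨hb, SB.congr (SB.add (hf.dr.mul hf') (hf.mul hf'.dr) ?_ ?_) he⟩
    · convert h1 using 1; ring
    · convert h2 using 1; ring

/-! #### The algebra of symbols -/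

namespace Symb

variable {g : ℕ → ℝ → ℝ → ℝ} {l n m : ℕ} {f f' : ℝ → ℝ → ℝ → ℝ}

theorem mono (ha : d.a < 1) (h : d.Symb g l n f) {g' : ℕ → ℝ → ℝ → ℝ}
    (hg : ∀ i t r, 0 ≤ g i t r) (hgg : ∀ i t r, 0 ≤ t → d.ρ₀ < r → g i t r ≤ g' i t r) {l' m : ℕ}
    (hl : l ≤ l') (hnm : n ≤ m) : d.Symb g' l' m f :=
  ⟨h.sm, fun k => (h.bd k).mono ha hg hgg hl hnm⟩

theorem mono_order (ha : d.a < 1) (h : d.Symb g l n f) (hg : IsWeight g) {l' m : ℕ} (hl : l ≤ l')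
    (hnm : n ≤ m) : d.Symb g l' m f :=
  h.mono ha hg.nonneg (fun _ _ _ _ _ => le_rfl) hl hnm

theorem shift (ha : d.a < 1) (h : d.Symb g l n f) (hg : IsWeight g) :
    d.Symb (fun i => g (i + 1)) l n f :=
  h.mono ha hg.nonneg (fun i t r _ _ => hg.mono i t r) le_rfl le_rfl

theorem congr (h : d.Symb g l n f) (he : ∀ ε t r, 0 < ε → d.ρ₀ < r → f' ε t r = f ε t r) :
    d.Symb g l n f' :=
  ⟨h.sm.congr he, fun k => (h.bd k).congr he⟩

theorem add (h : d.Symb g l n f) (h' : d.Symb g l n f') :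
    d.Symb g l n fun ε t r => f ε t r + f' ε t r :=
  ⟨h.sm.add h'.sm, fun k => SB.add h.sm h'.sm (h.bd k) (h'.bd k)⟩

theorem mul (ha : d.a < 1) (hg : IsWeight g) (h : d.Symb unitWeight l n f)
    (h' : d.Symb g l m f') : d.Symb g l (n + m) fun ε t r => f ε t r * f' ε t r :=
  ⟨h.sm.mul h'.sm, fun k => SB.mul ha hg h.sm h'.sm (h.bd k) (h'.bd k)⟩

theorem dr (h : d.Symb g l n f) : d.Symb (fun i => g (i + 1)) l (n + l) (dr f) :=
  ⟨h.sm.dr, fun k => (h.bd (k + 1)).2⟩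

theorem of_bound (hsm : d.Sm f)
    (hb : ∃ C, ∀ ε t r, d.Reg ε t r → |f ε t r| ≤ C * d.loss ε t ^ n * g 0 t r)
    (hd : ∀ k, d.SB (fun i => g (i + 1)) l k (n + l) (Data.dr f)) : d.Symb g l n f :=
  ⟨hsm, fun k => by
    cases k with
    | zero => exact hb
    | succ k => exact ⟨hb, hd k⟩⟩

/-- A family which depends on `ε` and `t` only. -/
theorem of_const {c : ℝ → ℝ → ℝ} (hsm : d.Sm fun ε t _ => c ε t)
    (hb : ∃ C, ∀ ε t r, d.Reg ε t r → |c ε t| ≤ C * d.loss ε t ^ n) :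
    d.Symb unitWeight l n fun ε t _ => c ε t := by
  have h0 : ∀ k m, d.SB unitWeight l k m fun _ _ _ => 0 := by
    intro k
    induction k with
    | zero => exact fun m => ⟨0, fun ε t r _ => by simp⟩
    | succ k ih =>
      intro m
      refine ⟨⟨0, fun ε t r _ => by simp⟩, ?_⟩
      refine SB.congr (ih (m + l)) fun ε t r _ _ => ?_
      simp [Data.dr]
  refine of_bound hsm ?_ fun k => ?_
  · obtain ⟨C, hC⟩ := hb
    exact ⟨C, fun ε t r hr => by simpa [unitWeight] using hC ε t r hr⟩
  · refine SB.congr (h0 k _) fun ε t r _ _ => ?_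
    simp [Data.dr]

theorem const (c : ℝ) : d.Symb unitWeight l 0 fun _ _ _ => c :=
  of_const (Sm.param fun _ => c) ⟨|c|, fun ε t r _ => by simp⟩

theorem const_mul (ha : d.a < 1) (hg : IsWeight g) (c : ℝ) (h : d.Symb g l n f) :
    d.Symb g l n fun ε t r => c * f ε t r := by
  have := mul ha hg (const c) h
  rwa [zero_add] at this

theorem time (ha : d.a < 1) : d.Symb unitWeight l 1 fun _ t _ => t := by
  refine of_const Sm.time ⟨1, fun ε t r hr => ?_⟩
  rw [abs_of_nonneg hr.nonneg, one_mul, pow_one, loss, le_div_iff₀ (cut_pos hr.pos)]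
  nlinarith [cut_le_one ha hr.pos hr.le_one, hr.nonneg, cut_pos (d := d) hr.pos]

theorem inv_cut : d.Symb unitWeight l 1 fun ε _ _ => (d.cut ε)⁻¹ := by
  refine of_const (Sm.param fun ε => (d.cut ε)⁻¹) ⟨1, fun ε t r hr => ?_⟩
  rw [abs_of_pos (inv_pos.2 (cut_pos hr.pos)), one_mul, pow_one, loss, div_eq_mul_inv]
  exact le_mul_of_one_le_left (inv_pos.2 (cut_pos hr.pos)).le (by linarith [hr.nonneg])

/-- Radial functions with bounded derivatives. -/
theorem radial {f : ℝ → ℝ} (hf : ContDiffOn ℝ ∞ f (Ioi d.ρ₀))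
    (hb : ∀ j, ∃ C, ∀ r, d.ρ₀ < r → |deriv^[j] f r| ≤ C) : d.Symb unitWeight 0 0 fun _ _ => f := by
  refine ⟨Sm.radial hf, fun k => ?_⟩
  induction k generalizing f with
  | zero =>
    obtain ⟨C, hC⟩ := hb 0
    exact ⟨C, fun ε t r hr => by simpa [unitWeight] using hC r hr.ocean⟩
  | succ k ih =>
    obtain ⟨C, hC⟩ := hb 0
    refine ⟨⟨C, fun ε t r hr => by simpa [unitWeight] using hC r hr.ocean⟩, ?_⟩
    exact ih (hf.deriv_of_isOpen isOpen_Ioi (by simp)) fun j => hb (j + 1)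

/-- Composition with a smooth function. -/
theorem comp (ha : d.a < 1) {A : Set ℝ} {X : ℝ → ℝ} (hX : ContDiff ℝ ∞ X)
    (hXb : ∀ j, ∃ C, ∀ y ∈ A, |deriv^[j] X y| ≤ C) (hf : d.Sm f)
    (hfd : d.Symb unitWeight l l (Data.dr f)) (hA : ∀ ε t r, d.Reg ε t r → f ε t r ∈ A) :
    d.Symb unitWeight l 0 fun ε t r => X (f ε t r) := by
  refine ⟨Sm.comp hX hf, fun k => ?_⟩
  induction k generalizing X with
  | zero =>
    obtain ⟨C, hC⟩ := hXb 0
    exact ⟨C, fun ε t r hr => by simpa [unitWeight] using hC _ (hA ε t r hr)⟩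
  | succ k ih =>
    obtain ⟨C, hC⟩ := hXb 0
    refine ⟨⟨C, fun ε t r hr => by simpa [unitWeight] using hC _ (hA ε t r hr)⟩, ?_⟩
    have hX' : ContDiff ℝ ∞ (deriv X) := (contDiff_infty_iff_deriv.1 hX).2
    -- Chain rule (X ∘ f)' = (X' ∘ f) f': the induction hypothesis is applied to X', whose
    -- derivatives are bounded on A as well.
    have h1 := SB.mul ha isWeight_unit (Sm.comp hX' hf) hf.dr
      (ih hX' fun j => hXb (j + 1)) (hfd.bd k)
    refine SB.congr h1 fun ε t r hε hr => ?_
    exact ((hX.differentiable (by simp) _).hasDerivAt.comp r (hf.hasDerivAt hε hr)).deriv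

end Symb

end Symbols

end Data

end Ekman

end

/-! ### Symbols of the depth, of the pumping coefficient and of the truncated velocity. -/

noncomputable section

namespace Ekman

namespace Data

variable {d : Data}

/-! ### The symbols of the construction -/

/-- A smooth function with bounded derivatives on the ocean. -/
structure IsFloor (d : Data) (ψ : ℝ → ℝ) : Prop where
  smooth : ContDiffOn ℝ ∞ ψ (Ioi d.ρ₀)
  bounded : ∀ j, ∃ C, ∀ r, d.ρ₀ < r → |deriv^[j] ψ r| ≤ C

/-- The flat floor stands for the surface z = 0, so that surface and bottom layers fall under the
same estimates. -/
theorem IsFloor.zero : d.IsFloor fun _ => 0 := by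
  refine ⟨contDiffOn_const, fun j => ⟨0, fun r _ => ?_⟩⟩
  have : deriv^[j] (fun _ : ℝ => (0 : ℝ)) = fun _ => 0 := by
    induction j with
    | zero => rfl
    | succ j ih => rw [Function.iterate_succ_apply', ih]; simp
  rw [this, abs_zero]

theorem Admissible.isFloor (hd : d.Admissible) : d.IsFloor d.φ := by
  refine ⟨hd.depth.smooth.mono Ioi_subset_Ici_self, fun j => ?_⟩
  obtain ⟨C, hC⟩ := hd.depth.bounded j
  refine ⟨C, fun r hr => ?_⟩
  have h1 : iteratedDerivWithin j d.φ (Ici d.ρ₀) r = iteratedDeriv j d.φ r := by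
    rw [← iteratedDerivWithin_univ]
    have h2 : Ici d.ρ₀ =ᶠ[𝓝 r] univ := eventuallyEq_univ.2 (Ici_mem_nhds hr)
    rw [iteratedDerivWithin, iteratedDerivWithin, iteratedFDerivWithin_congr_set h2]
  rw [← iteratedDeriv_eq_iterate, ← h1]
  exact hC r (le_of_lt hr)

/-- The power `(1 + ψ'²)^p`. -/
def metric (ψ : ℝ → ℝ) (p r : ℝ) : ℝ := (1 + deriv ψ r ^ 2) ^ p

theorem metric_pos (ψ : ℝ → ℝ) (p r : ℝ) : 0 < metric ψ p r :=
  Real.rpow_pos_of_pos (by positivity) p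

theorem metric_rpow (ψ : ℝ → ℝ) (p q r : ℝ) : metric ψ p r ^ q = metric ψ (p * q) r := by
  rw [metric, metric, ← Real.rpow_mul (by positivity)]

theorem one_le_metric (ψ : ℝ → ℝ) {p : ℝ} (hp : 0 ≤ p) (r : ℝ) : 1 ≤ metric ψ p r :=
  Real.one_le_rpow (by nlinarith [sq_nonneg (deriv ψ r)]) hp

theorem exists_bound_iterate_deriv {X : ℝ → ℝ} (hX : ContDiff ℝ ∞ X) {A : Set ℝ}
    (hA : IsCompact A) (j : ℕ) : ∃ C, ∀ y ∈ A, |deriv^[j] X y| ≤ C := by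
  have h : Continuous (deriv^[j] X) := by
    rw [← iteratedDeriv_eq_iterate]
    exact hX.continuous_iteratedDeriv j (by exact_mod_cast le_top)
  exact hA.exists_bound_of_continuousOn h.continuousOn

theorem IsFloor.slope {ψ : ℝ → ℝ} (hψ : d.IsFloor ψ) :
    d.Symb unitWeight 0 0 fun _ _ => deriv ψ :=
  (Symb.radial hψ.smooth hψ.bounded).dr

/-- The slope ψ' stays in a compact interval, on which y ↦ (1 + y²)^p has bounded derivatives of
every order. -/
theorem IsFloor.metric (ha : d.a < 1) {ψ : ℝ → ℝ} (hψ : d.IsFloor ψ) (p : ℝ) :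
    d.Symb unitWeight 0 0 fun _ _ => metric ψ p := by
  obtain ⟨M, hM⟩ := hψ.bounded 1
  have hX : ContDiff ℝ ∞ fun y : ℝ => (1 + y ^ 2) ^ p :=
    ContDiff.rpow_const_of_ne (by fun_prop) fun y => by positivity
  exact Symb.comp (f := fun _ _ => deriv ψ) ha (A := Icc (-M) M) hX
    (exists_bound_iterate_deriv hX isCompact_Icc) hψ.slope.sm hψ.slope.dr
    fun ε t r hr => abs_le.1 (hM r hr.ocean)

/-- The decay rate in time. -/
def rate (d : Data) : ℝ := √(2 * d.β) / d.H

/-- The weights adapted to the initial velocity. -/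
def weight (d : Data) (i : ℕ) (t r : ℝ) : ℝ :=
  Real.exp (-(d.rate * t)) * ∑ l ∈ Finset.range (i + 1), |deriv^[l] d.u₀ r|

theorem isWeight_weight : IsWeight d.weight := by
  refine ⟨fun i t r => ?_, fun i t r => ?_⟩
  · unfold weight; positivity
  · refine mul_le_mul_of_nonneg_left ?_ (Real.exp_pos _).le
    rw [Finset.sum_range_succ _ (i + 1)]
    exact le_add_of_nonneg_right (abs_nonneg _)

namespace Admissible

variable (hd : d.Admissible)
include hd

theorem rate_pos : 0 < d.rate := div_pos (Real.sqrt_pos.2 (by linarith [hd.β_pos])) hd.H_pos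

theorem phi_pos {r : ℝ} (hr : d.ρ₀ < r) : 0 < d.φ r :=
  lt_of_le_of_ne (hd.depth.mem_Icc r hr.le).1 fun h =>
    hr.ne' ((hd.depth.eq_zero_iff r hr.le).1 h.symm)

theorem phi_le {r : ℝ} (hr : d.ρ₀ < r) : d.φ r ≤ d.H := (hd.depth.mem_Icc r hr.le).2

theorem symb_phi : d.Symb unitWeight 0 0 fun _ _ => d.φ :=
  Symb.radial hd.isFloor.smooth hd.isFloor.bounded

/-- In the range `Reg` the depth is at least 2ε^(1-a), so 1/φ costs one loss factor. The derivatives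
follow inductively from (1/φ)' = −φ'/φ², a product of order two, that is one more loss for each
derivative. -/
theorem symb_inv_phi (ha : d.a < 1) : d.Symb unitWeight 1 1 fun _ _ r => (d.φ r)⁻¹ := by
  have hsm : d.Sm fun _ _ r => (d.φ r)⁻¹ :=
    Sm.radial (hd.isFloor.smooth.inv fun r hr => (hd.phi_pos hr).ne')
  refine ⟨hsm, fun k => ?_⟩
  have hb : ∃ C, ∀ ε t r, d.Reg ε t r →
      |(d.φ r)⁻¹| ≤ C * d.loss ε t ^ 1 * unitWeight 0 t r := by
    refine ⟨1, fun ε t r hr => ?_⟩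
    have hc := cut_pos (d := d) hr.pos
    have hp := hd.phi_pos hr.ocean
    rw [abs_of_pos (inv_pos.2 hp), unitWeight, one_mul, mul_one, pow_one, loss, inv_eq_one_div]
    refine div_le_div₀ (by linarith [hr.nonneg]) (by linarith [hr.nonneg]) hc ?_
    linarith [hr.depth]
  induction k with
  | zero => exact hb
  | succ k ih =>
    refine ⟨hb, ?_⟩
    have hφ : d.SB unitWeight 1 k 0 fun _ _ r => -deriv d.φ r := by
      have := (Symb.const_mul ha isWeight_unit (-1) hd.isFloor.slope).mono_order ha isWeight_unit
        (zero_le_one) le_rfl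
      refine SB.congr (this.bd k) fun ε t r _ _ => ?_
      ring
    have hφs : d.Sm fun _ _ r => -deriv d.φ r := by
      refine (Sm.mul (Sm.param fun _ => -1) hd.isFloor.slope.sm).congr fun ε t r _ _ => ?_
      ring
    have h1 := SB.mul ha isWeight_unit hφs (hsm.mul hsm) hφ
      (SB.mul ha isWeight_unit hsm hsm ih ih)
    refine SB.congr (h1.mono ha (fun _ _ _ => zero_le_one) (fun _ _ _ _ _ => le_rfl) le_rfl
      (by norm_num)) fun ε t r _ hr => ?_
    have h2 : HasDerivAt d.φ (deriv d.φ r) r :=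
      ((hd.isFloor.smooth.contDiffAt (Ioi_mem_nhds hr)).differentiableAt (by simp)).hasDerivAt
    have h3 := (h2.inv (hd.phi_pos hr).ne').deriv
    refine h3.trans ?_
    have := (hd.phi_pos hr).ne'
    field_simp

/-- The cut-off near the shore. -/
theorem symb_cutoff (ha : d.a < 1) :
    d.Symb unitWeight 1 0 fun ε _ r => d.χ (d.φ r / (4 * d.cut ε)) := by
  have h0 : d.Symb unitWeight 1 1 fun ε _ r => d.φ r / (4 * d.cut ε) := by
    have h1 := Symb.const_mul ha isWeight_unit (1 / 4) (Symb.mul ha isWeight_unit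
      ((hd.symb_phi).mono_order ha isWeight_unit (zero_le_one) le_rfl) Symb.inv_cut)
    refine h1.congr fun ε t r hε _ => ?_
    have := (cut_pos (d := d) hε).ne'
    field_simp
  have h0' : d.Symb unitWeight 1 1 (dr fun ε _ r => d.φ r / (4 * d.cut ε)) := by
    have h1 := Symb.const_mul ha isWeight_unit (1 / 4) (Symb.mul ha isWeight_unit
      ((hd.isFloor.slope).mono_order ha isWeight_unit (zero_le_one) le_rfl) Symb.inv_cut)
    refine h1.congr fun ε t r hε hr => ?_
    have := (cut_pos (d := d) hε).ne'
    simp only [dr, deriv_div_const]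
    field_simp
  obtain ⟨b, hb, hχ⟩ := hd.cutoff.support
  refine Symb.comp ha (A := Ici 0) hd.cutoff.smooth (fun j => ?_) h0.sm h0' fun ε t r hr => ?_
  · obtain ⟨C, hC⟩ := exists_bound_iterate_deriv hd.cutoff.smooth (isCompact_Icc (a := 0) (b := 1)) j
    have hz : ∀ j, ∀ y, b < y → deriv^[j] d.χ y = 0 := by
      intro j
      induction j with
      | zero => exact fun y hy => hχ y hy.le
      | succ j ih =>
        intro y hy
        rw [Function.iterate_succ_apply']
        have : deriv^[j] d.χ =ᶠ[𝓝 y] fun _ => 0 := by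
          filter_upwards [lt_mem_nhds hy] with s hs using ih s hs
        rw [this.deriv_eq, deriv_const]
    refine ⟨max C 0, fun y hy => ?_⟩
    by_cases h : b < y
    · rw [hz j y h, abs_zero]; exact le_max_right _ _
    · exact (hC y ⟨hy, by linarith⟩).trans (le_max_left _ _)
  · exact div_nonneg (hd.phi_pos hr.ocean).le (by linarith [cut_pos (d := d) hr.pos])

/-- The geometric factor of the pumping coefficient. -/
theorem symb_factor (ha : d.a < 1) :
    d.Symb unitWeight 0 0 fun _ _ r => (1 + (1 + deriv d.φ r ^ 2) ^ (1 / 4 : ℝ)) / 2 := by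
  have h1 := Symb.const_mul ha isWeight_unit (1 / 2)
    ((Symb.const 1).add (hd.isFloor.metric ha (1 / 4)))
  refine h1.congr fun ε t r _ _ => ?_
  simp only [Data.metric]
  ring

theorem symb_lam (ha : d.a < 1) : d.Symb unitWeight 1 1 fun _ _ => d.lam := by
  have h1 := Symb.const_mul ha isWeight_unit √(2 * d.β)
    (Symb.mul ha isWeight_unit
      ((hd.symb_factor ha).mono_order ha isWeight_unit zero_le_one le_rfl)
      (hd.symb_inv_phi ha))
  refine h1.congr fun ε t r _ _ => ?_
  simp only [lam]
  ring

/-- Both φ ≤ H and (1 + φ'²)^(1/4) ≥ 1 bound the pumping coefficient from below. This uniform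
damping is the source of integrability in time. -/
theorem rate_le_lam {r : ℝ} (hr : d.ρ₀ < r) : d.rate ≤ d.lam r := by
  have h1 : 1 ≤ (1 + (1 + deriv d.φ r ^ 2) ^ (1 / 4 : ℝ)) / 2 := by
    have := one_le_metric d.φ (p := 1 / 4) (by norm_num) r
    simp only [Data.metric] at this
    linarith
  have h2 : d.rate ≤ √(2 * d.β) / d.φ r :=
    div_le_div_of_nonneg_left (Real.sqrt_nonneg _) (hd.phi_pos hr) (hd.phi_le hr)
  exact h2.trans (le_mul_of_one_le_right (hd.rate_pos.le.trans h2) h1)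

theorem contDiffOn_iterate_u₀ (j : ℕ) : ContDiffOn ℝ ∞ (deriv^[j] d.u₀) (Ioi d.ρ₀) := by
  induction j with
  | zero => exact hd.u₀_smooth.mono Ioi_subset_Ici_self
  | succ j ih =>
    rw [Function.iterate_succ_apply']
    exact ih.deriv_of_isOpen isOpen_Ioi (by simp)

/-- Differentiating the exponential brings down tλ', where t costs one loss factor and λ' two: hence
three losses for each derivative. The induction runs over all u₀^(j) at once, because the derivative
may also fall on u₀^(j) and raise j. -/
theorem symb_uBar (ha : d.a < 1) : d.Symb d.weight 3 0 fun _ => d.uBar := by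
  have hlam := hd.symb_lam ha
  have hexp : d.Sm fun _ t r => Real.exp (-(t * d.lam r)) := by
    refine Sm.comp Real.contDiff_exp ((Sm.mul (Sm.param fun _ => -1)
      (Sm.time.mul hlam.sm)).congr fun ε t r _ _ => ?_)
    ring
  have hsm : ∀ j, d.Sm fun _ t r => deriv^[j] d.u₀ r * Real.exp (-(t * d.lam r)) := fun j =>
    (Sm.radial (hd.contDiffOn_iterate_u₀ j)).mul hexp
  have ht : d.Symb unitWeight 3 3 fun _ t r => -(t * deriv d.lam r) := by
    have h1 : d.Symb unitWeight 1 2 (dr fun _ _ => d.lam) := hlam.dr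
    have h2 := Symb.const_mul ha isWeight_unit (-1) (Symb.mul ha isWeight_unit (Symb.time ha) h1)
    refine (h2.mono_order ha isWeight_unit (by norm_num) (by norm_num)).congr fun ε t r _ _ => ?_
    simp only [dr]; ring
  have key : ∀ k j, d.SB (fun i => d.weight (i + j)) 3 k 0
      fun _ t r => deriv^[j] d.u₀ r * Real.exp (-(t * d.lam r)) := by
    intro k
    induction k with
    | zero =>
      intro j
      refine ⟨1, fun ε t r hr => ?_⟩
      rw [abs_mul, abs_of_pos (Real.exp_pos _), pow_zero, mul_one, one_mul, mul_comm]
      simp only [weight]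
      refine mul_le_mul ?_ ?_ (abs_nonneg _) (Real.exp_pos _).le
      · refine Real.exp_le_exp.2 (neg_le_neg ?_)
        rw [mul_comm]
        exact mul_le_mul_of_nonneg_left (hd.rate_le_lam hr.ocean) hr.nonneg
      · exact Finset.single_le_sum (f := fun l => |deriv^[l] d.u₀ r|) (fun _ _ => abs_nonneg _)
          (by simp)
    | succ k ih =>
      intro j
      have hb := (ih j).bound
      refine ⟨hb, ?_⟩
      have hw : ∀ i t r, 0 ≤ d.weight (i + j) t r := fun i => isWeight_weight.nonneg (i + j)
      have hw' : ∀ i t r, d.weight (i + j) t r ≤ d.weight (i + 1 + j) t r := fun i t r => by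
        have := (isWeight_weight (d := d)).mono (i + j) t r
        rwa [show i + 1 + j = i + j + 1 by ring]
      have h1 : d.SB (fun i => d.weight (i + 1 + j)) 3 k 3
          fun _ t r => deriv^[j + 1] d.u₀ r * Real.exp (-(t * d.lam r)) := by
        have e : (fun i => d.weight (i + 1 + j)) = fun i => d.weight (i + (j + 1)) := by
          funext i; congr 1; ring
        rw [e]
        exact (ih (j + 1)).mono ha (fun i => isWeight_weight.nonneg _) (fun _ _ _ _ _ => le_rfl)
          le_rfl (by norm_num)
      have h2 : d.SB (fun i => d.weight (i + 1 + j)) 3 k 3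
          fun _ t r => -(t * deriv d.lam r) * (deriv^[j] d.u₀ r * Real.exp (-(t * d.lam r))) :=
        SB.mul ha ⟨fun i => isWeight_weight.nonneg _, fun i t r => hw' (i + 1) t r⟩ ht.sm (hsm j)
          (ht.bd k) ((ih j).mono ha hw (fun i t r _ _ => hw' i t r) le_rfl le_rfl)
      refine SB.congr (SB.add (hsm (j + 1)) (ht.sm.mul (hsm j)) h1 h2) fun ε t r hε hr => ?_
      have e1 : HasDerivAt (deriv^[j] d.u₀) (deriv^[j + 1] d.u₀ r) r := by
        rw [Function.iterate_succ_apply']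
        exact (((hd.contDiffOn_iterate_u₀ j).contDiffAt (Ioi_mem_nhds hr)).differentiableAt
          (by simp)).hasDerivAt
      have e2 : HasDerivAt d.lam (deriv d.lam r) r := hlam.sm.hasDerivAt (t := t) hε hr
      have e3 := (e1.mul ((e2.const_mul t).neg.exp)).deriv
      refine e3.trans ?_
      simp only [Pi.neg_apply]
      ring
  exact ⟨hsm 0, fun k => key k 0⟩

theorem symb_uEps (ha : d.a < 1) : d.Symb d.weight 3 0 d.uEps := by
  have h1 := (((Symb.const (l := 1) 1).add
    (Symb.const_mul ha isWeight_unit (-1) (hd.symb_cutoff ha))).mono_order ha isWeight_unit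
    (l' := 3) (by norm_num) le_rfl).mul ha isWeight_weight (hd.symb_uBar ha)
  refine h1.congr fun ε t r _ _ => ?_
  simp only [uEps]
  ring

theorem symb_lam_uEps (ha : d.a < 1) : d.Symb d.weight 3 1 fun ε t r => d.lam r * d.uEps ε t r :=
  ((hd.symb_lam ha).mono_order ha isWeight_unit (by norm_num) le_rfl).mul ha isWeight_weight
    (hd.symb_uEps ha)

end Admissible

end Data

end Ekman

end

/-! ### Estimates on the fluid domain and derivatives of layers along a field. -/

noncomputable section

namespace Ekman

namespace Data

/-! ### Bounds on the domain -/

section Bounds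

variable (d : Data)

/-- `f` is bounded by `g` on `R`, up to `n` powers of the loss factor. -/
def PB (R : ℝ → ℝ → Space → Prop) (n : ℕ) (g f : ℝ → ℝ → Space → ℝ) : Prop :=
  ∃ C, ∀ ε t p, R ε t p → |f ε t p| ≤ C * d.loss ε t ^ n * g ε t p

/-- The range of parameters where one boundary layer is considered. The height above the floor is
`σ z + ψ(ρ)`. -/
structure RegP (σ : ℝ) (ψ : ℝ → ℝ) (ε t : ℝ) (p : Space) : Prop where
  reg : d.Reg ε t (d.rho p.1)
  height : 0 ≤ σ * p.2 + ψ (d.rho p.1)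
  depth : |p.2| ≤ d.H

variable {d} {R : ℝ → ℝ → Space → Prop}

theorem RegP.mem {σ : ℝ} {ψ : ℝ → ℝ} {ε t : ℝ} {p : Space} (h : d.RegP σ ψ ε t p) :
    p.1 ∈ d.ocean := mem_ocean.2 h.reg.ocean

namespace PB

variable {n m : ℕ} {g g' f f' : ℝ → ℝ → Space → ℝ}

theorem congr (h : d.PB R n g f) (he : ∀ ε t p, R ε t p → f' ε t p = f ε t p) : d.PB R n g f' := by
  obtain ⟨C, hC⟩ := h
  exact ⟨C, fun ε t p hp => by rw [he ε t p hp]; exact hC ε t p hp⟩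

theorem mono (hR : ∀ ε t p, R ε t p → 1 ≤ d.loss ε t) (h : d.PB R n g f) (hnm : n ≤ m) (K : ℝ)
    (hg : ∀ ε t p, R ε t p → 0 ≤ g ε t p ∧ g ε t p ≤ K * g' ε t p) : d.PB R m g' f := by
  obtain ⟨C, hC⟩ := h
  refine ⟨|C| * K, fun ε t p hp => (hC ε t p hp).trans ?_⟩
  have hw := hR ε t p hp
  have hw0 : 0 ≤ d.loss ε t := zero_le_one.trans hw
  obtain ⟨h1, h2⟩ := hg ε t p hp
  calc C * d.loss ε t ^ n * g ε t p ≤ |C| * d.loss ε t ^ m * (K * g' ε t p) :=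
        mul_le_mul (mul_le_mul (le_abs_self C) (pow_le_pow_right₀ hw hnm) (by positivity)
          (by positivity)) h2 h1 (by positivity)
    _ = _ := by ring

theorem add (h : d.PB R n g f) (h' : d.PB R n g f') :
    d.PB R n g fun ε t p => f ε t p + f' ε t p := by
  obtain ⟨C, hC⟩ := h
  obtain ⟨C', hC'⟩ := h'
  refine ⟨C + C', fun ε t p hp => (abs_add_le _ _).trans ?_⟩
  rw [add_mul, add_mul]
  exact add_le_add (hC ε t p hp) (hC' ε t p hp)

theorem neg (h : d.PB R n g f) : d.PB R n g fun ε t p => -f ε t p := by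
  obtain ⟨C, hC⟩ := h
  exact ⟨C, fun ε t p hp => by rw [abs_neg]; exact hC ε t p hp⟩

theorem sub (h : d.PB R n g f) (h' : d.PB R n g f') :
    d.PB R n g fun ε t p => f ε t p - f' ε t p :=
  (h.add h'.neg).congr fun _ _ _ _ => sub_eq_add_neg _ _

theorem mul (h : d.PB R n g f) (h' : d.PB R m g' f') :
    d.PB R (n + m) (fun ε t p => g ε t p * g' ε t p) fun ε t p => f ε t p * f' ε t p := by
  obtain ⟨C, hC⟩ := h
  obtain ⟨C', hC'⟩ := h'
  refine ⟨C * C', fun ε t p hp => ?_⟩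
  have h1 := hC ε t p hp
  calc |f ε t p * f' ε t p| = |f ε t p| * |f' ε t p| := abs_mul _ _
    _ ≤ (C * d.loss ε t ^ n * g ε t p) * (C' * d.loss ε t ^ m * g' ε t p) :=
      mul_le_mul h1 (hC' ε t p hp) (abs_nonneg _) ((abs_nonneg _).trans h1)
    _ = _ := by ring

/-- Product with a bounded factor. -/
theorem bmul (h : d.PB R n (fun _ _ _ => 1) f) (h' : d.PB R m g' f') :
    d.PB R (n + m) g' fun ε t p => f ε t p * f' ε t p := by
  have := h.mul h'
  simpa only [one_mul] using this

/-- Product with a bounded factor. -/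
theorem mulb (h : d.PB R n g f) (h' : d.PB R m (fun _ _ _ => 1) f') :
    d.PB R (n + m) g fun ε t p => f ε t p * f' ε t p := by
  have := h.mul h'
  simpa only [mul_one] using this

theorem of_abs_le (K : ℝ) (h : ∀ ε t p, R ε t p → |f ε t p| ≤ K * g ε t p) : d.PB R 0 g f :=
  ⟨K, fun ε t p hp => by rw [pow_zero, mul_one]; exact h ε t p hp⟩

theorem const (c : ℝ) : d.PB R 0 (fun _ _ _ => 1) fun _ _ _ => c :=
  of_abs_le |c| fun _ _ _ _ => by rw [mul_one]

theorem const_mul (c : ℝ) (h : d.PB R n g f) : d.PB R n g fun ε t p => c * f ε t p := by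
  have := (const (d := d) (R := R) c).bmul h
  rwa [zero_add] at this

end PB

/-! ### Weights -/

/-- The weights `exp (-c t) (|u₀| + ... + |u₀⁽ⁱ⁾|)` on the domain. -/
def wt (d : Data) (i : ℕ) (_ t : ℝ) (p : Space) : ℝ := d.weight i t (d.rho p.1)

theorem wt_nonneg (i : ℕ) (ε t : ℝ) (p : Space) : 0 ≤ d.wt i ε t p :=
  isWeight_weight.nonneg _ _ _

theorem wt_mono (i : ℕ) (ε t : ℝ) (p : Space) : d.wt i ε t p ≤ d.wt (i + 1) ε t p :=
  isWeight_weight.mono _ _ _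

/-- The uniform bounds on u₀ and u₀' turn the weight of order one into a constant. In a quadratic
term one factor is estimated in this way, while the other keeps its square integrable weight. -/
theorem Admissible.exists_wt_le (hd : d.Admissible) :
    ∃ C, ∀ ε t (p : Space), 0 ≤ t → p.1 ∈ d.ocean → d.wt 1 ε t p ≤ C := by
  obtain ⟨C, hC0, hC⟩ := hd.exists_bound_u₀
  obtain ⟨C', hC0', hC'⟩ := hd.exists_bound_deriv_u₀
  refine ⟨C + C', fun ε t p ht hp => ?_⟩
  have hr := mem_ocean.1 hp
  rw [wt, weight]
  have h1 : Real.exp (-(d.rate * t)) ≤ 1 :=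
    Real.exp_le_one_iff.2 (neg_nonpos.2 (mul_nonneg hd.rate_pos.le ht))
  have h2 : ∑ l ∈ Finset.range (1 + 1), |deriv^[l] d.u₀ (d.rho p.1)| ≤ C + C' := by
    simp only [Finset.sum_range_succ, Finset.sum_range_zero, zero_add, Function.iterate_zero, id,
      Function.iterate_one]
    exact add_le_add (hC _ hr) (hC' _ hr)
  calc _ ≤ 1 * (C + C') := mul_le_mul h1 h2 (Finset.sum_nonneg fun _ _ => abs_nonneg _) zero_le_one
    _ = _ := one_mul _

/-! ### Coefficients -/

/-- Coefficients `A(ρ) + B(ρ) Δρ`. -/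
def IsCoef (d : Data) (n : ℕ) (c : ℝ → ℝ → Plane → ℝ) : Prop :=
  ∃ A B : ℝ → ℝ → ℝ → ℝ, d.Symb (fun i => d.weight (i + 1)) 3 n A ∧
    d.Symb (fun i => d.weight (i + 1)) 3 n B ∧
    ∀ ε t x, 0 < ε → x ∈ d.ocean → c ε t x = A ε t (d.rho x) + d.curv x * B ε t (d.rho x)

namespace IsCoef

variable {n m : ℕ} {c : ℝ → ℝ → Plane → ℝ}

theorem radial (ha : d.a < 1) {f} (hf : d.Symb d.weight 3 n f) :
    d.IsCoef n fun ε t x => f ε t (d.rho x) := by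
  refine ⟨f, fun ε t r => 0 * f ε t r, hf.shift ha isWeight_weight,
    (hf.const_mul ha isWeight_weight 0).shift ha isWeight_weight, fun ε t x _ _ => ?_⟩
  simp

/-- The formula div(f(ρ)∇ρ) = f'(ρ) + f(ρ)Δρ is why coefficients have two parts, and f' is why their
weights start one derivative higher. -/
theorem divRadial (hd : d.Admissible) (ha : d.a < 1) {f} (hf : d.Symb d.weight 3 n f) :
    d.IsCoef (n + 3) fun ε t x => d.divRadial (f ε t) x := by
  refine ⟨dr f, f, hf.dr, (hf.shift ha isWeight_weight).mono_order ha isWeight_weight.shift le_rfl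
    (by omega), fun ε t x hε hx => ?_⟩
  change d.divRadial (f ε t) x = _
  rw [hd.divRadial_eq hx ((hf.sm.contDiffAt_radial hε (mem_ocean.1 hx)).differentiableAt (by simp))]
  rw [mul_comm (d.curv x)]
  rfl

theorem radial_mul (ha : d.a < 1) {f : ℝ → ℝ} (hf : d.Symb unitWeight 0 0 fun _ _ => f)
    (h : d.IsCoef n c) : d.IsCoef n fun ε t x => f (d.rho x) * c ε t x := by
  obtain ⟨A, B, hA, hB, he⟩ := h
  have hf' := hf.mono_order ha isWeight_unit (l' := 3) (by norm_num) le_rfl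
  have h1 := hf'.mul ha isWeight_weight.shift hA
  have h2 := hf'.mul ha isWeight_weight.shift hB
  rw [zero_add] at h1 h2
  refine ⟨_, _, h1, h2, fun ε t x hε hx => ?_⟩
  simp only [he ε t x hε hx]
  ring

end IsCoef

end Bounds

/-! ### Directional derivatives of the coefficients -/

section Directional

variable {d : Data}

theorem Admissible.hasDerivAt_rho (hd : d.Admissible) {p : Space} (hp : p.1 ∈ d.ocean) (v : Space) :
    HasDerivAt (fun τ : ℝ => d.rho (p + τ • v).1) ⟪∇ d.rho p.1, v.1⟫_ℝ 0 := by
  have h1 : HasDerivAt (fun τ : ℝ => p.1 + τ • v.1) v.1 0 := by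
    simpa using ((hasDerivAt_id (0 : ℝ)).smul_const v.1).const_add p.1
  have h2 : HasFDerivAt d.rho (innerSL ℝ (∇ d.rho p.1)) (p.1 + (0 : ℝ) • v.1) := by
    rw [zero_smul, add_zero]; exact hd.hasFDerivAt_rho hp
  exact h2.comp_hasDerivAt 0 h1

theorem Admissible.hasDerivAt_curv (hd : d.Admissible) {p : Space} (hp : p.1 ∈ d.ocean) (v : Space) :
    HasDerivAt (fun τ : ℝ => d.curv (p + τ • v).1) (fderiv ℝ d.curv p.1 v.1) 0 := by
  have h1 : HasDerivAt (fun τ : ℝ => p.1 + τ • v.1) v.1 0 := by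
    simpa using ((hasDerivAt_id (0 : ℝ)).smul_const v.1).const_add p.1
  have h2 : HasFDerivAt d.curv (fderiv ℝ d.curv p.1) (p.1 + (0 : ℝ) • v.1) := by
    rw [zero_smul, add_zero]
    exact ((hd.contDiffAt_curv hp).differentiableAt (by simp)).hasFDerivAt
  exact h2.comp_hasDerivAt 0 h1

theorem hasDerivAt_height (p v : Space) : HasDerivAt (fun τ : ℝ => (p + τ • v).2) v.2 0 := by
  simpa using ((hasDerivAt_id (0 : ℝ)).mul_const v.2).const_add p.2

theorem Sm.hasDerivAt_comp (hd : d.Admissible) {f} (hf : d.Sm f) {ε : ℝ} (hε : 0 < ε) (t : ℝ)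
    {p : Space} (hp : p.1 ∈ d.ocean) (v : Space) :
    HasDerivAt (fun τ : ℝ => f ε t (d.rho (p + τ • v).1))
      (Data.dr f ε t (d.rho p.1) * ⟪∇ d.rho p.1, v.1⟫_ℝ) 0 := by
  have h := hf.hasDerivAt (t := t) hε (mem_ocean.1 hp)
  have h0 : HasDerivAt (f ε t) (Data.dr f ε t (d.rho p.1)) (d.rho (p + (0 : ℝ) • v).1) := by simpa using h
  exact h0.comp 0 (hd.hasDerivAt_rho hp v)

/-- The family `T` has derivatives in the direction of the field `V`, bounded by `g`. -/
def DB (d : Data) (R : ℝ → ℝ → Space → Prop) (V : ℝ → ℝ → Space → Space) (n : ℕ)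
    (g T : ℝ → ℝ → Space → ℝ) : Prop :=
  ∃ T', d.PB R n g T' ∧ ∀ ε t p, R ε t p →
    HasDerivAt (fun τ : ℝ => T ε t (p + τ • V ε t p)) (T' ε t p) 0

namespace DB

variable {R : ℝ → ℝ → Space → Prop} {V : ℝ → ℝ → Space → Space} {n m : ℕ}
  {g g' T T₁ : ℝ → ℝ → Space → ℝ}

theorem mono (hR : ∀ ε t p, R ε t p → 1 ≤ d.loss ε t) (h : d.DB R V n g T) (hnm : n ≤ m) (K : ℝ)
    (hg : ∀ ε t p, R ε t p → 0 ≤ g ε t p ∧ g ε t p ≤ K * g' ε t p) : d.DB R V m g' T := by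
  obtain ⟨T', h1, h2⟩ := h
  exact ⟨T', h1.mono hR hnm K hg, h2⟩

theorem add (h : d.DB R V n g T) (h₁ : d.DB R V n g T₁) :
    d.DB R V n g fun ε t p => T ε t p + T₁ ε t p := by
  obtain ⟨T', h1, h2⟩ := h
  obtain ⟨T₁', h1', h2'⟩ := h₁
  exact ⟨_, h1.add h1', fun ε t p hp => (h2 ε t p hp).add (h2' ε t p hp)⟩

theorem param_mul (c : ℝ → ℝ) (hc : d.PB R m g' fun ε _ _ => c ε) (h : d.DB R V n g T) :
    d.DB R V (m + n) (fun ε t p => g' ε t p * g ε t p) fun ε t p => c ε * T ε t p := by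
  obtain ⟨T', h1, h2⟩ := h
  exact ⟨_, hc.mul h1, fun ε t p hp => (h2 ε t p hp).const_mul (c ε)⟩

theorem const_mul (c : ℝ) (h : d.DB R V n g T) : d.DB R V n g fun ε t p => c * T ε t p := by
  obtain ⟨T', h1, h2⟩ := h
  exact ⟨_, h1.const_mul c, fun ε t p hp => (h2 ε t p hp).const_mul c⟩

theorem neg (h : d.DB R V n g T) : d.DB R V n g fun ε t p => -T ε t p := by
  obtain ⟨T', h1, h2⟩ := h
  exact ⟨_, h1.neg, fun ε t p hp => (h2 ε t p hp).neg⟩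

theorem sub (h : d.DB R V n g T) (h₁ : d.DB R V n g T₁) :
    d.DB R V n g fun ε t p => T ε t p - T₁ ε t p := by
  obtain ⟨T', h1, h2⟩ := h
  obtain ⟨T₁', h1', h2'⟩ := h₁
  exact ⟨_, h1.sub h1', fun ε t p hp => (h2 ε t p hp).sub (h2' ε t p hp)⟩

end DB

end Directional

/-! ### Layers -/

section Layers

variable {d : Data}

/-- Profiles decaying exponentially at `-∞`. -/
structure IsProfile (g : ℝ → ℝ) : Prop where
  smooth : ContDiff ℝ ∞ g
  bound : ∃ C, ∀ ζ ≤ 0, |g ζ| ≤ C * Real.exp (ζ / 2) ∧ |deriv g ζ| ≤ C * Real.exp (ζ / 2) ∧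
    |ζ * deriv g ζ| ≤ C * Real.exp (ζ / 2)

/-- Smooth cut-off functions, bounded on the half line. -/
structure IsTrunc (X : ℝ → ℝ) : Prop where
  smooth : ContDiff ℝ ∞ X
  bound : ∃ C, ∀ s, 0 ≤ s → |X s| ≤ C ∧ |deriv X s| ≤ C

/-- The height above the floor. -/
def height (d : Data) (σ : ℝ) (ψ : ℝ → ℝ) (p : Space) : ℝ := σ * p.2 + ψ (d.rho p.1)

/-- The boundary layer variable. -/
def fast (d : Data) (σ : ℝ) (ψ : ℝ → ℝ) (ε : ℝ) (p : Space) : ℝ :=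
  -(d.height σ ψ p / (metric ψ (3 / 4) (d.rho p.1) * d.sqrtE ε))

/-- A boundary layer term. -/
def block (d : Data) (σ : ℝ) (ψ : ℝ → ℝ) (X g : ℝ → ℝ) (c : ℝ → ℝ → Plane → ℝ) (ε t : ℝ)
    (p : Space) : ℝ :=
  c ε t p.1 * X (d.height σ ψ p / d.cut ε) * g (d.fast σ ψ ε p)

/-- The exponential weight in the boundary layer. -/
def decay (d : Data) (σ : ℝ) (ψ : ℝ → ℝ) (ε _ : ℝ) (p : Space) : ℝ :=
  Real.exp (d.fast σ ψ ε p / 2)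

theorem Admissible.sqrtE_eq {ε : ℝ} (hε : 0 < ε) : d.sqrtE ε = √(2 * d.β) * ε := by
  rw [sqrtE, Real.sqrt_mul' _ (sq_nonneg ε), Real.sqrt_sq hε.le]

theorem Admissible.sqrtE_pos (hd : d.Admissible) {ε : ℝ} (hε : 0 < ε) : 0 < d.sqrtE ε := by
  rw [Admissible.sqrtE_eq hε]
  exact mul_pos (Real.sqrt_pos.2 (by linarith [hd.β_pos])) hε

/-- The bounds for the directions along which the terms are differentiated. -/
structure IsDir (d : Data) (σ : ℝ) (ψ : ℝ → ℝ) (m : ℕ) (V : ℝ → ℝ → Space → Space) : Prop where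
  radial : d.PB (d.RegP σ ψ) m (fun _ _ _ => 1) fun ε t p => ⟪∇ d.rho p.1, (V ε t p).1⟫_ℝ
  curv : d.PB (d.RegP σ ψ) m (fun _ _ _ => 1) fun ε t p => fderiv ℝ d.curv p.1 (V ε t p).1
  height : d.PB (d.RegP σ ψ) m (fun ε _ _ => ε) fun ε t p =>
    σ * (V ε t p).2 + deriv ψ (d.rho p.1) * ⟪∇ d.rho p.1, (V ε t p).1⟫_ℝ

variable {σ : ℝ} {ψ : ℝ → ℝ} {n m : ℕ} {V : ℝ → ℝ → Space → Space}

theorem RegP.one_le_loss (ha : d.a < 1) (ε t : ℝ) (p : Space) (h : d.RegP σ ψ ε t p) :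
    1 ≤ d.loss ε t := h.reg.one_le_loss ha

theorem RegP.fast_nonpos (hd : d.Admissible) {ε t : ℝ} {p : Space} (h : d.RegP σ ψ ε t p) :
    d.fast σ ψ ε p ≤ 0 :=
  neg_nonpos.2 (div_nonneg h.height
    (mul_pos (metric_pos _ _ _) (hd.sqrtE_pos h.reg.pos)).le)

theorem Symb.pb {g : ℕ → ℝ → ℝ → ℝ} {l : ℕ} {f} (h : d.Symb g l n f) :
    d.PB (d.RegP σ ψ) n (fun _ t p => g 0 t (d.rho p.1)) fun ε t p => f ε t (d.rho p.1) := by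
  obtain ⟨C, hC⟩ := (h.bd 0).bound
  exact ⟨C, fun ε t p hp => hC ε t _ hp.reg⟩

theorem Admissible.pb_curv (hd : d.Admissible) :
    d.PB (d.RegP σ ψ) 0 (fun _ _ _ => 1) fun _ _ p => d.curv p.1 :=
  PB.of_abs_le d.ρ₀⁻¹ fun ε t p hp => by rw [mul_one]; exact hd.abs_curv_le hp.mem

theorem IsCoef.pb (hd : d.Admissible) {c} (h : d.IsCoef n c) :
    d.PB (d.RegP σ ψ) n (d.wt 1) fun ε t p => c ε t p.1 := by
  obtain ⟨A, B, hA, hB, he⟩ := h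
  have h2 := (hd.pb_curv (σ := σ) (ψ := ψ)).bmul hB.pb
  rw [zero_add] at h2
  exact (hA.pb.add h2).congr fun ε t p hp => he ε t p.1 hp.reg.pos hp.mem

/-- Only the radial component of V and the variation of Δρ along V enter, and `IsDir` allows them m
loss factors. Differentiating A or B costs three more and raises the weight to two derivatives of
u₀. -/
theorem IsCoef.db (hd : d.Admissible) (ha : d.a < 1) {c} (h : d.IsCoef n c)
    (hV : d.IsDir σ ψ m V) :
    d.DB (d.RegP σ ψ) V (n + 3 + m) (d.wt 2) fun ε t p => c ε t p.1 := by
  obtain ⟨A, B, hA, hB, he⟩ := h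
  refine ⟨fun ε t p => dr A ε t (d.rho p.1) * ⟪∇ d.rho p.1, (V ε t p).1⟫_ℝ
    + (fderiv ℝ d.curv p.1 (V ε t p).1 * B ε t (d.rho p.1)
      + d.curv p.1 * (dr B ε t (d.rho p.1) * ⟪∇ d.rho p.1, (V ε t p).1⟫_ℝ)), ?_, ?_⟩
  · have hA' : d.PB (d.RegP σ ψ) (n + 3) (d.wt 2) fun ε t p => dr A ε t (d.rho p.1) := hA.dr.pb
    have hB' : d.PB (d.RegP σ ψ) (n + 3) (d.wt 2) fun ε t p => dr B ε t (d.rho p.1) := hB.dr.pb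
    have hB0 : d.PB (d.RegP σ ψ) n (d.wt 1) fun ε t p => B ε t (d.rho p.1) := hB.pb
    have h1 := hA'.mulb hV.radial
    have h2 := (hV.curv.bmul hB0).mono (RegP.one_le_loss ha) (m := n + 3 + m) (by omega) 1
      (g' := d.wt 2) fun ε t p _ => ⟨wt_nonneg _ _ _ _, by rw [one_mul]; exact wt_mono _ _ _ _⟩
    have h3 := (hd.pb_curv (σ := σ) (ψ := ψ)).bmul (hB'.mulb hV.radial)
    rw [zero_add] at h3
    exact h1.add (h2.add h3)
  · intro ε t p hp
    have h1 := hA.sm.hasDerivAt_comp hd hp.reg.pos t hp.mem (V ε t p)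
    have h2 := hB.sm.hasDerivAt_comp hd hp.reg.pos t hp.mem (V ε t p)
    have h3 := h1.add ((hd.hasDerivAt_curv hp.mem (V ε t p)).mul h2)
    simp only [zero_smul, add_zero] at h3
    refine h3.congr_of_eventuallyEq ?_
    have hcont : Tendsto (fun τ : ℝ => (p + τ • V ε t p).1) (𝓝 0) (𝓝 p.1) := by
      have : Continuous (fun τ : ℝ => (p + τ • V ε t p).1) := by fun_prop
      simpa using this.tendsto 0
    filter_upwards [hcont.eventually (isOpen_ocean.mem_nhds hp.mem)] with τ hτ
    exact he ε t _ hp.reg.pos hτ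

variable {X g : ℝ → ℝ} {c : ℝ → ℝ → Plane → ℝ}

theorem IsTrunc.pb (hX : IsTrunc X) :
    d.PB (d.RegP σ ψ) 0 (fun _ _ _ => 1) (fun ε _ p => X (d.height σ ψ p / d.cut ε)) ∧
    d.PB (d.RegP σ ψ) 0 (fun _ _ _ => 1) fun ε _ p => deriv X (d.height σ ψ p / d.cut ε) := by
  obtain ⟨C, hC⟩ := hX.bound
  have h0 : ∀ ε t p, d.RegP σ ψ ε t p → 0 ≤ d.height σ ψ p / d.cut ε := fun ε t p hp =>
    div_nonneg hp.height (cut_pos hp.reg.pos).le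
  exact ⟨PB.of_abs_le C fun ε t p hp => by rw [mul_one]; exact (hC _ (h0 ε t p hp)).1,
    PB.of_abs_le C fun ε t p hp => by rw [mul_one]; exact (hC _ (h0 ε t p hp)).2⟩

theorem IsProfile.pb (hd : d.Admissible) (hg : IsProfile g) :
    d.PB (d.RegP σ ψ) 0 (d.decay σ ψ) (fun ε _ p => g (d.fast σ ψ ε p)) ∧
    d.PB (d.RegP σ ψ) 0 (d.decay σ ψ) (fun ε _ p => deriv g (d.fast σ ψ ε p)) ∧
    d.PB (d.RegP σ ψ) 0 (d.decay σ ψ) fun ε _ p =>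
      d.fast σ ψ ε p * deriv g (d.fast σ ψ ε p) := by
  obtain ⟨C, hC⟩ := hg.bound
  exact ⟨PB.of_abs_le C fun ε t p hp => (hC _ (hp.fast_nonpos hd)).1,
    PB.of_abs_le C fun ε t p hp => (hC _ (hp.fast_nonpos hd)).2.1,
    PB.of_abs_le C fun ε t p hp => (hC _ (hp.fast_nonpos hd)).2.2⟩

theorem block_pb (hd : d.Admissible) (hX : IsTrunc X) (hg : IsProfile g) (hc : d.IsCoef n c) :
    d.PB (d.RegP σ ψ) n (fun ε t p => d.wt 1 ε t p * d.decay σ ψ ε t p)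
      (d.block σ ψ X g c) := by
  have h := ((hc.pb hd (σ := σ) (ψ := ψ)).mulb hX.pb.1).mul (hg.pb hd).1
  rw [add_zero, add_zero] at h
  exact h

/-- The height above the wall varies along V at rate O(ε). This cancels the factor 1/√E produced by
the profile, and leaves at most one extra loss when the cut-off at scale ε^(1-a) is differentiated.
The variation of the layer thickness δ√E produces ζ g'(ζ), which still decays exponentially. -/
theorem block_db (hd : d.Admissible) (ha : d.a < 1) (hψ : d.IsFloor ψ) (hX : IsTrunc X)
    (hg : IsProfile g) (hc : d.IsCoef n c) (hV : d.IsDir σ ψ m V) :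
    d.DB (d.RegP σ ψ) V (n + 3 + m) (fun ε t p => d.wt 2 ε t p * d.decay σ ψ ε t p)
      (d.block σ ψ X g c) := by
  obtain ⟨c', hc', hcd⟩ := hc.db hd ha hV
  let Y : ℝ → ℝ → Space → ℝ := fun ε t p =>
    σ * (V ε t p).2 + deriv ψ (d.rho p.1) * ⟪∇ d.rho p.1, (V ε t p).1⟫_ℝ
  let D : ℝ → ℝ → Space → ℝ := fun ε t p =>
    deriv (metric ψ (3 / 4)) (d.rho p.1) * ⟪∇ d.rho p.1, (V ε t p).1⟫_ℝ
  have hmet := hψ.metric ha (3 / 4)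
  have hsq : 0 < √(2 * d.β) := Real.sqrt_pos.2 (by linarith [hd.β_pos])
  have hR := RegP.one_le_loss (σ := σ) (ψ := ψ) ha
  refine ⟨fun ε t p =>
    (c' ε t p * X (d.height σ ψ p / d.cut ε)
      + c ε t p.1 * (deriv X (d.height σ ψ p / d.cut ε) * (Y ε t p / d.cut ε)))
      * g (d.fast σ ψ ε p)
    + c ε t p.1 * X (d.height σ ψ p / d.cut ε) *
      (deriv g (d.fast σ ψ ε p) * (-(Y ε t p / (metric ψ (3 / 4) (d.rho p.1) * d.sqrtE ε)))
        - d.fast σ ψ ε p * deriv g (d.fast σ ψ ε p) *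
          (D ε t p / metric ψ (3 / 4) (d.rho p.1))), ?_, ?_⟩
  · have hY : d.PB (d.RegP σ ψ) m (fun ε _ _ => ε) Y := hV.height
    have hY1 : d.PB (d.RegP σ ψ) (m + 1) (fun _ _ _ => 1) fun ε t p => Y ε t p / d.cut ε := by
      have h1 := hY.mono hR le_rfl 1 (g' := fun _ _ _ => 1)
        fun ε t p hp => ⟨hp.reg.pos.le, by rw [one_mul]; exact hp.reg.le_one⟩
      have h2 : d.PB (d.RegP σ ψ) 1 (fun _ _ _ => 1) fun ε _ _ => (d.cut ε)⁻¹ :=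
        (Symb.inv_cut (d := d) (l := 0)).pb
      exact (h1.mulb h2).congr fun ε t p _ => div_eq_mul_inv _ _
    have hY2 : d.PB (d.RegP σ ψ) m (fun _ _ _ => 1)
        fun ε t p => -(Y ε t p / (metric ψ (3 / 4) (d.rho p.1) * d.sqrtE ε)) := by
      obtain ⟨C, hC⟩ := hY
      refine ⟨C / √(2 * d.β), fun ε t p hp => ?_⟩
      have h1 := one_le_metric ψ (p := 3 / 4) (by norm_num) (d.rho p.1)
      have hE := hd.sqrtE_pos hp.reg.pos
      rw [abs_neg, abs_div, abs_of_pos (mul_pos (metric_pos _ _ _) hE), mul_one]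
      calc |Y ε t p| / (metric ψ (3 / 4) (d.rho p.1) * d.sqrtE ε)
          ≤ (C * d.loss ε t ^ m * ε) / (1 * d.sqrtE ε) := by
            have := hC ε t p hp
            exact div_le_div₀ ((abs_nonneg _).trans this) this (by linarith)
              (mul_le_mul_of_nonneg_right h1 hE.le)
        _ = C / √(2 * d.β) * d.loss ε t ^ m := by
            rw [one_mul, Admissible.sqrtE_eq hp.reg.pos]
            have := hp.reg.pos.ne'
            field_simp
    have hD : d.PB (d.RegP σ ψ) m (fun _ _ _ => 1)
        fun ε t p => D ε t p / metric ψ (3 / 4) (d.rho p.1) := by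
      have h1 : d.PB (d.RegP σ ψ) 0 (fun _ _ _ => 1)
          fun ε t p => deriv (metric ψ (3 / 4)) (d.rho p.1) := hmet.dr.pb
      have h2 : d.PB (d.RegP σ ψ) 0 (fun _ _ _ => 1)
          fun ε t p => (metric ψ (3 / 4) (d.rho p.1))⁻¹ :=
        PB.of_abs_le 1 fun ε t p _ => by
          rw [abs_of_pos (inv_pos.2 (metric_pos _ _ _)), mul_one]
          exact inv_le_one_of_one_le₀ (one_le_metric ψ (by norm_num) _)
      have h3 := (h1.bmul hV.radial).mulb h2
      rw [zero_add, add_zero] at h3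
      exact h3.congr fun ε t p _ => div_eq_mul_inv _ _
    obtain ⟨hX0, hX1⟩ := hX.pb (d := d) (σ := σ) (ψ := ψ)
    obtain ⟨hg0, hg1, hg2⟩ := hg.pb hd (σ := σ) (ψ := ψ)
    have hc0 := (hc.pb hd (σ := σ) (ψ := ψ)).mono hR le_rfl 1 (g' := d.wt 2)
      fun ε t p _ => ⟨wt_nonneg _ _ _ _, by rw [one_mul]; exact wt_mono _ _ _ _⟩
    have hw : ∀ ε t p, d.RegP σ ψ ε t p → 0 ≤ d.wt 2 ε t p ∧ d.wt 2 ε t p ≤ 1 * d.wt 2 ε t p :=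
      fun ε t p _ => ⟨wt_nonneg _ _ _ _, by rw [one_mul]⟩
    have hl : ∀ ε t p, d.RegP σ ψ ε t p →
        0 ≤ d.decay σ ψ ε t p ∧ d.decay σ ψ ε t p ≤ 1 * d.decay σ ψ ε t p :=
      fun ε t p _ => ⟨(Real.exp_pos _).le, by rw [one_mul]⟩
    have a1 := (hc'.mulb hX0).mono hR (m := n + 3 + m) (by omega) 1 hw
    have a2 := (hc0.mulb (hX1.bmul hY1)).mono hR (m := n + 3 + m) (by omega) 1 hw
    have a3 := (a1.add a2).mul hg0
    have a4 := (hg1.mulb hY2).mono hR (m := m) (by omega) 1 hl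
    have a5 := (hg2.mulb hD).mono hR (m := m) (by omega) 1 hl
    have a6 := (hc0.mulb hX0).mul (a4.sub a5)
    have hwl : ∀ ε t p, d.RegP σ ψ ε t p →
        0 ≤ d.wt 2 ε t p * d.decay σ ψ ε t p ∧
        d.wt 2 ε t p * d.decay σ ψ ε t p ≤ 1 * (d.wt 2 ε t p * d.decay σ ψ ε t p) :=
      fun ε t p _ => ⟨mul_nonneg (wt_nonneg _ _ _ _) (Real.exp_pos _).le, by rw [one_mul]⟩
    exact (a3.mono hR (by omega) 1 hwl).add (a6.mono hR (by omega) 1 hwl)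
  · intro ε t p hp
    have hρ := hd.hasDerivAt_rho hp.mem (V ε t p)
    have hψs : d.Sm fun _ _ => ψ := Sm.radial hψ.smooth
    have hy : HasDerivAt (fun τ : ℝ => d.height σ ψ (p + τ • V ε t p)) (Y ε t p) 0 :=
      ((hasDerivAt_height p (V ε t p)).const_mul σ).add
        (hψs.hasDerivAt_comp hd hp.reg.pos t hp.mem (V ε t p))
    have hm : HasDerivAt (fun τ : ℝ => metric ψ (3 / 4) (d.rho (p + τ • V ε t p).1)) (D ε t p) 0 :=
      hmet.sm.hasDerivAt_comp hd hp.reg.pos t hp.mem (V ε t p)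
    have hE := hd.sqrtE_pos hp.reg.pos
    have hm0 := metric_pos ψ (3 / 4) (d.rho p.1)
    have hf : HasDerivAt (fun τ : ℝ => d.fast σ ψ ε (p + τ • V ε t p))
        (-(Y ε t p / (metric ψ (3 / 4) (d.rho p.1) * d.sqrtE ε))
          - d.fast σ ψ ε p * (D ε t p / metric ψ (3 / 4) (d.rho p.1))) 0 := by
      have h := (hy.div (hm.mul_const (d.sqrtE ε)) (by simpa using (mul_pos hm0 hE).ne')).neg
      refine h.congr_deriv ?_
      simp only [zero_smul, add_zero, fast]
      field_simp
      ring
    have hXd : HasDerivAt (fun τ : ℝ => X (d.height σ ψ (p + τ • V ε t p) / d.cut ε))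
        (deriv X (d.height σ ψ p / d.cut ε) * (Y ε t p / d.cut ε)) 0 := by
      have h0 : HasDerivAt X (deriv X (d.height σ ψ p / d.cut ε))
          (d.height σ ψ (p + (0 : ℝ) • V ε t p) / d.cut ε) := by
        simpa using (hX.smooth.differentiable (by simp) _).hasDerivAt
      exact h0.comp 0 (hy.div_const (d.cut ε))
    have hgd : HasDerivAt (fun τ : ℝ => g (d.fast σ ψ ε (p + τ • V ε t p)))
        (deriv g (d.fast σ ψ ε p) * (-(Y ε t p / (metric ψ (3 / 4) (d.rho p.1) * d.sqrtE ε))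
          - d.fast σ ψ ε p * (D ε t p / metric ψ (3 / 4) (d.rho p.1)))) 0 := by
      have h0 : HasDerivAt g (deriv g (d.fast σ ψ ε p))
          (d.fast σ ψ ε (p + (0 : ℝ) • V ε t p)) := by
        simpa using (hg.smooth.differentiable (by simp) _).hasDerivAt
      exact h0.comp 0 hf
    refine (((hcd ε t p hp).mul hXd).mul hgd).congr_deriv ?_
    simp only [zero_smul, add_zero, Pi.mul_apply]
    ring

end Layers

end Data

end Ekman

end

/-! ### Decay of the boundary layer profiles and bounds on the cut-offs. -/

noncomputable section

namespace Ekman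

namespace Data

variable {d : Data}

/-! ### The profiles of the construction -/

/-- Half of the exponential absorbs polynomial factors: 1 + x ≤ 4 exp(x/4) for x ≥ 0, then square.
The second power of 1 + |ζ| is needed for ζ g'(ζ). -/
theorem IsProfile.of_exp {g : ℝ → ℝ} (hg : ContDiff ℝ ∞ g) {C : ℝ}
    (h0 : ∀ ζ, |g ζ| ≤ C * ((1 + |ζ|) * Real.exp ζ))
    (h1 : ∀ ζ, |deriv g ζ| ≤ C * ((1 + |ζ|) * Real.exp ζ)) : IsProfile g := by
  have hC : 0 ≤ C := by
    have := (abs_nonneg _).trans (h0 0)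
    simpa using this
  have key : ∀ ζ ≤ (0 : ℝ), (1 + |ζ|) ^ 2 * Real.exp ζ ≤ 16 * Real.exp (ζ / 2) := by
    intro ζ hζ
    have e1 : Real.exp (ζ / 2) = Real.exp ζ * Real.exp (-ζ / 4) ^ 2 := by
      rw [← Real.exp_nat_mul, ← Real.exp_add]; congr 1; push_cast; ring
    have e2 : 1 + |ζ| ≤ 4 * Real.exp (-ζ / 4) := by
      have := Real.add_one_le_exp (-ζ / 4)
      rw [abs_of_nonpos hζ]
      linarith
    rw [e1]
    have e3 : (1 + |ζ|) ^ 2 ≤ (4 * Real.exp (-ζ / 4)) ^ 2 :=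
      pow_le_pow_left₀ (by positivity) e2 2
    have := mul_le_mul_of_nonneg_right e3 (Real.exp_pos ζ).le
    linarith
  have key' : ∀ ζ ≤ (0 : ℝ), (1 + |ζ|) * Real.exp ζ ≤ 16 * Real.exp (ζ / 2) := by
    intro ζ hζ
    refine le_trans (mul_le_mul_of_nonneg_right ?_ (Real.exp_pos ζ).le) (key ζ hζ)
    nlinarith [abs_nonneg ζ]
  refine ⟨hg, C * 16, fun ζ hζ => ⟨?_, ?_, ?_⟩⟩
  · rw [mul_assoc]
    exact (h0 ζ).trans (mul_le_mul_of_nonneg_left (key' ζ hζ) hC)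
  · rw [mul_assoc]
    exact (h1 ζ).trans (mul_le_mul_of_nonneg_left (key' ζ hζ) hC)
  · rw [mul_assoc, abs_mul]
    calc |ζ| * |deriv g ζ| ≤ (1 + |ζ|) * (C * ((1 + |ζ|) * Real.exp ζ)) :=
          mul_le_mul (by linarith) (h1 ζ) (abs_nonneg _) (by positivity)
      _ = C * ((1 + |ζ|) ^ 2 * Real.exp ζ) := by ring
      _ ≤ _ := mul_le_mul_of_nonneg_left (key ζ hζ) hC

/-- On [−2, 0] the functions g, g' and ζg' are bounded by continuity, and exp(1 + ζ/2) ≥ 1 there,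
which explains the factor e in the constant. -/
theorem IsProfile.of_support {g : ℝ → ℝ} (hg : ContDiff ℝ ∞ g) (h : ∀ ζ ≤ -2, g ζ = 0) :
    IsProfile g := by
  have hg' : Continuous (deriv g) := hg.continuous_deriv (by simp)
  obtain ⟨A, hA⟩ := isCompact_Icc.exists_bound_of_continuousOn (s := Icc (-2) (0 : ℝ))
    hg.continuous.continuousOn
  obtain ⟨B, hB⟩ := isCompact_Icc.exists_bound_of_continuousOn (s := Icc (-2) (0 : ℝ))
    hg'.continuousOn
  obtain ⟨D, hD⟩ := isCompact_Icc.exists_bound_of_continuousOn (s := Icc (-2) (0 : ℝ))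
    (continuous_id.mul hg').continuousOn
  set M := max (max A B) (max D 0)
  have hM : 0 ≤ M := (le_max_right D 0).trans (le_max_right _ _)
  refine ⟨hg, M * Real.exp 1, fun ζ hζ => ?_⟩
  have hpos : 0 ≤ M * Real.exp 1 * Real.exp (ζ / 2) := by positivity
  by_cases h2 : ζ < -2
  · have hz : g =ᶠ[𝓝 ζ] fun _ => 0 := by
      filter_upwards [gt_mem_nhds h2] with s hs using h s hs.le
    rw [hz.deriv_eq, h ζ h2.le]
    simpa using hpos
  · have hmem : ζ ∈ Icc (-2) (0 : ℝ) := ⟨not_lt.1 h2, hζ⟩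
    have e : M ≤ M * Real.exp 1 * Real.exp (ζ / 2) := by
      rw [mul_assoc, ← Real.exp_add]
      refine le_mul_of_one_le_right hM (Real.one_le_exp ?_)
      linarith [hmem.1]
    exact ⟨((hA ζ hmem).trans ((le_max_left A B).trans (le_max_left _ _))).trans e,
      ((hB ζ hmem).trans ((le_max_right A B).trans (le_max_left _ _))).trans e,
      ((hD ζ hmem).trans ((le_max_left D 0).trans (le_max_right _ _))).trans e⟩

/-- `e^ζ sin ζ` -/
def expSin (ζ : ℝ) : ℝ := Real.exp ζ * Real.sin ζ

/-- `e^ζ cos ζ` -/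
def expCos (ζ : ℝ) : ℝ := Real.exp ζ * Real.cos ζ

/-- `e^ζ (cos ζ - sin ζ)` -/
def expDiff (ζ : ℝ) : ℝ := Real.exp ζ * (Real.cos ζ - Real.sin ζ)

/-- `ζ e^ζ sin ζ` -/
def mulExpSin (ζ : ℝ) : ℝ := ζ * Real.exp ζ * Real.sin ζ

theorem abs_exp_mul_le {ζ y M : ℝ} (hy : |y| ≤ M * (1 + |ζ|)) :
    |Real.exp ζ * y| ≤ M * ((1 + |ζ|) * Real.exp ζ) := by
  rw [abs_mul, abs_of_pos (Real.exp_pos ζ)]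
  have := mul_le_mul_of_nonneg_left hy (Real.exp_pos ζ).le
  linarith

theorem abs_sin_add_cos_le (x y ζ : ℝ) :
    |x * Real.sin ζ + y * Real.cos ζ| ≤ |x| + |y| := by
  refine (abs_add_le _ _).trans ?_
  rw [abs_mul, abs_mul]
  exact add_le_add (mul_le_of_le_one_right (abs_nonneg _) (Real.abs_sin_le_one ζ))
    (mul_le_of_le_one_right (abs_nonneg _) (Real.abs_cos_le_one ζ))

/-- The span of e^ζ sin ζ and e^ζ cos ζ is stable under differentiation, so one bound serves for the
function and its derivative. -/
theorem isProfile_expTrig (x y : ℝ) :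
    IsProfile fun ζ => Real.exp ζ * (x * Real.sin ζ + y * Real.cos ζ) := by
  refine IsProfile.of_exp (C := 2 * (|x| + |y|)) (by fun_prop) (fun ζ => ?_) fun ζ => ?_
  · refine abs_exp_mul_le ((abs_sin_add_cos_le x y ζ).trans ?_)
    nlinarith [abs_nonneg x, abs_nonneg y, abs_nonneg ζ,
      mul_nonneg (add_nonneg (abs_nonneg x) (abs_nonneg y)) (abs_nonneg ζ)]
  · have h : HasDerivAt (fun ζ => Real.exp ζ * (x * Real.sin ζ + y * Real.cos ζ))
        (Real.exp ζ * ((x - y) * Real.sin ζ + (x + y) * Real.cos ζ)) ζ := by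
      refine ((Real.hasDerivAt_exp ζ).mul (((Real.hasDerivAt_sin ζ).const_mul x).add
        ((Real.hasDerivAt_cos ζ).const_mul y))).congr_deriv ?_
      simp only [Pi.add_apply]
      ring
    rw [h.deriv]
    refine abs_exp_mul_le ((abs_sin_add_cos_le _ _ ζ).trans ?_)
    have h1 := abs_sub x y
    have h2 := abs_add_le x y
    nlinarith [abs_nonneg x, abs_nonneg y, abs_nonneg ζ,
      mul_nonneg (add_nonneg (abs_nonneg x) (abs_nonneg y)) (abs_nonneg ζ)]

theorem isProfile_expSin : IsProfile expSin := by
  have h := isProfile_expTrig 1 0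
  have e : (fun ζ => Real.exp ζ * (1 * Real.sin ζ + 0 * Real.cos ζ)) = expSin := by
    funext ζ; simp [expSin]
  rwa [e] at h

theorem isProfile_expCos : IsProfile expCos := by
  have h := isProfile_expTrig 0 1
  have e : (fun ζ => Real.exp ζ * (0 * Real.sin ζ + 1 * Real.cos ζ)) = expCos := by
    funext ζ; simp [expCos]
  rwa [e] at h

theorem isProfile_expDiff : IsProfile expDiff := by
  have h := isProfile_expTrig (-1) 1
  have e : (fun ζ => Real.exp ζ * (-1 * Real.sin ζ + 1 * Real.cos ζ)) = expDiff := by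
    funext ζ; simp only [expDiff]; ring
  rwa [e] at h

theorem isProfile_mulExpSin : IsProfile mulExpSin := by
  refine IsProfile.of_exp (C := 2) (by unfold mulExpSin; fun_prop) (fun ζ => ?_) fun ζ => ?_
  · have e : mulExpSin ζ = Real.exp ζ * (ζ * Real.sin ζ + 0 * Real.cos ζ) := by
      simp only [mulExpSin]; ring
    rw [e]
    refine abs_exp_mul_le ((abs_sin_add_cos_le _ _ ζ).trans ?_)
    rw [abs_zero]
    linarith [abs_nonneg ζ]
  · have h : HasDerivAt mulExpSin (Real.exp ζ * ((1 + ζ) * Real.sin ζ + ζ * Real.cos ζ)) ζ := by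
      refine (((hasDerivAt_id ζ).mul (Real.hasDerivAt_exp ζ)).mul
        (Real.hasDerivAt_sin ζ)).congr_deriv ?_
      simp only [Pi.mul_apply, id]
      ring
    rw [h.deriv]
    refine abs_exp_mul_le ((abs_sin_add_cos_le _ _ ζ).trans ?_)
    have := abs_add_le 1 ζ
    rw [abs_one] at this
    linarith [abs_nonneg ζ]

theorem contDiff_primitive {f : ℝ → ℝ} (hf : ContDiff ℝ ∞ f) :
    ContDiff ℝ ∞ fun ζ => ∫ s in ζ..0, f s := by
  have h : ∀ ζ, HasDerivAt (fun ζ => ∫ s in ζ..0, f s) (-f ζ) ζ := by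
    intro ζ
    have h1 := (hf.continuous.integral_hasStrictDerivAt 0 ζ).hasDerivAt.neg
    refine h1.congr_of_eventuallyEq (Eventually.of_forall fun x => ?_)
    exact intervalIntegral.integral_symm _ _
  refine contDiff_infty_iff_deriv.2 ⟨fun ζ => (h ζ).differentiableAt, ?_⟩
  rw [funext fun ζ => (h ζ).deriv]
  exact hf.neg

/-- For ζ ≤ −2 the interval [ζ, 0] already carries the whole integral, which is zero. This is the
role of the two integral conditions on k: the primitives K₀ and K₁ vanish away from the wall, so
they need no cut-off. -/
theorem primitive_eq_zero {f : ℝ → ℝ} (h0 : ∀ s ≤ -2, f s = 0)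
    (hi : ∫ s in Iic (0 : ℝ), f s = 0) {ζ : ℝ} (hζ : ζ ≤ -2) : ∫ s in ζ..0, f s = 0 := by
  rw [intervalIntegral.integral_of_le (by linarith)]
  refine (setIntegral_eq_of_subset_of_forall_sdiff_eq_zero measurableSet_Iic
    (fun s hs => hs.2) fun s hs => h0 s ?_).symm.trans hi
  by_contra h
  exact hs.2 ⟨by linarith, hs.1⟩

namespace Admissible

variable (hd : d.Admissible)
include hd

theorem k_eq_zero {s : ℝ} (hs : s ≤ -2) : d.k s = 0 := by
  obtain ⟨b, hb, h⟩ := hd.profile.support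
  exact h s (by linarith)

theorem mul_deriv_k_eq_zero {s : ℝ} (hs : s ≤ -2) : s * deriv d.k s = 0 := by
  obtain ⟨b, hb, h⟩ := hd.profile.support
  have hz : d.k =ᶠ[𝓝 s] fun _ => 0 := by
    filter_upwards [gt_mem_nhds (show s < b by linarith)] with x hx using h x (le_of_lt hx)
  rw [hz.deriv_eq, deriv_const, mul_zero]

theorem K0_eq_zero {s : ℝ} (hs : s ≤ -2) : d.K0 s = 0 :=
  primitive_eq_zero (fun _ h => hd.k_eq_zero h) hd.profile.integral_eq_zero hs

theorem K1_eq_zero {s : ℝ} (hs : s ≤ -2) : d.K1 s = 0 :=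
  primitive_eq_zero (fun _ h => hd.mul_deriv_k_eq_zero h) hd.profile.integral_deriv_eq_zero hs

theorem isProfile_k : IsProfile d.k :=
  IsProfile.of_support hd.profile.smooth fun _ h => hd.k_eq_zero h

theorem isProfile_K0 : IsProfile d.K0 :=
  IsProfile.of_support (contDiff_primitive hd.profile.smooth) fun _ h => hd.K0_eq_zero h

theorem isProfile_K1 : IsProfile d.K1 :=
  IsProfile.of_support
    (contDiff_primitive (contDiff_id.mul (contDiff_infty_iff_deriv.1 hd.profile.smooth).2))
    fun _ h => hd.K1_eq_zero h

theorem isTrunc_iterate (j : ℕ) : IsTrunc (deriv^[j] d.χ) := by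
  have hsm : ∀ j, ContDiff ℝ ∞ (deriv^[j] d.χ) := by
    intro j
    induction j with
    | zero => exact hd.cutoff.smooth
    | succ j ih =>
      rw [Function.iterate_succ_apply']
      exact (contDiff_infty_iff_deriv.1 ih).2
  obtain ⟨b, hb, hχ⟩ := hd.cutoff.support
  have hz : ∀ j, ∀ y, b < y → deriv^[j] d.χ y = 0 := by
    intro j
    induction j with
    | zero => exact fun y hy => hχ y hy.le
    | succ j ih =>
      intro y hy
      rw [Function.iterate_succ_apply']
      have : deriv^[j] d.χ =ᶠ[𝓝 y] fun _ => 0 := by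
        filter_upwards [lt_mem_nhds hy] with s hs using ih s hs
      rw [this.deriv_eq, deriv_const]
  have hbd : ∀ j, ∃ C, ∀ s, 0 ≤ s → |deriv^[j] d.χ s| ≤ C := by
    intro j
    obtain ⟨C, hC⟩ := isCompact_Icc.exists_bound_of_continuousOn (s := Icc (0 : ℝ) 1)
      (hsm j).continuous.continuousOn
    refine ⟨max C 0, fun s hs => ?_⟩
    by_cases h : b < s
    · rw [hz j s h, abs_zero]; exact le_max_right _ _
    · exact (hC s ⟨hs, by linarith⟩).trans (le_max_left _ _)
  obtain ⟨C, hC⟩ := hbd j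
  obtain ⟨C', hC'⟩ := hbd (j + 1)
  refine ⟨hsm j, max C C', fun s hs => ⟨(hC s hs).trans (le_max_left _ _), ?_⟩⟩
  have := hC' s hs
  rw [Function.iterate_succ_apply'] at this
  exact this.trans (le_max_right _ _)

theorem isTrunc_chi : IsTrunc d.χ := hd.isTrunc_iterate 0

theorem isTrunc_deriv_chi : IsTrunc (deriv d.χ) := hd.isTrunc_iterate 1

end Admissible

theorem isTrunc_one : IsTrunc fun _ => 1 :=
  ⟨contDiff_const, 1, fun s _ => by simp⟩

end Data

end Ekman

end

/-! ### Size of the components of a field with a single boundary layer. -/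

noncomputable section

namespace Ekman

namespace Data

variable {d : Data}

/-! ### The field with one boundary layer -/

section Field

variable (d : Data) (σ : ℝ) (ψ : ℝ → ℝ)

/-- Half the square root of `2β`. -/
def half (d : Data) : ℝ := √(2 * d.β) / 2

/-- The radial component of the layers, multiplied by the radial function `s`. -/
def layerP (s : ℝ → ℝ) (ε t : ℝ) (p : Space) : ℝ :=
  d.block σ ψ d.χ expSin
      (fun ε t x => s (d.rho x) * (metric ψ (-1 / 2) (d.rho x) * d.uEps ε t (d.rho x))) ε t p
    + ε ^ d.a * d.block σ ψ (deriv d.χ) expDiff (fun ε t x =>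
        s (d.rho x) * (d.half * (metric ψ (1 / 4) (d.rho x) * d.uEps ε t (d.rho x)))) ε t p
    - ε * d.block σ ψ (fun _ => 1) d.k
        (fun ε t x => s (d.rho x) * (d.lam (d.rho x) * d.uEps ε t (d.rho x))) ε t p

/-- The angular component of the layers. -/
def layerQ (ε t : ℝ) (p : Space) : ℝ :=
  -d.block σ ψ d.χ expCos (fun ε t x => d.uEps ε t (d.rho x)) ε t p

/-- The component of the layers transverse to the floor. -/
def layerR (ε t : ℝ) (p : Space) : ℝ :=
  ε * (-d.half * d.block σ ψ d.χ expDiff (fun ε t x =>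
        d.divRadial (fun r => metric ψ (1 / 4) r * d.uEps ε t r) x) ε t p
      - √(2 * d.β) * d.block σ ψ d.χ mulExpSin (fun ε t x =>
        deriv (metric ψ (3 / 4)) (d.rho x) *
          (metric ψ (-1 / 2) (d.rho x) * d.uEps ε t (d.rho x))) ε t p)
    + ε ^ 2 * (√(2 * d.β) * (d.block σ ψ (fun _ => 1) d.K0 (fun ε t x =>
          metric ψ (3 / 4) (d.rho x) * d.divRadial (fun r => d.lam r * d.uEps ε t r) x) ε t p
        - d.block σ ψ (fun _ => 1) d.K1 (fun ε t x =>
          deriv (metric ψ (3 / 4)) (d.rho x) * (d.lam (d.rho x) * d.uEps ε t (d.rho x))) ε t p))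

/-- The vertical component of the layers. -/
def layerW (ε t : ℝ) (p : Space) : ℝ :=
  σ * (-d.layerP σ ψ (deriv ψ) ε t p + d.layerR σ ψ ε t p)

/-- The radial component of the interior terms. -/
def intP (ε t : ℝ) (p : Space) : ℝ := ε * (d.lam (d.rho p.1) * d.uEps ε t (d.rho p.1))

/-- The angular component of the interior terms. -/
def intQ (ε t : ℝ) (p : Space) : ℝ := d.uEps ε t (d.rho p.1)

/-- The vertical component of the interior terms. -/
def intW (ε t : ℝ) (p : Space) : ℝ :=
  ε * (-d.half * d.divRadial (d.uEps ε t) p.1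
    - p.2 * d.divRadial (fun r => d.lam r * d.uEps ε t r) p.1)

/-- The radial component of the field with one layer. -/
def genP (ε t : ℝ) (p : Space) : ℝ := d.intP ε t p + d.layerP σ ψ (fun _ => 1) ε t p

/-- The angular component of the field with one layer. -/
def genQ (ε t : ℝ) (p : Space) : ℝ := d.intQ ε t p + d.layerQ σ ψ ε t p

/-- The vertical component of the field with one layer. -/
def genW (ε t : ℝ) (p : Space) : ℝ := d.intW ε t p + d.layerW σ ψ ε t p

/-- The field with one layer. -/
def gen (ε t : ℝ) (p : Space) : Space :=
  d.frame p.1 (d.genP σ ψ ε t p) (d.genQ σ ψ ε t p) (d.genW σ ψ ε t p)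

/-- The weight of the remainder. -/
def rem (ε t : ℝ) (p : Space) : ℝ := d.wt 2 ε t p * (ε + d.decay σ ψ ε t p)

end Field

section Estimates

variable {σ : ℝ} {ψ : ℝ → ℝ}

theorem decay_pos (ε t : ℝ) (p : Space) : 0 < d.decay σ ψ ε t p := Real.exp_pos _

theorem decay_le_one (hd : d.Admissible) {ε t : ℝ} {p : Space} (h : d.RegP σ ψ ε t p) :
    d.decay σ ψ ε t p ≤ 1 := Real.exp_le_one_iff.2 (by linarith [h.fast_nonpos hd])

theorem pb_eps : d.PB (d.RegP σ ψ) 0 (fun ε _ _ => ε) fun ε _ _ => ε :=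
  PB.of_abs_le 1 fun ε t p hp => by rw [abs_of_pos hp.reg.pos, one_mul]

theorem pb_eps_one : d.PB (d.RegP σ ψ) 0 (fun _ _ _ => 1) fun ε _ _ => ε :=
  PB.of_abs_le 1 fun ε t p hp => by rw [abs_of_pos hp.reg.pos, one_mul]; exact hp.reg.le_one

theorem pb_eps_rpow (ha0 : 0 ≤ d.a) :
    d.PB (d.RegP σ ψ) 0 (fun _ _ _ => 1) fun ε _ _ => ε ^ d.a :=
  PB.of_abs_le 1 fun ε t p hp => by
    rw [abs_of_pos (Real.rpow_pos_of_pos hp.reg.pos _), one_mul]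
    exact Real.rpow_le_one hp.reg.pos.le hp.reg.le_one ha0

theorem IsCoef.const_mul (ha : d.a < 1) {n : ℕ} {c} (h : d.IsCoef n c) (y : ℝ) :
    d.IsCoef n fun ε t x => y * c ε t x :=
  IsCoef.radial_mul ha (Symb.const y) h

theorem _root_.Ekman.Data.Symb.metric_mul (ha : d.a < 1) (hψ : d.IsFloor ψ) {n : ℕ} {f}
    (hf : d.Symb d.weight 3 n f) (q : ℝ) :
    d.Symb d.weight 3 n fun ε t r => metric ψ q r * f ε t r := by
  have := ((hψ.metric ha q).mono_order ha isWeight_unit (l' := 3) (by norm_num) le_rfl).mul ha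
    isWeight_weight hf
  rwa [zero_add] at this

variable (hd : d.Admissible) (ha0 : 0 ≤ d.a) (ha : d.a < 1) (hψ : d.IsFloor ψ)
include hd ha0 ha hψ

section Coefs

omit ha0

theorem coef_uEps (q : ℝ) :
    d.IsCoef 0 fun ε t x => metric ψ q (d.rho x) * d.uEps ε t (d.rho x) :=
  IsCoef.radial ha ((hd.symb_uEps ha).metric_mul ha hψ q)

omit hψ in
theorem coef_lam : d.IsCoef 1 fun ε t x => d.lam (d.rho x) * d.uEps ε t (d.rho x) :=
  IsCoef.radial ha (hd.symb_lam_uEps ha)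

theorem coef_div_uEps (q : ℝ) :
    d.IsCoef 3 fun ε t x => d.divRadial (fun r => metric ψ q r * d.uEps ε t r) x :=
  IsCoef.divRadial hd ha ((hd.symb_uEps ha).metric_mul ha hψ q)

omit hψ in
theorem coef_div_lam : d.IsCoef 4 fun ε t x => d.divRadial (fun r => d.lam r * d.uEps ε t r) x :=
  IsCoef.divRadial hd ha (hd.symb_lam_uEps ha)

end Coefs

omit hd ha0 hψ in
theorem regP_loss : ∀ ε t p, d.RegP σ ψ ε t p → 1 ≤ d.loss ε t := RegP.one_le_loss ha

omit hd ha0 ha hψ in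
/-- The weight of the layer terms. -/
theorem layer_weight (i : ℕ) (ε t : ℝ) (p : Space) :
    0 ≤ d.wt i ε t p * d.decay σ ψ ε t p ∧
      d.wt i ε t p * d.decay σ ψ ε t p ≤ 1 * (d.wt i ε t p * d.decay σ ψ ε t p) :=
  ⟨mul_nonneg (wt_nonneg _ _ _ _) (decay_pos _ _ _).le, by rw [one_mul]⟩

theorem layerP_pb {s : ℝ → ℝ} (hs : d.Symb unitWeight 0 0 fun _ _ => s) :
    d.PB (d.RegP σ ψ) 1 (fun ε t p => d.wt 1 ε t p * d.decay σ ψ ε t p) (d.layerP σ ψ s) := by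
  have h1 := block_pb (σ := σ) (ψ := ψ) hd hd.isTrunc_chi isProfile_expSin
    (IsCoef.radial_mul ha hs (coef_uEps hd ha hψ (-1 / 2)))
  have h2 := block_pb (σ := σ) (ψ := ψ) hd hd.isTrunc_deriv_chi isProfile_expDiff
    (IsCoef.radial_mul ha hs ((coef_uEps hd ha hψ (1 / 4)).const_mul ha d.half))
  have h3 := block_pb (σ := σ) (ψ := ψ) hd isTrunc_one hd.isProfile_k
    (IsCoef.radial_mul ha hs (coef_lam hd ha))
  have hm := fun ε t p (_ : d.RegP σ ψ ε t p) => layer_weight (d := d) (σ := σ) (ψ := ψ) 1 ε t p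
  have h1' := h1.mono (regP_loss ha) zero_le_one 1 hm
  have h2' := ((pb_eps_rpow ha0).bmul h2).mono (regP_loss ha) (m := 1) (by norm_num) 1 hm
  have h3' := (pb_eps_one.bmul h3).mono (regP_loss ha) (m := 1) (by norm_num) 1 hm
  exact (h1'.add h2').sub h3'

omit ha0 hψ in
theorem layerQ_pb :
    d.PB (d.RegP σ ψ) 1 (fun ε t p => d.wt 1 ε t p * d.decay σ ψ ε t p) (d.layerQ σ ψ) := by
  have h1 := block_pb (σ := σ) (ψ := ψ) hd hd.isTrunc_chi isProfile_expCos
    (IsCoef.radial ha (hd.symb_uEps ha))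
  exact (h1.mono (regP_loss ha) zero_le_one 1 fun ε t p _ => layer_weight 1 ε t p).neg

omit ha0 in
-- Every term carries a factor ε. The order four is that of div(λu∇ρ): one loss for λ and three for
-- the derivative. The decay is bounded by one, since smallness in ε suffices here.
theorem layerR_pb : d.PB (d.RegP σ ψ) 4 (fun ε t p => ε * d.wt 1 ε t p) (d.layerR σ ψ) := by
  have hm : ∀ ε t p, d.RegP σ ψ ε t p →
      0 ≤ d.wt 1 ε t p * d.decay σ ψ ε t p ∧
        d.wt 1 ε t p * d.decay σ ψ ε t p ≤ 1 * d.wt 1 ε t p := fun ε t p hp =>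
    ⟨(layer_weight 1 ε t p).1, by
      rw [one_mul]; exact mul_le_of_le_one_right (wt_nonneg _ _ _ _) (decay_le_one hd hp)⟩
  have hδ : d.Symb unitWeight 0 0 fun _ _ => deriv (metric ψ (3 / 4)) := (hψ.metric ha (3 / 4)).dr
  have h1 := (block_pb (σ := σ) (ψ := ψ) hd hd.isTrunc_chi isProfile_expDiff
    (coef_div_uEps hd ha hψ (1 / 4))).mono (regP_loss ha) (m := 4) (by norm_num) 1 hm
  have h2 := (block_pb (σ := σ) (ψ := ψ) hd hd.isTrunc_chi isProfile_mulExpSin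
    (IsCoef.radial_mul ha hδ (coef_uEps hd ha hψ (-1 / 2)))).mono (regP_loss ha) (m := 4)
    (by norm_num) 1 hm
  have h3 := (block_pb (σ := σ) (ψ := ψ) hd isTrunc_one hd.isProfile_K0
    (IsCoef.radial_mul ha (hψ.metric ha (3 / 4)) (coef_div_lam hd ha))).mono (regP_loss ha)
    (m := 4) (by norm_num) 1 hm
  have h4 := (block_pb (σ := σ) (ψ := ψ) hd isTrunc_one hd.isProfile_K1
    (IsCoef.radial_mul ha hδ (coef_lam hd ha))).mono (regP_loss ha) (m := 4) (by norm_num) 1 hm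
  have h5 := pb_eps.mul ((h1.const_mul (-d.half)).sub (h2.const_mul √(2 * d.β)))
  have h6 := pb_eps.mul (pb_eps_one.bmul ((h3.sub h4).const_mul √(2 * d.β)))
  simp only [zero_add] at h5 h6
  refine (h5.add h6).congr fun ε t p _ => ?_
  simp only [layerR]
  ring

omit hψ ha0 in
theorem intP_pb : d.PB (d.RegP σ ψ) 1 (fun ε t p => ε * d.wt 1 ε t p) (d.intP) := by
  have h := pb_eps.mul ((coef_lam hd ha).pb hd (σ := σ) (ψ := ψ))
  rw [zero_add] at h
  exact h

omit hψ ha0 in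
theorem intQ_pb : d.PB (d.RegP σ ψ) 0 (d.wt 1) d.intQ :=
  (IsCoef.radial ha (hd.symb_uEps ha)).pb hd (σ := σ) (ψ := ψ)

omit hd ha0 ha hψ in
theorem pb_depth : d.PB (d.RegP σ ψ) 0 (fun _ _ _ => 1) fun _ _ p => p.2 :=
  PB.of_abs_le d.H fun ε t p hp => by rw [mul_one]; exact hp.depth

omit ha hψ ha0 in
theorem wt_one_bound : ∃ K, 0 ≤ K ∧ ∀ ε t p, d.RegP σ ψ ε t p → d.wt 1 ε t p ≤ K := by
  obtain ⟨K, hK⟩ := hd.exists_wt_le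
  exact ⟨max K 0, le_max_right _ _, fun ε t p hp =>
    (hK ε t p hp.reg.nonneg hp.mem).trans (le_max_left _ _)⟩

omit ha0 hψ in
theorem intW_pb : d.PB (d.RegP σ ψ) 4 (fun ε t p => ε * d.wt 1 ε t p) (d.intW) := by
  have hm : ∀ ε t p, d.RegP σ ψ ε t p → 0 ≤ d.wt 1 ε t p ∧ d.wt 1 ε t p ≤ 1 * d.wt 1 ε t p :=
    fun ε t p _ => ⟨wt_nonneg _ _ _ _, by rw [one_mul]⟩
  have h1 := ((IsCoef.divRadial hd ha (hd.symb_uEps ha)).pb hd (σ := σ) (ψ := ψ)).mono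
    (regP_loss ha) (m := 4) (by norm_num) 1 hm
  have h2 := pb_depth.bmul ((coef_div_lam hd ha).pb hd (σ := σ) (ψ := ψ))
  rw [zero_add] at h2
  have h := pb_eps.mul ((h1.const_mul (-d.half)).sub h2)
  rw [zero_add] at h
  exact h

omit hd ha0 ha hψ in
-- The factor s is kept inside the coefficients when ψ' times the radial layers has to be estimated
-- as a layer, and is taken outside when it must cancel in `transverse_pb`.
theorem layerP_eq (s : ℝ → ℝ) (ε t : ℝ) (p : Space) :
    d.layerP σ ψ s ε t p = s (d.rho p.1) * d.layerP σ ψ (fun _ => 1) ε t p := by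
  simp only [layerP, block]
  ring

omit ha0 in
/-- The component of the field across the floor is small. -/
theorem transverse_pb (hσ : σ * σ = 1) :
    d.PB (d.RegP σ ψ) 4 (fun ε t p => ε * d.wt 1 ε t p) fun ε t p =>
      σ * d.genW σ ψ ε t p + deriv ψ (d.rho p.1) * d.genP σ ψ ε t p := by
  have hm : ∀ ε t p, d.RegP σ ψ ε t p →
      0 ≤ ε * d.wt 1 ε t p ∧ ε * d.wt 1 ε t p ≤ 1 * (ε * d.wt 1 ε t p) :=
    fun ε t p hp => ⟨mul_nonneg hp.reg.pos.le (wt_nonneg _ _ _ _), by rw [one_mul]⟩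
  have h1 := ((intW_pb hd ha (σ := σ) (ψ := ψ)).const_mul σ).add (layerR_pb hd ha hψ (σ := σ))
  have h2 : d.PB (d.RegP σ ψ) 0 (fun _ _ _ => 1) fun ε t p => deriv ψ (d.rho p.1) := hψ.slope.pb
  have h3 := (h2.bmul (intP_pb hd ha (σ := σ) (ψ := ψ))).mono (regP_loss ha) (m := 4)
    (by norm_num) 1 hm
  refine (h1.add h3).congr fun ε t p _ => ?_
  -- Since σ² = 1, the radial layers of order one cancel between σW and ψ'P; only `layerR` and the
  -- interior terms remain, all of them of order ε.
  simp only [genW, genP, layerW, layerP_eq (deriv ψ)]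
  linear_combination (-(deriv ψ (d.rho p.1) * d.layerP σ ψ (fun _ => 1) ε t p)
    + d.layerR σ ψ ε t p) * hσ

/-- The radial velocity is of order ε in the interior and of order one only inside the layer. This
smallness compensates for the interior angular velocity, which is of order one. -/
theorem genP_pb : d.PB (d.RegP σ ψ) 1 (fun ε t p => d.wt 1 ε t p * (ε + d.decay σ ψ ε t p))
    (d.genP σ ψ) := by
  have h1 := (intP_pb hd ha (σ := σ) (ψ := ψ)).mono (regP_loss ha) le_rfl 1
    (g' := fun ε t p => d.wt 1 ε t p * (ε + d.decay σ ψ ε t p)) fun ε t p hp =>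
      ⟨mul_nonneg hp.reg.pos.le (wt_nonneg _ _ _ _), by
        rw [one_mul, mul_comm ε]
        exact mul_le_mul_of_nonneg_left (le_add_of_nonneg_right (decay_pos _ _ _).le)
          (wt_nonneg _ _ _ _)⟩
  have h2 := (layerP_pb hd ha0 ha hψ (σ := σ) (Symb.const 1)).mono (regP_loss ha) le_rfl 1
    (g' := fun ε t p => d.wt 1 ε t p * (ε + d.decay σ ψ ε t p)) fun ε t p hp =>
      ⟨(layer_weight 1 ε t p).1, by
        rw [one_mul]
        exact mul_le_mul_of_nonneg_left (le_add_of_nonneg_left hp.reg.pos.le)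
          (wt_nonneg _ _ _ _)⟩
  exact h1.add h2

omit ha0 hψ in
theorem genQ_pb : d.PB (d.RegP σ ψ) 1 (d.wt 1) (d.genQ σ ψ) := by
  have h1 := (intQ_pb hd ha (σ := σ) (ψ := ψ)).mono (regP_loss ha) zero_le_one 1
    (g' := d.wt 1) fun ε t p hp => ⟨wt_nonneg _ _ _ _, by rw [one_mul]⟩
  have h2 := (layerQ_pb hd ha (σ := σ) (ψ := ψ)).mono (regP_loss ha) le_rfl 1
    (g' := d.wt 1) fun ε t p hp => ⟨(layer_weight 1 ε t p).1, by
      rw [one_mul]; exact mul_le_of_le_one_right (wt_nonneg _ _ _ _) (decay_le_one hd hp)⟩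
  exact h1.add h2

omit ha0 ha hψ in
/-- Replace the weight of order one by a constant. -/
theorem PB.drop_weight {n : ℕ} {w f : ℝ → ℝ → Space → ℝ}
    (hw : ∀ ε t p, d.RegP σ ψ ε t p → 0 ≤ w ε t p)
    (h : d.PB (d.RegP σ ψ) n (fun ε t p => d.wt 1 ε t p * w ε t p) f) :
    d.PB (d.RegP σ ψ) n w f := by
  obtain ⟨K, hK0, hK⟩ := wt_one_bound hd (σ := σ) (ψ := ψ)
  obtain ⟨C, hC⟩ := h
  refine ⟨|C| * K, fun ε t p hp => (hC ε t p hp).trans ?_⟩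
  have hl : 0 ≤ d.loss ε t := div_nonneg (by linarith [hp.reg.nonneg]) (cut_pos hp.reg.pos).le
  calc C * d.loss ε t ^ n * (d.wt 1 ε t p * w ε t p)
      ≤ |C| * d.loss ε t ^ n * (K * w ε t p) :=
        mul_le_mul (mul_le_mul_of_nonneg_right (le_abs_self C) (by positivity))
          (mul_le_mul_of_nonneg_right (hK ε t p hp) (hw ε t p hp))
          (mul_nonneg (wt_nonneg _ _ _ _) (hw ε t p hp)) (by positivity)
    _ = _ := by ring

theorem genP_pb_one : d.PB (d.RegP σ ψ) 1 (fun ε t p => ε + d.decay σ ψ ε t p) (d.genP σ ψ) :=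
  PB.drop_weight hd (fun _ _ _ hp => add_nonneg hp.reg.pos.le (decay_pos _ _ _).le)
    (genP_pb hd ha0 ha hψ)

theorem genP_pb_unit : d.PB (d.RegP σ ψ) 1 (fun _ _ _ => 1) (d.genP σ ψ) :=
  (genP_pb_one hd ha0 ha hψ).mono (regP_loss ha) le_rfl 2 fun _ _ _ hp =>
    ⟨add_nonneg hp.reg.pos.le (decay_pos _ _ _).le, by
      linarith [hp.reg.le_one, decay_le_one hd hp]⟩

omit ha0 hψ in
theorem genQ_pb_unit : d.PB (d.RegP σ ψ) 1 (fun _ _ _ => 1) (d.genQ σ ψ) :=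
  PB.drop_weight hd (fun _ _ _ _ => zero_le_one) (by simpa only [mul_one] using genQ_pb hd ha)

omit ha0 in
theorem transverse_pb_eps (hσ : σ * σ = 1) :
    d.PB (d.RegP σ ψ) 4 (fun ε _ _ => ε) fun ε t p =>
      σ * d.genW σ ψ ε t p + deriv ψ (d.rho p.1) * d.genP σ ψ ε t p :=
  PB.drop_weight hd (fun _ _ _ hp => hp.reg.pos.le)
    (by simpa only [mul_comm] using transverse_pb hd ha hψ hσ)

/-- W is recovered from the component across the wall as σ(σW + ψ'P) − σψ'P. -/
theorem genW_pb_unit (hσ : σ * σ = 1) :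
    d.PB (d.RegP σ ψ) 4 (fun _ _ _ => 1) (d.genW σ ψ) := by
  have h1 := (transverse_pb_eps hd ha hψ hσ).mono (regP_loss ha) le_rfl 1
    (g' := fun _ _ _ => 1) fun ε t p hp =>
      ⟨hp.reg.pos.le, by rw [one_mul]; exact hp.reg.le_one⟩
  have h2 : d.PB (d.RegP σ ψ) 0 (fun _ _ _ => 1) fun ε t p => deriv ψ (d.rho p.1) := hψ.slope.pb
  have h3 := (h2.bmul (genP_pb_unit hd ha0 ha hψ (σ := σ))).mono (regP_loss ha) (m := 4)
    (by norm_num) 1 (g' := fun _ _ _ => 1) fun _ _ _ _ => ⟨zero_le_one, by norm_num⟩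
  refine ((h1.sub h3).const_mul σ).congr fun ε t p _ => ?_
  linear_combination (-d.genW σ ψ ε t p) * hσ

omit ha0 ha hψ in
theorem inner_gradient_gen {ε t : ℝ} {p : Space} (hp : d.RegP σ ψ ε t p) :
    ⟪∇ d.rho p.1, (d.gen σ ψ ε t p).1⟫_ℝ = d.genP σ ψ ε t p := by
  simp only [gen, frame, inner_add_right, inner_smul_right, inner_self_perp,
    inner_self_of_unit (hd.norm_gradient hp.mem)]
  ring

omit ha0 ha hψ in
theorem inner_perp_gen {ε t : ℝ} {p : Space} (hp : d.RegP σ ψ ε t p) :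
    ⟪perp (∇ d.rho p.1), (d.gen σ ψ ε t p).1⟫_ℝ = d.genQ σ ψ ε t p := by
  have h : ‖perp (∇ d.rho p.1)‖ = 1 := by rw [norm_perp, hd.norm_gradient hp.mem]
  simp only [gen, frame, inner_add_right, inner_smul_right, inner_perp_self,
    inner_self_of_unit h]
  ring

/-- The field is an admissible direction of differentiation for its own layers; the order four is
that of its component across the wall. -/
theorem isDir_gen (hσ : σ * σ = 1) : d.IsDir σ ψ 4 (d.gen σ ψ) := by
  have hone : ∀ ε t p, d.RegP σ ψ ε t p → (0 : ℝ) ≤ 1 ∧ (1 : ℝ) ≤ 1 * 1 :=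
    fun _ _ _ _ => ⟨zero_le_one, by norm_num⟩
  refine ⟨?_, ?_, ?_⟩
  · exact ((genP_pb_unit hd ha0 ha hψ).mono (regP_loss ha) (by norm_num) 1 hone).congr
      fun ε t p hp => inner_gradient_gen hd hp
  · obtain ⟨C, hC0, hC⟩ := hd.exists_bound_fderiv_curv
    obtain ⟨A, hA⟩ := (genP_pb_unit hd ha0 ha hψ (σ := σ)).mono (regP_loss ha) (m := 4)
      (by norm_num) 1 hone
    obtain ⟨B, hB⟩ := (genQ_pb_unit hd ha (σ := σ) (ψ := ψ)).mono (regP_loss ha) (m := 4)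
      (by norm_num) 1 hone
    refine ⟨C * (A + B), fun ε t p hp => (hC p.1 hp.mem _).trans ?_⟩
    rw [mul_one, mul_assoc]
    refine mul_le_mul_of_nonneg_left ?_ hC0
    simp only [gen, frame]
    refine (norm_add_le _ _).trans ?_
    rw [norm_smul, norm_smul, norm_perp, hd.norm_gradient hp.mem, mul_one, mul_one, add_mul]
    have h1 := hA ε t p hp
    have h2 := hB ε t p hp
    rw [mul_one] at h1 h2
    exact add_le_add h1 h2
  · exact (transverse_pb_eps hd ha hψ hσ).congr fun ε t p hp => by
      rw [inner_gradient_gen hd hp]; rfl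

end Estimates

end Data

end Ekman

end

/-! ### Self-advection of the field with one layer. -/

noncomputable section

namespace Ekman

namespace Data

variable {d : Data} {σ : ℝ} {ψ : ℝ → ℝ}

/-! ### The nonlinear term for the field with one layer -/

section Nonlinear

theorem wt_decay_le_rem (ε t : ℝ) (p : Space) (hp : d.RegP σ ψ ε t p) :
    0 ≤ d.wt 2 ε t p * d.decay σ ψ ε t p ∧
      d.wt 2 ε t p * d.decay σ ψ ε t p ≤ 1 * d.rem σ ψ ε t p :=
  ⟨(layer_weight 2 ε t p).1, by
    rw [one_mul]
    exact mul_le_mul_of_nonneg_left (le_add_of_nonneg_left hp.reg.pos.le) (wt_nonneg _ _ _ _)⟩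

theorem eps_wt_le_rem (ε t : ℝ) (p : Space) (hp : d.RegP σ ψ ε t p) :
    0 ≤ ε * d.wt 2 ε t p ∧ ε * d.wt 2 ε t p ≤ 1 * d.rem σ ψ ε t p :=
  ⟨mul_nonneg hp.reg.pos.le (wt_nonneg _ _ _ _), by
    rw [one_mul, mul_comm]
    exact mul_le_mul_of_nonneg_left (le_add_of_nonneg_right (decay_pos _ _ _).le)
      (wt_nonneg _ _ _ _)⟩

theorem wt_one_le_rem (ε t : ℝ) (p : Space) (hp : d.RegP σ ψ ε t p) :
    0 ≤ d.wt 1 ε t p * (ε + d.decay σ ψ ε t p) ∧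
      d.wt 1 ε t p * (ε + d.decay σ ψ ε t p) ≤ 1 * d.rem σ ψ ε t p := by
  have h := add_nonneg hp.reg.pos.le (decay_pos (d := d) (σ := σ) (ψ := ψ) ε t p).le
  refine ⟨mul_nonneg (wt_nonneg _ _ _ _) h, ?_⟩
  rw [one_mul]
  exact mul_le_mul_of_nonneg_right (wt_mono _ _ _ _) h

theorem rem_nonneg (ε t : ℝ) (p : Space) (hp : d.RegP σ ψ ε t p) : 0 ≤ d.rem σ ψ ε t p :=
  (wt_one_le_rem ε t p hp).1.trans (by simpa using (wt_one_le_rem ε t p hp).2)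

theorem rem_le_rem (ε t : ℝ) (p : Space) (hp : d.RegP σ ψ ε t p) :
    0 ≤ d.rem σ ψ ε t p ∧ d.rem σ ψ ε t p ≤ 1 * d.rem σ ψ ε t p :=
  ⟨rem_nonneg ε t p hp, by rw [one_mul]⟩

variable (hd : d.Admissible) (ha0 : 0 ≤ d.a) (ha : d.a < 1) (hψ : d.IsFloor ψ)
  {V : ℝ → ℝ → Space → Space} (hV : d.IsDir σ ψ 4 V)
include hd ha

include hV in
/-- Derivatives of a layer term of order at most four. -/
theorem block_db_rem (hψ : d.IsFloor ψ) {X g : ℝ → ℝ} {n : ℕ} {c : ℝ → ℝ → Plane → ℝ}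
    (hX : IsTrunc X) (hg : IsProfile g) (hc : d.IsCoef n c) (hn : n ≤ 4) :
    d.DB (d.RegP σ ψ) V 11 (d.rem σ ψ) (d.block σ ψ X g c) :=
  -- Eleven is 4 + 3 + 4: the order of the coefficient, one derivative, and the order of the
  -- direction.
  (block_db hd ha hψ hX hg hc hV).mono (regP_loss ha) (by omega) 1 wt_decay_le_rem

omit hd in
theorem DB.bounded_mul {c : ℝ → ℝ} {T : ℝ → ℝ → Space → ℝ}
    (hc : d.PB (d.RegP σ ψ) 0 (fun _ _ _ => 1) fun ε _ _ => c ε)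
    (hT : d.DB (d.RegP σ ψ) V 11 (d.rem σ ψ) T) :
    d.DB (d.RegP σ ψ) V 11 (d.rem σ ψ) fun ε t p => c ε * T ε t p :=
  (DB.param_mul c hc hT).mono (regP_loss ha) le_rfl 1 fun ε t p hp => by
    simpa only [one_mul] using rem_le_rem ε t p hp

omit hd in
theorem DB.eps_mul {T : ℝ → ℝ → Space → ℝ} (hT : d.DB (d.RegP σ ψ) V 11 (d.wt 2) T) :
    d.DB (d.RegP σ ψ) V 11 (d.rem σ ψ) fun ε t p => ε * T ε t p :=
  (DB.param_mul (fun ε => ε) pb_eps hT).mono (regP_loss ha) le_rfl 1 eps_wt_le_rem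

include hV hψ

include ha0 in
theorem layerP_db {s : ℝ → ℝ} (hs : d.Symb unitWeight 0 0 fun _ _ => s) :
    d.DB (d.RegP σ ψ) V 11 (d.rem σ ψ) (d.layerP σ ψ s) := by
  have h1 := block_db_rem hd ha hV hψ hd.isTrunc_chi isProfile_expSin
    (IsCoef.radial_mul ha hs (coef_uEps hd ha hψ (-1 / 2))) (by norm_num)
  have h2 := block_db_rem hd ha hV hψ hd.isTrunc_deriv_chi isProfile_expDiff
    (IsCoef.radial_mul ha hs ((coef_uEps hd ha hψ (1 / 4)).const_mul ha d.half)) (by norm_num)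
  have h3 := block_db_rem hd ha hV hψ isTrunc_one hd.isProfile_k
    (IsCoef.radial_mul ha hs (coef_lam hd ha)) (by norm_num)
  exact (h1.add (DB.bounded_mul ha (pb_eps_rpow ha0) h2)).sub (DB.bounded_mul ha pb_eps_one h3)

theorem layerR_db : d.DB (d.RegP σ ψ) V 11 (d.rem σ ψ) (d.layerR σ ψ) := by
  have hδ : d.Symb unitWeight 0 0 fun _ _ => deriv (metric ψ (3 / 4)) := (hψ.metric ha (3 / 4)).dr
  have h1 := block_db_rem hd ha hV hψ hd.isTrunc_chi isProfile_expDiff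
    (coef_div_uEps hd ha hψ (1 / 4)) (by norm_num)
  have h2 := block_db_rem hd ha hV hψ hd.isTrunc_chi isProfile_mulExpSin
    (IsCoef.radial_mul ha hδ (coef_uEps hd ha hψ (-1 / 2))) (by norm_num)
  have h3 := block_db_rem hd ha hV hψ isTrunc_one hd.isProfile_K0
    (IsCoef.radial_mul ha (hψ.metric ha (3 / 4)) (coef_div_lam hd ha)) (by norm_num)
  have h4 := block_db_rem hd ha hV hψ isTrunc_one hd.isProfile_K1
    (IsCoef.radial_mul ha hδ (coef_lam hd ha)) (by norm_num)
  have he2 : d.PB (d.RegP σ ψ) 0 (fun _ _ _ => 1) fun ε _ _ => ε ^ 2 :=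
    (pb_eps_one.bmul pb_eps_one).congr fun ε _ _ _ => sq ε
  exact (DB.bounded_mul ha pb_eps_one ((h1.const_mul (-d.half)).sub (h2.const_mul √(2 * d.β)))).add
    (DB.bounded_mul ha he2 ((h3.sub h4).const_mul √(2 * d.β)))

include ha0 in
theorem genP_db : d.DB (d.RegP σ ψ) V 11 (d.rem σ ψ) (d.genP σ ψ) := by
  have h1 := ((coef_lam hd ha).db hd ha hV).mono (regP_loss ha) (m := 11) (by norm_num) 1
    (g' := d.wt 2) fun ε t p hp => ⟨wt_nonneg _ _ _ _, by rw [one_mul]⟩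
  exact (DB.eps_mul ha h1).add (layerP_db hd ha0 ha hψ hV (Symb.const 1))

omit hV in
include ha0 in
-- The interior part u_ε(ρ) has no factor ε, but it varies only radially: its derivative along the
-- field is u_ε' P, and P is O(ε) outside the layer.
theorem genQ_db (hσ : σ * σ = 1) :
    d.DB (d.RegP σ ψ) (d.gen σ ψ) 11 (d.rem σ ψ) (d.genQ σ ψ) := by
  have hV := isDir_gen hd ha0 ha hψ hσ
  have h1 : d.DB (d.RegP σ ψ) (d.gen σ ψ) 11 (d.rem σ ψ) d.intQ := by
    have hu := hd.symb_uEps ha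
    refine ⟨fun ε t p => dr d.uEps ε t (d.rho p.1) * d.genP σ ψ ε t p, ?_, ?_⟩
    · have h2 : d.PB (d.RegP σ ψ) 3 (d.wt 1) fun ε t p => dr d.uEps ε t (d.rho p.1) := hu.dr.pb
      exact (h2.mul (genP_pb_one hd ha0 ha hψ)).mono (regP_loss ha) (by norm_num) 1 wt_one_le_rem
    · intro ε t p hp
      have h2 := hu.sm.hasDerivAt_comp hd hp.reg.pos t hp.mem (d.gen σ ψ ε t p)
      rwa [inner_gradient_gen hd hp] at h2
  have h2 := block_db_rem hd ha hV hψ hd.isTrunc_chi isProfile_expCos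
    (IsCoef.radial ha (hd.symb_uEps ha)) (by norm_num)
  exact h1.add h2.neg

omit hV in
include ha0 in
-- The interior part has the prefactor ε, so it is enough that its derivative be bounded up to
-- losses; differentiating its explicit factor z produces W, for which `genW_pb_unit` suffices.
theorem genW_db (hσ : σ * σ = 1) :
    d.DB (d.RegP σ ψ) (d.gen σ ψ) 11 (d.rem σ ψ) (d.genW σ ψ) := by
  have hV := isDir_gen hd ha0 ha hψ hσ
  have hw : ∀ ε t p, d.RegP σ ψ ε t p → 0 ≤ d.wt 2 ε t p ∧ d.wt 2 ε t p ≤ 1 * d.wt 2 ε t p :=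
    fun ε t p hp => ⟨wt_nonneg _ _ _ _, by rw [one_mul]⟩
  have h1 := ((IsCoef.divRadial hd ha (hd.symb_uEps ha)).db hd ha hV).mono (regP_loss ha)
    (m := 11) (by norm_num) 1 hw
  have h2 : d.DB (d.RegP σ ψ) (d.gen σ ψ) 11 (d.wt 2) fun ε t p =>
      p.2 * d.divRadial (fun r => d.lam r * d.uEps ε t r) p.1 := by
    obtain ⟨c', hc', hcd⟩ := (coef_div_lam hd ha).db hd ha hV
    have hc := (coef_div_lam hd ha).pb hd (σ := σ) (ψ := ψ)
    refine ⟨fun ε t p => d.genW σ ψ ε t p * d.divRadial (fun r => d.lam r * d.uEps ε t r) p.1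
      + p.2 * c' ε t p, ?_, ?_⟩
    · have h3 := ((genW_pb_unit hd ha0 ha hψ hσ).bmul hc).mono (regP_loss ha) (m := 11)
        (by norm_num) 1 (g' := d.wt 2) fun ε t p hp =>
          ⟨wt_nonneg _ _ _ _, by rw [one_mul]; exact wt_mono _ _ _ _⟩
      have h4 := (pb_depth.bmul hc').mono (regP_loss ha) (m := 11) (by norm_num) 1 hw
      exact h3.add h4
    · intro ε t p hp
      have h3 := (hasDerivAt_height p (d.gen σ ψ ε t p)).mul (hcd ε t p hp)
      simp only [zero_smul, add_zero] at h3
      exact h3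
  have h3 := ((layerP_db hd ha0 ha hψ hV hψ.slope).neg.add
    (layerR_db hd ha hψ hV)).const_mul σ
  exact (DB.eps_mul ha ((h1.const_mul (-d.half)).sub h2)).add h3

omit hψ hV ha in
/-- The nonlinear term in the moving frame. -/
theorem advection_gen {ε t : ℝ} {p : Space} (hp : d.RegP σ ψ ε t p)
    (hdiff : DifferentiableAt ℝ (d.gen σ ψ ε t) p) {P' Q' W' : ℝ}
    (hP : HasDerivAt (fun τ : ℝ => d.genP σ ψ ε t (p + τ • d.gen σ ψ ε t p)) P' 0)
    (hQ : HasDerivAt (fun τ : ℝ => d.genQ σ ψ ε t (p + τ • d.gen σ ψ ε t p)) Q' 0)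
    (hW : HasDerivAt (fun τ : ℝ => d.genW σ ψ ε t (p + τ • d.gen σ ψ ε t p)) W' 0) :
    advection (d.gen σ ψ ε t) p =
      ((P' - d.curv p.1 * d.genQ σ ψ ε t p ^ 2) • ∇ d.rho p.1
        + (Q' + d.genP σ ψ ε t p * d.curv p.1 * d.genQ σ ψ ε t p) • perp (∇ d.rho p.1), W') := by
  set v := d.gen σ ψ ε t p with hv
  have hline : HasDerivAt (fun τ : ℝ => p + τ • v) v 0 := by
    simpa using ((hasDerivAt_id (0 : ℝ)).smul_const v).const_add p
  have h1 : HasDerivAt (fun τ : ℝ => d.gen σ ψ ε t (p + τ • v)) (fderiv ℝ (d.gen σ ψ ε t) p v) 0 := by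
    have h0 : HasFDerivAt (d.gen σ ψ ε t) (fderiv ℝ (d.gen σ ψ ε t) p) (p + (0 : ℝ) • v) := by
      simpa using hdiff.hasFDerivAt
    exact h0.comp_hasDerivAt 0 hline
  -- By the rank-one form of the Hessian, only the angular component turns the frame, at the rate Δρ
  -- Q.
  have hn : HasDerivAt (fun τ : ℝ => ∇ d.rho (p + τ • v).1)
      ((d.curv p.1 * d.genQ σ ψ ε t p) • perp (∇ d.rho p.1)) 0 := by
    have h0 := hd.hasFDerivAt_gradient hp.mem
    have hp0 : p.1 = (p + (0 : ℝ) • v).1 := by simp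
    rw [hp0] at h0
    have hl1 : HasDerivAt (fun τ : ℝ => (p + τ • v).1) v.1 0 := by
      simpa using ((hasDerivAt_id (0 : ℝ)).smul_const v.1).const_add p.1
    refine (h0.comp_hasDerivAt 0 hl1).congr_deriv ?_
    rw [← inner_perp_gen hd hp, ← hv]
    simp [smul_smul]
  have hpn : HasDerivAt (fun τ : ℝ => perp (∇ d.rho (p + τ • v).1))
      ((d.curv p.1 * d.genQ σ ψ ε t p) • -∇ d.rho p.1) 0 := by
    have := perpL.hasFDerivAt.comp_hasDerivAt 0 hn
    refine this.congr_deriv ?_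
    rw [map_smul, perpL_apply, perp_perp]
  have h2 := ((hP.smul hn).add (hQ.smul hpn)).prodMk hW
  have h3 := h1.unique h2
  rw [advection, ← hv, h3]
  simp only [zero_smul, add_zero]
  refine Prod.ext ?_ rfl
  simp only
  module

omit hV in
include ha0 in
-- Adding u_ε²Δρ∇ρ leaves −Δρ(Q² − u_ε²) = −Δρ `layerQ` (Q + u_ε) in the radial component, which
-- decays away from the wall. Every other term is a derivative along the field or contains the
-- factor P.
theorem advection_gen_bound (hσ : σ * σ = 1)
    (hsm : ∀ ε t p, d.RegP σ ψ ε t p → DifferentiableAt ℝ (d.gen σ ψ ε t) p) :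
    ∃ C, ∀ ε t p, d.RegP σ ψ ε t p →
      ‖(advection (d.gen σ ψ ε t) p
        + ((d.uEps ε t (d.rho p.1) ^ 2 * d.curv p.1) • ∇ d.rho p.1, 0)).1‖
      + |(advection (d.gen σ ψ ε t) p
        + ((d.uEps ε t (d.rho p.1) ^ 2 * d.curv p.1) • ∇ d.rho p.1, 0)).2|
      ≤ C * d.loss ε t ^ 11 * d.rem σ ψ ε t p := by
  have hR := regP_loss (σ := σ) (ψ := ψ) ha
  obtain ⟨P', hP', hPd⟩ := genP_db hd ha0 ha hψ (isDir_gen hd ha0 ha hψ hσ)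
  obtain ⟨Q', hQ', hQd⟩ := genQ_db hd ha0 ha hψ hσ
  obtain ⟨W', ⟨C₃, hC₃⟩, hWd⟩ := genW_db hd ha0 ha hψ hσ
  have hQu := genQ_pb_unit hd ha (σ := σ) (ψ := ψ)
  have hIu : d.PB (d.RegP σ ψ) 1 (fun _ _ _ => 1) d.intQ :=
    (PB.drop_weight hd (fun _ _ _ _ => zero_le_one)
      (by simpa only [mul_one] using intQ_pb hd ha)).mono hR zero_le_one 1
      fun _ _ _ _ => ⟨zero_le_one, by norm_num⟩
  have hJ := hd.pb_curv (σ := σ) (ψ := ψ)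
  have h1 : d.PB (d.RegP σ ψ) 11 (d.rem σ ψ) fun ε t p =>
      P' ε t p - d.curv p.1 * (d.layerQ σ ψ ε t p * (d.genQ σ ψ ε t p + d.intQ ε t p)) := by
    have h2 := (hJ.bmul ((layerQ_pb hd ha (σ := σ) (ψ := ψ)).mulb (hQu.add hIu))).mono hR
      (m := 11) (by norm_num) 1 (g' := d.rem σ ψ) fun ε t p hp =>
        ⟨(layer_weight 1 ε t p).1, (mul_le_mul_of_nonneg_right (wt_mono 1 ε t p)
          (decay_pos _ _ _).le).trans (wt_decay_le_rem ε t p hp).2⟩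
    exact hP'.sub h2
  have h2 : d.PB (d.RegP σ ψ) 11 (d.rem σ ψ) fun ε t p =>
      Q' ε t p + d.genP σ ψ ε t p * d.curv p.1 * d.genQ σ ψ ε t p := by
    have h3 := (((genP_pb hd ha0 ha hψ (σ := σ)).mulb hJ).mulb hQu).mono hR
      (m := 11) (by norm_num) 1 wt_one_le_rem
    exact hQ'.add h3
  obtain ⟨C₁, hC₁⟩ := h1
  obtain ⟨C₂, hC₂⟩ := h2
  refine ⟨C₁ + C₂ + C₃, fun ε t p hp => ?_⟩
  rw [advection_gen hd hp (hsm ε t p hp) (hPd ε t p hp) (hQd ε t p hp) (hWd ε t p hp)]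
  have e : ((P' ε t p - d.curv p.1 * d.genQ σ ψ ε t p ^ 2) • ∇ d.rho p.1
        + (Q' ε t p + d.genP σ ψ ε t p * d.curv p.1 * d.genQ σ ψ ε t p) • perp (∇ d.rho p.1))
        + (d.uEps ε t (d.rho p.1) ^ 2 * d.curv p.1) • ∇ d.rho p.1 =
      (P' ε t p - d.curv p.1 * (d.layerQ σ ψ ε t p * (d.genQ σ ψ ε t p + d.intQ ε t p))) •
        ∇ d.rho p.1
      + (Q' ε t p + d.genP σ ψ ε t p * d.curv p.1 * d.genQ σ ψ ε t p) • perp (∇ d.rho p.1) := by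
    rw [add_right_comm, ← add_smul]
    congr 2
    simp only [genQ, intQ]
    ring
  rw [Prod.fst_add, Prod.snd_add]
  simp only [add_zero, e]
  have hn := hd.norm_gradient hp.mem
  have h3 := norm_add_le ((P' ε t p - d.curv p.1 * (d.layerQ σ ψ ε t p *
    (d.genQ σ ψ ε t p + d.intQ ε t p))) • ∇ d.rho p.1)
    ((Q' ε t p + d.genP σ ψ ε t p * d.curv p.1 * d.genQ σ ψ ε t p) • perp (∇ d.rho p.1))
  rw [norm_smul, norm_smul, norm_perp, hn, mul_one, mul_one, Real.norm_eq_abs,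
    Real.norm_eq_abs] at h3
  have h4 := hC₁ ε t p hp
  have h5 := hC₂ ε t p hp
  have h6 := hC₃ ε t p hp
  rw [add_mul, add_mul, add_mul, add_mul]
  linarith

end Nonlinear

end Data

end Ekman

end

/-! ### Joint smoothness, and splitting of the approximate solution into interior and two layers. -/

noncomputable section

namespace Ekman

namespace Data

variable {d : Data}

/-! ### Smoothness in time and space -/

section Smooth

/-- Joint smoothness in time and space, above the ocean. -/
def SmP {F : Type*} [NormedAddCommGroup F] [NormedSpace ℝ F] (d : Data)
    (T : ℝ → ℝ → Space → F) : Prop :=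
  ∀ ε t p, 0 < ε → p.1 ∈ d.ocean → ContDiffAt ℝ ∞ (fun q : ℝ × Space => T ε q.1 q.2) (t, p)

namespace SmP

variable {F : Type*} [NormedAddCommGroup F] [NormedSpace ℝ F] {T T' : ℝ → ℝ → Space → ℝ}

theorem congr {S S' : ℝ → ℝ → Space → F} (h : d.SmP S)
    (he : ∀ ε t p, 0 < ε → p.1 ∈ d.ocean → S' ε t p = S ε t p) : d.SmP S' := by
  intro ε t p hε hp
  refine (h ε t p hε hp).congr_of_eventuallyEq ?_
  have hc : Continuous fun q : ℝ × Space => q.2.1 := by fun_prop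
  filter_upwards [(isOpen_ocean.preimage hc).mem_nhds (show (t, p) ∈ _ from hp)] with q hq
  exact he ε q.1 q.2 hε hq

theorem differentiableAt {S : ℝ → ℝ → Space → F} (h : d.SmP S) {ε : ℝ} (hε : 0 < ε) (t : ℝ)
    {p : Space} (hp : p.1 ∈ d.ocean) : DifferentiableAt ℝ (S ε t) p := by
  have h1 : ContDiffAt ℝ ∞ (fun p : Space => S ε t p) p :=
    (h ε t p hε hp).comp p (contDiffAt_const.prodMk contDiffAt_id)
  exact h1.differentiableAt (by simp)

theorem contDiffOn {S : ℝ → ℝ → Space → F} (h : d.SmP S) {ε : ℝ} (hε : 0 < ε)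
    {A : Set (ℝ × Space)} (hA : ∀ q ∈ A, q.2.1 ∈ d.ocean) :
    ContDiffOn ℝ ∞ (fun q : ℝ × Space => S ε q.1 q.2) A :=
  fun q hq => (h ε q.1 q.2 hε (hA q hq)).contDiffWithinAt

theorem add (h : d.SmP T) (h' : d.SmP T') : d.SmP fun ε t p => T ε t p + T' ε t p :=
  fun ε t p hε hp => (h ε t p hε hp).add (h' ε t p hε hp)

theorem neg (h : d.SmP T) : d.SmP fun ε t p => -T ε t p :=
  fun ε t p hε hp => (h ε t p hε hp).neg

theorem sub (h : d.SmP T) (h' : d.SmP T') : d.SmP fun ε t p => T ε t p - T' ε t p :=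
  fun ε t p hε hp => (h ε t p hε hp).sub (h' ε t p hε hp)

theorem mul (h : d.SmP T) (h' : d.SmP T') : d.SmP fun ε t p => T ε t p * T' ε t p :=
  fun ε t p hε hp => (h ε t p hε hp).mul (h' ε t p hε hp)

theorem param (c : ℝ → ℝ) : d.SmP fun ε _ _ => c ε := fun _ _ _ _ _ => contDiffAt_const

theorem snd : d.SmP fun _ _ p => p.2 := fun _ _ _ _ _ => by fun_prop

theorem comp {X : ℝ → ℝ} (hX : ContDiff ℝ ∞ X) (h : d.SmP T) : d.SmP fun ε t p => X (T ε t p) :=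
  fun ε t p hε hp => hX.contDiffAt.comp (t, p) (h ε t p hε hp)

theorem radial (hd : d.Admissible) {f : ℝ → ℝ → ℝ → ℝ} (hf : d.Sm f) :
    d.SmP fun ε t p => f ε t (d.rho p.1) := by
  intro ε t p hε hp
  have h1 : ContDiffAt ℝ ∞ (fun q : ℝ × Space => d.rho q.2.1) (t, p) :=
    ContDiffAt.comp (t, p) (g := d.rho) (hd.contDiffAt_rho hp) (by fun_prop)
  exact ContDiffAt.comp (t, p) (g := fun q : ℝ × ℝ => f ε q.1 q.2)
    (f := fun q : ℝ × Space => (q.1, d.rho q.2.1)) (hf.contDiffAt hε (mem_ocean.1 hp))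
    (contDiffAt_fst.prodMk h1)

theorem curv (hd : d.Admissible) : d.SmP fun _ _ p => d.curv p.1 :=
  fun _ t p _ hp => ContDiffAt.comp (t, p) (g := d.curv) (hd.contDiffAt_curv hp) (by fun_prop)

theorem coef (hd : d.Admissible) {n : ℕ} {c} (hc : d.IsCoef n c) :
    d.SmP fun ε t p => c ε t p.1 := by
  obtain ⟨A, B, hA, hB, he⟩ := hc
  exact ((radial hd hA.sm).add ((curv hd).mul (radial hd hB.sm))).congr
    fun ε t p hε hp => he ε t p.1 hε hp

theorem height (hd : d.Admissible) (σ : ℝ) {ψ : ℝ → ℝ} (hψ : d.IsFloor ψ) :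
    d.SmP fun _ _ p => d.height σ ψ p :=
  ((param fun _ => σ).mul snd).add (radial hd (Sm.radial hψ.smooth))

theorem fast (hd : d.Admissible) (ha : d.a < 1) (σ : ℝ) {ψ : ℝ → ℝ} (hψ : d.IsFloor ψ) :
    d.SmP fun ε _ p => d.fast σ ψ ε p := by
  intro ε t p hε hp
  refine ((height hd σ hψ ε t p hε hp).div
    (((radial hd (hψ.metric ha (3 / 4)).sm).mul (param d.sqrtE)) ε t p hε hp) ?_).neg
  exact (mul_pos (metric_pos _ _ _) (hd.sqrtE_pos hε)).ne'

theorem block (hd : d.Admissible) (ha : d.a < 1) {σ : ℝ} {ψ : ℝ → ℝ} (hψ : d.IsFloor ψ)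
    {X g : ℝ → ℝ} (hX : IsTrunc X) (hg : IsProfile g) {n : ℕ} {c} (hc : d.IsCoef n c) :
    d.SmP (d.block σ ψ X g c) :=
  ((coef hd hc).mul (comp hX.smooth ((height hd σ hψ).mul (param fun ε => (d.cut ε)⁻¹)))).mul
    (comp hg.smooth (fast hd ha σ hψ))

theorem frame (hd : d.Admissible) {W : ℝ → ℝ → Space → ℝ} (hP : d.SmP T) (hQ : d.SmP T')
    (hW : d.SmP W) : d.SmP fun ε t p => d.frame p.1 (T ε t p) (T' ε t p) (W ε t p) := by
  intro ε t p hε hp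
  have hn : ContDiffAt ℝ ∞ (fun q : ℝ × Space => ∇ d.rho q.2.1) (t, p) :=
    ContDiffAt.comp (t, p) (g := fun x => ∇ d.rho x) (hd.contDiffAt_gradient hp) (by fun_prop)
  have hpn : ContDiffAt ℝ ∞ (fun q : ℝ × Space => perp (∇ d.rho q.2.1)) (t, p) :=
    perpL.contDiff.contDiffAt.comp (t, p) hn
  exact (((hP ε t p hε hp).smul hn).add ((hQ ε t p hε hp).smul hpn)).prodMk (hW ε t p hε hp)

end SmP

variable {σ : ℝ} {ψ : ℝ → ℝ} (hd : d.Admissible) (ha : d.a < 1) (hψ : d.IsFloor ψ)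
include hd ha

theorem smP_intP : d.SmP d.intP :=
  (SmP.param fun ε => ε).mul (SmP.radial hd (hd.symb_lam_uEps ha).sm)

theorem smP_intQ : d.SmP d.intQ := SmP.radial hd (hd.symb_uEps ha).sm

theorem smP_intW : d.SmP d.intW :=
  (SmP.param fun ε => ε).mul (((SmP.param fun _ => -d.half).mul
    (SmP.coef hd (IsCoef.divRadial hd ha (hd.symb_uEps ha)))).sub
    (SmP.snd.mul (SmP.coef hd (coef_div_lam hd ha))))

include hψ

theorem smP_layerP {s : ℝ → ℝ} (hs : d.Symb unitWeight 0 0 fun _ _ => s) :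
    d.SmP (d.layerP σ ψ s) :=
  ((SmP.block hd ha hψ hd.isTrunc_chi isProfile_expSin
      (IsCoef.radial_mul ha hs (coef_uEps hd ha hψ (-1 / 2)))).add
    ((SmP.param fun ε => ε ^ d.a).mul (SmP.block hd ha hψ hd.isTrunc_deriv_chi isProfile_expDiff
      (IsCoef.radial_mul ha hs ((coef_uEps hd ha hψ (1 / 4)).const_mul ha d.half))))).sub
    ((SmP.param fun ε => ε).mul (SmP.block hd ha hψ isTrunc_one hd.isProfile_k
      (IsCoef.radial_mul ha hs (coef_lam hd ha))))

theorem smP_layerQ : d.SmP (d.layerQ σ ψ) :=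
  (SmP.block hd ha hψ hd.isTrunc_chi isProfile_expCos (IsCoef.radial ha (hd.symb_uEps ha))).neg

theorem smP_layerR : d.SmP (d.layerR σ ψ) :=
  ((SmP.param fun ε => ε).mul (((SmP.param fun _ => -d.half).mul
    (SmP.block hd ha hψ hd.isTrunc_chi isProfile_expDiff (coef_div_uEps hd ha hψ (1 / 4)))).sub
    ((SmP.param fun _ => √(2 * d.β)).mul
    (SmP.block hd ha hψ hd.isTrunc_chi isProfile_mulExpSin (IsCoef.radial_mul ha
      ((hψ.metric ha (3 / 4)).dr) (coef_uEps hd ha hψ (-1 / 2))))))).add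
  ((SmP.param fun ε => ε ^ 2).mul ((SmP.param fun _ => √(2 * d.β)).mul
    ((SmP.block hd ha hψ isTrunc_one hd.isProfile_K0
      (IsCoef.radial_mul ha (hψ.metric ha (3 / 4)) (coef_div_lam hd ha))).sub
    (SmP.block hd ha hψ isTrunc_one hd.isProfile_K1
      (IsCoef.radial_mul ha ((hψ.metric ha (3 / 4)).dr) (coef_lam hd ha))))))

theorem smP_layerW : d.SmP (d.layerW σ ψ) :=
  (SmP.param fun _ => σ).mul ((smP_layerP hd ha hψ hψ.slope).neg.add (smP_layerR hd ha hψ))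

theorem smP_gen : d.SmP (d.gen σ ψ) :=
  SmP.frame hd ((smP_intP hd ha).add (smP_layerP hd ha hψ (Symb.const 1)))
    ((smP_intQ hd ha).add (smP_layerQ hd ha hψ)) ((smP_intW hd ha).add (smP_layerW hd ha hψ))

end Smooth

/-! ### The approximate solution in the moving frame -/

section Decomposition

variable (d)

/-- The radial component of the approximate solution. -/
def appP (ε t : ℝ) (p : Space) : ℝ :=
  d.intP ε t p + d.layerP (-1) (fun _ => 0) (fun _ => 1) ε t p + d.layerP 1 d.φ (fun _ => 1) ε t p

/-- The angular component of the approximate solution. -/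
def appQ (ε t : ℝ) (p : Space) : ℝ :=
  d.intQ ε t p + d.layerQ (-1) (fun _ => 0) ε t p + d.layerQ 1 d.φ ε t p

/-- The vertical component of the approximate solution. -/
def appW (ε t : ℝ) (p : Space) : ℝ :=
  d.intW ε t p + d.layerW (-1) (fun _ => 0) ε t p + d.layerW 1 d.φ ε t p

variable {d}

theorem metric_zero (p r : ℝ) : metric (fun _ => 0) p r = 1 := by simp [metric]

theorem delta_eq : d.delta = metric d.φ (3 / 4) := rfl

theorem height_surface (p : Space) : d.height (-1) (fun _ => 0) p = -p.2 := by simp [height]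

theorem height_bottom (p : Space) : d.height 1 d.φ p = p.2 + d.φ (d.rho p.1) := by simp [height]

theorem fast_surface (ε : ℝ) (p : Space) : d.fast (-1) (fun _ => 0) ε p = d.zetaS ε p := by
  rw [fast, height_surface, metric_zero, one_mul, zetaS, neg_div, neg_neg]

theorem fast_bottom (ε : ℝ) (p : Space) : d.fast 1 d.φ ε p = d.zetaB ε p := by
  rw [fast, height_bottom]; rfl

/-- The surface layers are the case σ = −1, ψ = 0 of the general formulas, where the metric factor
is 1 and its derivative 0; the bottom layers are the case σ = 1, ψ = φ. The powers of δ become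
powers of 1 + φ'² through δ = (1 + φ'²)^(3/4). -/
theorem uApp_eq (ε t : ℝ) (p : Space) :
    d.Uapp ε t p = d.frame p.1 (d.appP ε t p) (d.appQ ε t p) (d.appW ε t p) := by
  have e1 : d.delta (d.rho p.1) ^ (-2 / 3 : ℝ) = metric d.φ (-1 / 2) (d.rho p.1) := by
    rw [delta_eq, metric_rpow]; norm_num
  have e2 : ∀ r, d.delta r ^ (1 / 3 : ℝ) = metric d.φ (1 / 4) r := fun r => by
    rw [delta_eq, metric_rpow]; norm_num
  have e3 : ∀ y, y / d.delta (d.rho p.1) ^ (2 / 3 : ℝ) = y * metric d.φ (-1 / 2) (d.rho p.1) := by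
    intro y
    rw [div_eq_mul_inv, delta_eq, ← Real.rpow_neg (metric_pos _ _ _).le, metric_rpow]; norm_num
  have e4 : ∀ r, deriv (metric (fun _ => 0) (3 / 4)) r = 0 := fun r => by
    rw [funext (metric_zero (3 / 4)), deriv_const]
  refine Prod.ext ?_ ?_
  · simp only [Uapp, U0int, U0surf, U0bot, Uasurf, Uabot, U1int, U1surf, U1bot, U2surf, U2bot,
      frame, Prod.fst_add, Prod.smul_fst, appP, appQ, layerP, layerQ, intP, intQ, block,
      height_surface, height_bottom, fast_surface, fast_bottom, metric_zero, e1, e2, expSin,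
      expCos, expDiff, cutS, cutB, half]
    module
  · simp only [Uapp, U0int, U0surf, U0bot, Uasurf, Uabot, U1int, U1surf, U1bot, U2surf, U2bot,
      frame, Prod.snd_add, Prod.smul_snd, appW, layerP, layerW, layerR, intW, block, smul_eq_mul,
      height_surface, height_bottom, fast_surface, fast_bottom, metric_zero, e1, e2, e3, expSin,
      expDiff, mulExpSin, cutS, cutB, half, one_mul, deriv_const, e4, ← delta_eq]
    ring

theorem smP_uApp (hd : d.Admissible) (ha : d.a < 1) : d.SmP d.Uapp := by
  have h := SmP.frame hd
    (((smP_intP hd ha).add (smP_layerP (σ := -1) hd ha IsFloor.zero (Symb.const 1))).add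
      (smP_layerP (σ := 1) hd ha hd.isFloor (Symb.const 1)))
    (((smP_intQ hd ha).add (smP_layerQ (σ := -1) hd ha IsFloor.zero)).add
      (smP_layerQ (σ := 1) hd ha hd.isFloor))
    (((smP_intW hd ha).add (smP_layerW (σ := -1) hd ha IsFloor.zero)).add
      (smP_layerW (σ := 1) hd ha hd.isFloor))
  exact h.congr fun ε t p _ _ => uApp_eq ε t p

end Decomposition

end Data

end Ekman

end

/-! ### Supports of the layers and behaviour near the shore. -/

noncomputable section

namespace Ekman

namespace Data

variable {d : Data}

/-! ### Localization -/

section Vanishing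

variable {σ : ℝ} {ψ : ℝ → ℝ}

theorem block_eq_zero_of_trunc {X g : ℝ → ℝ} {c : ℝ → ℝ → Plane → ℝ} {ε t : ℝ} {p : Space}
    (h : X (d.height σ ψ p / d.cut ε) = 0) : d.block σ ψ X g c ε t p = 0 := by
  rw [block, h, mul_zero, zero_mul]

theorem block_eq_zero_of_profile {X g : ℝ → ℝ} {c : ℝ → ℝ → Plane → ℝ} {ε t : ℝ} {p : Space}
    (h : g (d.fast σ ψ ε p) = 0) : d.block σ ψ X g c ε t p = 0 := by
  rw [block, h, mul_zero]

/-- Outside of the truncation, the layers vanish. -/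
theorem layers_eq_zero (hd : d.Admissible) {ε t : ℝ} {p : Space}
    (h0 : d.χ (d.height σ ψ p / d.cut ε) = 0) (h1 : deriv d.χ (d.height σ ψ p / d.cut ε) = 0)
    (h2 : d.fast σ ψ ε p ≤ -2) :
    (∀ s, d.layerP σ ψ s ε t p = 0) ∧ d.layerQ σ ψ ε t p = 0 ∧ d.layerW σ ψ ε t p = 0 := by
  have hP : ∀ s, d.layerP σ ψ s ε t p = 0 := fun s => by
    rw [layerP, block_eq_zero_of_trunc h0, block_eq_zero_of_trunc h1,
      block_eq_zero_of_profile (hd.k_eq_zero h2)]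
    ring
  refine ⟨hP, ?_, ?_⟩
  · rw [layerQ, block_eq_zero_of_trunc h0, neg_zero]
  · rw [layerW, hP, layerR, block_eq_zero_of_trunc h0, block_eq_zero_of_trunc h0,
      block_eq_zero_of_profile (hd.K0_eq_zero h2), block_eq_zero_of_profile (hd.K1_eq_zero h2)]
    ring

theorem exists_metric_le (hψ : d.IsFloor ψ) (q : ℝ) :
    ∃ M, 0 < M ∧ ∀ r, d.ρ₀ < r → metric ψ q r ≤ M := by
  have hX : ContinuousOn (fun y : ℝ => (1 + y ^ 2) ^ q) univ :=
    fun y _ => (ContinuousAt.rpow_const (by fun_prop) (Or.inl (by positivity))).continuousWithinAt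
  obtain ⟨B, hB⟩ := hψ.bounded 1
  obtain ⟨M, hM⟩ := (isCompact_Icc (a := -B) (b := B)).exists_bound_of_continuousOn
    (hX.mono (subset_univ _))
  refine ⟨|M| + 1, by positivity, fun r hr => ?_⟩
  have := hM (deriv ψ r) (abs_le.1 (hB r hr))
  rw [Real.norm_eq_abs] at this
  exact (le_abs_self _).trans (this.trans ((le_abs_self M).trans (by linarith)))

/-- The fast variable is comparable to the height divided by `ε`. -/
theorem exists_fast_le (hd : d.Admissible) (hψ : d.IsFloor ψ) :
    ∃ κ > 0, ∀ ε p, 0 < ε → p.1 ∈ d.ocean → 0 ≤ d.height σ ψ p →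
      d.fast σ ψ ε p ≤ -(κ * (d.height σ ψ p / ε)) := by
  obtain ⟨M, hM0, hM⟩ := exists_metric_le hψ (3 / 4)
  have hs : 0 < √(2 * d.β) := Real.sqrt_pos.2 (by linarith [hd.β_pos])
  refine ⟨(M * √(2 * d.β))⁻¹, by positivity, fun ε p hε hp h => ?_⟩
  rw [fast, neg_le_neg_iff, Admissible.sqrtE_eq hε]
  have h1 := hM _ (mem_ocean.1 hp)
  have h2 := metric_pos ψ (3 / 4) (d.rho p.1)
  calc (M * √(2 * d.β))⁻¹ * (d.height σ ψ p / ε) = d.height σ ψ p / (M * (√(2 * d.β) * ε)) := by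
        field_simp
    _ ≤ _ := div_le_div_of_nonneg_left h (by positivity) (by gcongr)

/-- The quotient is ε^a: the truncation length is much larger than the layer thickness. -/
theorem tendsto_eps_div_cut (ha0 : 0 < d.a) :
    Tendsto (fun ε => ε / d.cut ε) (𝓝[>] 0) (𝓝 0) := by
  have h : Tendsto (fun ε : ℝ => ε ^ d.a) (𝓝[>] 0) (𝓝 0) := by
    have := (Real.continuousAt_rpow_const 0 d.a (Or.inr ha0.le)).tendsto
    rw [Real.zero_rpow ha0.ne'] at this
    exact this.mono_left nhdsWithin_le_nhds
  refine h.congr' ?_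
  filter_upwards [self_mem_nhdsWithin] with ε hε
  have hε' : (0 : ℝ) < ε := hε
  rw [cut, eq_div_iff (Real.rpow_pos_of_pos hε' _).ne', ← Real.rpow_add hε']
  simp

/-- The layers vanish near the points at distance `ε ^ (1 - a)`. -/
theorem eventually_layers_eq_zero (hd : d.Admissible) (ha0 : 0 < d.a)
    (hψ : d.IsFloor ψ) :
    ∀ᶠ ε in 𝓝[>] 0, ∀ t p, p.1 ∈ d.ocean → d.cut ε ≤ d.height σ ψ p → ∀ᶠ q in 𝓝 p,
      (∀ s, d.layerP σ ψ s ε t q = 0) ∧ d.layerQ σ ψ ε t q = 0 ∧ d.layerW σ ψ ε t q = 0 := by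
  obtain ⟨b, hb1, hb⟩ := hd.cutoff.support
  obtain ⟨κ, hκ, hfast⟩ := exists_fast_le (σ := σ) hd hψ
  -- Taking θ < 1 leaves room for a whole neighbourhood of a point at height ε^(1-a), and b ≤ θ
  -- makes χ and χ' vanish beyond height θε^(1-a).
  set θ := max b (1 / 2) with hθ
  have hθ1 : θ < 1 := max_lt hb1 (by norm_num)
  have hθ0 : (1 / 2 : ℝ) ≤ θ := le_max_right _ _
  -- With ε < (κ/4) ε^(1-a), heights above ε^(1-a)/2 correspond to a layer variable below −2, where
  -- k, K₀ and K₁ vanish.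
  have hev := (tendsto_eps_div_cut ha0).eventually (gt_mem_nhds (show 0 < κ / 4 by positivity))
  filter_upwards [hev, self_mem_nhdsWithin] with ε hε hε0 t p hp hcut
  have hε' : 0 < ε := hε0
  have hc := cut_pos (d := d) hε'
  have hcont : ContinuousAt (d.height σ ψ) p := by
    have h1 : ContinuousAt (fun q : Space => ψ (d.rho q.1)) p :=
      ContinuousAt.comp (g := ψ) (f := fun q : Space => d.rho q.1)
        ((hψ.smooth.continuousOn).continuousAt (Ioi_mem_nhds (mem_ocean.1 hp)))
        ((continuous_rho.comp continuous_fst).continuousAt)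
    exact (continuousAt_snd.const_mul σ).add h1
  have hlt : θ * d.cut ε < d.height σ ψ p := by nlinarith
  filter_upwards [hcont.eventually (lt_mem_nhds hlt),
    (isOpen_ocean.preimage continuous_fst).mem_nhds (show p ∈ Prod.fst ⁻¹' d.ocean from hp)]
    with q hq hqo
  have hbq : b < d.height σ ψ q / d.cut ε := by
    rw [lt_div_iff₀ hc]
    exact (mul_le_mul_of_nonneg_right (le_max_left _ _) hc.le).trans_lt hq
  have hzero : d.χ =ᶠ[𝓝 (d.height σ ψ q / d.cut ε)] fun _ => 0 := by
    filter_upwards [lt_mem_nhds hbq] with s hs using hb s hs.le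
  refine layers_eq_zero hd hzero.self_of_nhds (by rw [hzero.deriv_eq, deriv_const]) ?_
  have hh : d.cut ε / 2 ≤ d.height σ ψ q := by nlinarith
  refine (hfast ε q hε' hqo (by linarith)).trans ?_
  rw [div_lt_iff₀ hc] at hε
  rw [neg_le_neg_iff, ← mul_div_assoc, le_div_iff₀ hε']
  nlinarith

theorem divRadial_eq_zero (hd : d.Admissible) {f : ℝ → ℝ} {x : Plane} (hx : x ∈ d.ocean)
    (h : f =ᶠ[𝓝 (d.rho x)] fun _ => 0) : d.divRadial f x = 0 := by
  rw [hd.divRadial_eq hx (h.symm.differentiableAt_iff.1 (differentiableAt_const _)), h.deriv_eq,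
    h.self_of_nhds, deriv_const]
  ring

/-- The approximate solution vanishes near the shore. -/
theorem uApp_eq_zero (hd : d.Admissible) {ε : ℝ} (hε : 0 < ε) (t : ℝ) {p : Space}
    (hp : p.1 ∈ d.ocean) (h : d.φ (d.rho p.1) < 2 * d.cut ε) :
    d.uEps ε t (d.rho p.1) = 0 ∧ d.Uapp ε t p = 0 := by
  obtain ⟨η, hη, hχ⟩ := hd.cutoff.eq_one
  have hc := cut_pos (d := d) hε
  have hr := mem_ocean.1 hp
  have hcont : ContinuousAt d.φ (d.rho p.1) :=
    (hd.isFloor.smooth.continuousOn).continuousAt (Ioi_mem_nhds hr)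
  -- Depth below 2ε^(1-a) puts the argument of χ in [0, 1/2], where χ = 1. Vanishing in a
  -- neighbourhood is needed because the divergences differentiate u_ε.
  have hu : d.uEps ε t =ᶠ[𝓝 (d.rho p.1)] fun _ => 0 := by
    filter_upwards [hcont.eventually (gt_mem_nhds h), Ioi_mem_nhds hr] with r h1 h2
    rw [uEps, hχ, sub_self, zero_mul]
    refine ⟨div_nonneg (hd.phi_pos h2).le (by positivity), ?_⟩
    rw [div_le_iff₀ (by positivity)]
    nlinarith
  have hm : ∀ f : ℝ → ℝ, d.divRadial (fun s => f s * d.uEps ε t s) p.1 = 0 := fun f =>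
    divRadial_eq_zero hd hp (by filter_upwards [hu] with r hr; rw [hr, mul_zero])
  have h0 := hu.self_of_nhds
  refine ⟨h0, ?_⟩
  simp [Uapp, U0int, U0surf, U0bot, Uasurf, Uabot, U1int, U1surf, U1bot, U2surf, U2bot, frame,
    h0, hm, divRadial_eq_zero hd hp hu]

end Vanishing

end Data

end Ekman

end

/-! ### Patching the one-layer estimates and adding the truncation error. -/

noncomputable section

namespace Ekman

namespace Data

variable {d : Data}

/-! ### Pointwise bound of the error -/

section Pointwise

/-- The exponential weights of the two boundary layers. -/
def layerExp (κ ε h z : ℝ) : ℝ := Real.exp (-(κ * (-z / ε))) + Real.exp (-(κ * ((z + h) / ε)))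

variable (hd : d.Admissible)
include hd

theorem exists_decay_le {σ : ℝ} {ψ : ℝ → ℝ} (hψ : d.IsFloor ψ) :
    ∃ κ > 0, ∀ ε t p, d.RegP σ ψ ε t p →
      d.decay σ ψ ε t p ≤ Real.exp (-(κ * (d.height σ ψ p / ε))) := by
  obtain ⟨κ, hκ, h⟩ := exists_fast_le (σ := σ) hd hψ
  refine ⟨κ / 2, by positivity, fun ε t p hp => Real.exp_le_exp.2 ?_⟩
  have := h ε p hp.reg.pos hp.mem hp.height
  linarith

/-- Advection depends only on the germ of the field, so the bound passes to the approximate solution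
wherever the other layer vanishes nearby. -/
theorem one_layer_bound {σ : ℝ} {ψ : ℝ → ℝ} (ha0 : 0 < d.a) (ha : d.a < 1) (hψ : d.IsFloor ψ)
    (hσ : σ * σ = 1) :
    ∃ κ > 0, ∃ C, ∀ ε t p, d.RegP σ ψ ε t p → d.Uapp ε t =ᶠ[𝓝 p] d.gen σ ψ ε t →
      ‖(advection (d.Uapp ε t) p
        + ((d.uEps ε t (d.rho p.1) ^ 2 * d.curv p.1) • ∇ d.rho p.1, 0)).1‖
      + |(advection (d.Uapp ε t) p
        + ((d.uEps ε t (d.rho p.1) ^ 2 * d.curv p.1) • ∇ d.rho p.1, 0)).2|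
      ≤ C * (d.wt 2 ε t p *
        (d.loss ε t ^ 11 * (ε + Real.exp (-(κ * (d.height σ ψ p / ε)))))) := by
  obtain ⟨κ, hκ, hdec⟩ := exists_decay_le (σ := σ) hd hψ
  obtain ⟨C, hC⟩ := advection_gen_bound hd ha0.le ha hψ hσ
    fun ε t p hp => (smP_gen hd ha hψ).differentiableAt hp.reg.pos t hp.mem
  refine ⟨κ, hκ, |C|, fun ε t p hp he => ?_⟩
  have h1 : advection (d.Uapp ε t) p = advection (d.gen σ ψ ε t) p := by
    rw [advection, advection, he.fderiv_eq, he.self_of_nhds]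
  rw [h1]
  refine (hC ε t p hp).trans ?_
  have hl : 0 ≤ d.loss ε t := zero_le_one.trans (hp.one_le_loss ha)
  have hw := wt_nonneg (d := d) 2 ε t p
  have h2 := hdec ε t p hp
  have h3 := hp.reg.pos.le
  have h4 := (decay_pos (d := d) (σ := σ) (ψ := ψ) ε t p).le
  calc C * d.loss ε t ^ 11 * d.rem σ ψ ε t p ≤ |C| * d.loss ε t ^ 11 * d.rem σ ψ ε t p := by
        have : 0 ≤ d.rem σ ψ ε t p := mul_nonneg hw (by linarith)
        have := le_abs_self C
        gcongr
    _ = |C| * (d.wt 2 ε t p * (d.loss ε t ^ 11 * (ε + d.decay σ ψ ε t p))) := by rw [rem]; ring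
    _ ≤ _ := by gcongr

/-- Bound of the nonlinear term of the approximate solution. -/
theorem advection_uApp_bound (ha0 : 0 < d.a) (ha : d.a < 1) :
    ∃ κ > 0, ∃ C, 0 ≤ C ∧ ∀ᶠ ε in 𝓝[>] 0, ∀ t p, 0 ≤ t → p ∈ d.Omega →
      ‖(advection (d.Uapp ε t) p
        + ((d.uEps ε t (d.rho p.1) ^ 2 * d.curv p.1) • ∇ d.rho p.1, 0)).1‖
      + |(advection (d.Uapp ε t) p
        + ((d.uEps ε t (d.rho p.1) ^ 2 * d.curv p.1) • ∇ d.rho p.1, 0)).2|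
      ≤ C * (d.wt 2 ε t p * (d.loss ε t ^ 11 * (ε + layerExp κ ε (d.φ (d.rho p.1)) p.2))) := by
  obtain ⟨κ₁, hκ₁, C₁, hC₁⟩ := one_layer_bound (σ := -1) hd ha0 ha IsFloor.zero (by norm_num)
  obtain ⟨κ₂, hκ₂, C₂, hC₂⟩ := one_layer_bound (σ := 1) hd ha0 ha hd.isFloor (by norm_num)
  refine ⟨min κ₁ κ₂, lt_min hκ₁ hκ₂, |C₁| + |C₂|, by positivity, ?_⟩
  filter_upwards [self_mem_nhdsWithin, eventually_layers_eq_zero (σ := -1) hd ha0 IsFloor.zero,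
    eventually_layers_eq_zero (σ := 1) hd ha0 hd.isFloor,
    nhdsWithin_le_nhds (gt_mem_nhds (zero_lt_one (α := ℝ)))] with ε hε0 hS hB hε1 t p ht hp
  have hε : 0 < ε := hε0
  obtain ⟨hpo, hz1, hz2⟩ := hp
  have hw := wt_nonneg (d := d) 2 ε t p
  have hl : 0 ≤ d.loss ε t := zero_le_one.trans (one_le_loss ha hε (le_of_lt hε1) ht)
  -- Reduces either one-layer bound to a common form: the smaller decay rate, the sum of the
  -- constants and the sum of the two exponential weights.
  have key : ∀ C κ y E : ℝ, |C| ≤ |C₁| + |C₂| → min κ₁ κ₂ ≤ κ → 0 ≤ y →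
      E = Real.exp (-(min κ₁ κ₂ * (y / ε))) → E ≤ layerExp (min κ₁ κ₂) ε (d.φ (d.rho p.1)) p.2 →
      C * (d.wt 2 ε t p * (d.loss ε t ^ 11 * (ε + Real.exp (-(κ * (y / ε)))))) ≤
      (|C₁| + |C₂|) * (d.wt 2 ε t p *
        (d.loss ε t ^ 11 * (ε + layerExp (min κ₁ κ₂) ε (d.φ (d.rho p.1)) p.2))) := by
    intro C κ y E hC hκ hy hE hEL
    have h1 : Real.exp (-(κ * (y / ε))) ≤ layerExp (min κ₁ κ₂) ε (d.φ (d.rho p.1)) p.2 := by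
      refine le_trans ?_ hEL
      rw [hE]
      refine Real.exp_le_exp.2 (neg_le_neg ?_)
      have : 0 ≤ y / ε := by positivity
      gcongr
    have h2 := (le_abs_self C).trans hC
    gcongr
  by_cases hφ : d.φ (d.rho p.1) < 2 * d.cut ε
  · obtain ⟨h0, h1⟩ := uApp_eq_zero hd hε t hpo hφ
    rw [advection, h1, h0, map_zero]
    have h2 : 0 ≤ layerExp (min κ₁ κ₂) ε (d.φ (d.rho p.1)) p.2 := by unfold layerExp; positivity
    simp only [ne_eq, OfNat.ofNat_ne_zero, not_false_eq_true, zero_pow, zero_mul, zero_smul,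
      Prod.fst_add, Prod.snd_add, Prod.fst_zero, Prod.snd_zero, add_zero, norm_zero, abs_zero]
    positivity
  · rw [not_lt] at hφ
    have hreg : d.Reg ε t (d.rho p.1) := ⟨hε, le_of_lt hε1, ht, mem_ocean.1 hpo, hφ⟩
    have hdepth : |p.2| ≤ d.H := by
      rw [abs_of_neg hz2]
      linarith [hd.phi_le (mem_ocean.1 hpo)]
    -- The heights −z and z + φ add up to φ ≥ 2ε^(1-a), so one of them is at least ε^(1-a), and the
    -- corresponding layer vanishes near the point.
    rcases le_total (d.cut ε) (p.2 + d.φ (d.rho p.1)) with h | h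
    · have hR : d.RegP (-1) (fun _ => 0) ε t p := ⟨hreg, by linarith, hdepth⟩
      refine (hC₁ ε t p hR ?_).trans (key C₁ κ₁ _ _ (by linarith [abs_nonneg C₂])
        (min_le_left _ _) (by rw [height_surface]; linarith) rfl ?_)
      · filter_upwards [hB t p hpo (by rwa [height_bottom])] with q hq
        obtain ⟨h1, h2, h3⟩ := hq
        rw [uApp_eq, appP, appQ, appW, h1, h2, h3, add_zero, add_zero, add_zero]
        rfl
      · rw [height_surface, layerExp]
        linarith [Real.exp_pos (-(min κ₁ κ₂ * ((p.2 + d.φ (d.rho p.1)) / ε)))]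
    · have hR : d.RegP 1 d.φ ε t p := ⟨hreg, by linarith, hdepth⟩
      refine (hC₂ ε t p hR ?_).trans (key C₂ κ₂ _ _ (by linarith [abs_nonneg C₁])
        (min_le_right _ _) (by rw [height_bottom]; linarith) rfl ?_)
      · filter_upwards [hS t p hpo (by rw [height_surface]; linarith)] with q hq
        obtain ⟨h1, h2, h3⟩ := hq
        rw [uApp_eq, appP, appQ, appW, h1, h2, h3, add_zero, add_zero, add_zero]
        rfl
      · rw [height_bottom, layerExp]
        linarith [Real.exp_pos (-(min κ₁ κ₂ * (-p.2 / ε)))]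

theorem abs_uBar_le {t r : ℝ} (ht : 0 ≤ t) (hr : d.ρ₀ < r) : |d.uBar t r| ≤ d.weight 0 t r := by
  rw [uBar, weight, abs_mul, abs_of_pos (Real.exp_pos _), mul_comm]
  simp only [zero_add, Finset.range_one, Finset.sum_singleton, Function.iterate_zero, id]
  refine mul_le_mul_of_nonneg_right (Real.exp_le_exp.2 ?_) (abs_nonneg _)
  have := hd.rate_le_lam hr
  nlinarith

/-- Bound of the truncation error. -/
theorem truncation_bound :
    ∃ C, 0 ≤ C ∧ ∀ ε t p, 0 < ε → 0 ≤ t → p.1 ∈ d.ocean →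
      |(d.uBar t (d.rho p.1) ^ 2 - d.uEps ε t (d.rho p.1) ^ 2) * d.curv p.1| ≤
        C * (d.wt 2 ε t p * (if d.φ (d.rho p.1) < 4 * d.cut ε then 1 else 0)) := by
  obtain ⟨A, hA⟩ := hd.exists_wt_le
  obtain ⟨B, hB⟩ := hd.isTrunc_chi.bound
  obtain ⟨b, hb1, hb⟩ := hd.cutoff.support
  refine ⟨|A| * ((2 + |B|) * |B|) * d.ρ₀⁻¹, by have := hd.ρ₀_pos; positivity,
    fun ε t p hε ht hp => ?_⟩
  have hr := mem_ocean.1 hp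
  have hc := cut_pos (d := d) hε
  split_ifs with h
  · set u := d.uBar t (d.rho p.1)
    set X := d.χ (d.φ (d.rho p.1) / (4 * d.cut ε)) with hX
    have hX1 : |X| ≤ |B| := ((hB _ (div_nonneg (hd.phi_pos hr).le (by positivity))).1).trans
      (le_abs_self B)
    have hu := abs_uBar_le hd ht hr
    have hu1 : |u| ≤ |A| := hu.trans ((wt_mono 0 ε t p).trans ((hA ε t p ht hp).trans
      (le_abs_self A)))
    have hu2 : |u| ≤ d.wt 2 ε t p := hu.trans ((wt_mono 0 ε t p).trans (wt_mono 1 ε t p))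
    -- From u² − (1 − X)²u² = (2 − X)X u²: one factor u is bounded by a constant, the other keeps
    -- the weight.
    have e : (u ^ 2 - d.uEps ε t (d.rho p.1) ^ 2) * d.curv p.1 =
        u * ((2 - X) * X) * d.curv p.1 * u := by
      simp only [uEps, u, X]; ring
    have h3 := hd.abs_curv_le hp
    have h4 : |2 - X| ≤ 2 + |B| := (abs_sub _ _).trans (by rw [abs_two]; linarith)
    rw [e, abs_mul, abs_mul, abs_mul, abs_mul, mul_one]
    have := hd.ρ₀_pos
    gcongr
  · have hX : d.χ (d.φ (d.rho p.1) / (4 * d.cut ε)) = 0 := by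
      refine hb _ (hb1.le.trans ?_)
      rw [le_div_iff₀ (by positivity)]
      linarith
    rw [uEps, hX]
    simp

/-- Pointwise bound of the error. -/
theorem error_bound (ha0 : 0 < d.a) (ha : d.a < 1) :
    ∃ κ > 0, ∃ C, 0 ≤ C ∧ ∀ᶠ ε in 𝓝[>] 0, ∀ t p, 0 ≤ t → p ∈ d.Omega →
      ‖(advection (d.Uapp ε t) p + d.limitTerm t p).1‖ ^ 2
        + (advection (d.Uapp ε t) p + d.limitTerm t p).2 ^ 2
      ≤ (C * (d.wt 2 ε t p * (d.loss ε t ^ 11 * (ε + layerExp κ ε (d.φ (d.rho p.1)) p.2)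
          + if d.φ (d.rho p.1) < 4 * d.cut ε then 1 else 0))) ^ 2 := by
  obtain ⟨κ, hκ, C, hC0, hC⟩ := advection_uApp_bound hd ha0 ha
  obtain ⟨B, hB0, hB⟩ := truncation_bound hd
  refine ⟨κ, hκ, C + B, by positivity, ?_⟩
  filter_upwards [hC, self_mem_nhdsWithin] with ε hε hε0 t p ht hp
  have hε' : 0 < ε := hε0
  have h1 := hε t p ht hp
  have h2 := hB ε t p hε' ht hp.1
  set A := advection (d.Uapp ε t) p
    + ((d.uEps ε t (d.rho p.1) ^ 2 * d.curv p.1) • ∇ d.rho p.1, (0 : ℝ)) with hA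
  set T := (d.uBar t (d.rho p.1) ^ 2 - d.uEps ε t (d.rho p.1) ^ 2) * d.curv p.1 with hT
  have e : advection (d.Uapp ε t) p + d.limitTerm t p = A + (T • ∇ d.rho p.1, (0 : ℝ)) := by
    refine Prod.ext ?_ ?_
    · simp only [hA, hT, Prod.fst_add, limitTerm, curv]
      module
    · simp only [hA, Prod.snd_add, limitTerm, add_zero]
  rw [e, Prod.fst_add, Prod.snd_add, add_zero]
  have h3 : ‖A.1 + T • ∇ d.rho p.1‖ ≤ ‖A.1‖ + |T| := by
    refine (norm_add_le _ _).trans ?_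
    rw [norm_smul, hd.norm_gradient hp.1, mul_one, Real.norm_eq_abs]
  have h4 : ‖A.1 + T • ∇ d.rho p.1‖ + |A.2| ≤
      (C + B) * (d.wt 2 ε t p * (d.loss ε t ^ 11 * (ε + layerExp κ ε (d.φ (d.rho p.1)) p.2)
          + if d.φ (d.rho p.1) < 4 * d.cut ε then 1 else 0)) := by
    have hw := wt_nonneg (d := d) 2 ε t p
    have hl : 0 ≤ d.loss ε t := div_nonneg (by linarith) (cut_pos hε').le
    have h5 : 0 ≤ layerExp κ ε (d.φ (d.rho p.1)) p.2 := by unfold layerExp; positivity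
    set J : ℝ := if d.φ (d.rho p.1) < 4 * d.cut ε then 1 else 0 with hJ
    have h6 : 0 ≤ J := by rw [hJ]; split_ifs <;> norm_num
    set Y := d.loss ε t ^ 11 * (ε + layerExp κ ε (d.φ (d.rho p.1)) p.2) with hY
    have h7 : 0 ≤ Y := by positivity
    have h8 : 0 ≤ C * (d.wt 2 ε t p * J) := by positivity
    have h9 : 0 ≤ B * (d.wt 2 ε t p * Y) := by positivity
    calc _ ≤ (‖A.1‖ + |A.2|) + |T| := by linarith
      _ ≤ C * (d.wt 2 ε t p * Y) + B * (d.wt 2 ε t p * J) := add_le_add h1 h2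
      _ ≤ _ := by nlinarith
  calc _ ≤ (‖A.1 + T • ∇ d.rho p.1‖ + |A.2|) ^ 2 := by
        rw [add_sq, sq_abs]
        nlinarith [mul_nonneg (norm_nonneg (A.1 + T • ∇ d.rho p.1)) (abs_nonneg A.2)]
    _ ≤ _ := pow_le_pow_left₀ (by positivity) h4 2

end Pointwise

end Data

end Ekman

end

/-! ### Integration in depth, in the plane and in time; threshold on the exponent. -/

noncomputable section

namespace Ekman

namespace Data

variable {d : Data}

/-! ### Integration of the error -/

section Integration

/-- With an explicit primitive, each exponential weight integrates to at most ε/κ over the column.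
This is the power of ε gained by the layers in the squared norm. -/
theorem integral_layerExp_le {κ ε h A J : ℝ} (hκ : 0 < κ) (hε : 0 < ε) :
    ∫ z in -h..0, 4 * (A ^ 2 * (ε + layerExp κ ε h z) + J ^ 2) ≤
      4 * (A ^ 2 * (ε * (h + 2 / κ)) + J ^ 2 * h) := by
  have hder : ∀ z ∈ uIcc (-h) 0, HasDerivAt
      (fun z => 4 * (A ^ 2 * (ε * z + ε / κ * (Real.exp (-(κ * (-z / ε)))
        - Real.exp (-(κ * ((z + h) / ε))))) + J ^ 2 * z))
      (4 * (A ^ 2 * (ε + layerExp κ ε h z) + J ^ 2)) z := by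
    intro z _
    have h1 : HasDerivAt (fun z : ℝ => Real.exp (-(κ * (-z / ε))))
        (Real.exp (-(κ * (-z / ε))) * (-(κ * (-1 / ε)))) z :=
      ((((hasDerivAt_id z).neg.div_const ε).const_mul κ).neg).exp
    have h2 : HasDerivAt (fun z : ℝ => Real.exp (-(κ * ((z + h) / ε))))
        (Real.exp (-(κ * ((z + h) / ε))) * (-(κ * (1 / ε)))) z :=
      (((((hasDerivAt_id z).add_const h).div_const ε).const_mul κ).neg).exp
    have h3 := ((((((hasDerivAt_id z).const_mul ε).add ((h1.sub h2).const_mul (ε / κ))).const_mul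
      (A ^ 2)).add ((hasDerivAt_id z).const_mul (J ^ 2))).const_mul 4)
    refine h3.congr_deriv ?_
    rw [layerExp]
    field_simp
    ring
  rw [intervalIntegral.integral_eq_sub_of_hasDerivAt hder
    (Continuous.intervalIntegrable (by unfold layerExp; fun_prop) _ _)]
  simp only [neg_neg, neg_add_cancel, zero_add, zero_div, mul_zero, neg_zero, Real.exp_zero,
    mul_neg]
  have h1 := (Real.exp_pos (-(κ * (h / ε)))).le
  have h2 : 0 ≤ A ^ 2 * (ε / κ * Real.exp (-(κ * (h / ε)))) := by positivity
  have h3 : ε * (h + 2 / κ) = ε * h + 2 * (ε / κ) := by ring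
  rw [h3]
  nlinarith

/-- The four contributions are separated by (a + b + c + d)² ≤ 4(a² + b² + c² + d²). Since ε and
both exponentials lie in [0, 1], their squares are at most themselves, which leads back to
`integral_layerExp_le`. -/
theorem lintegral_vertical_le {κ ε h A J M : ℝ} (hκ : 0 < κ) (hε : 0 < ε) (hε1 : ε ≤ 1)
    (hh : 0 < h) :
    ∫⁻ z in Ioo (-h) 0, ENNReal.ofReal ((M * (A * (ε + layerExp κ ε h z) + J)) ^ 2) ≤
      ENNReal.ofReal (M ^ 2) * ENNReal.ofReal (4 * (A ^ 2 * (ε * (h + 2 / κ)) + J ^ 2 * h)) := by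
  have hc : Continuous fun z => 4 * (A ^ 2 * (ε + layerExp κ ε h z) + J ^ 2) := by
    unfold layerExp; fun_prop
  have hL : ∀ z, 0 ≤ layerExp κ ε h z := fun z => by unfold layerExp; positivity
  calc _ ≤ ∫⁻ z in Ioo (-h) 0, ENNReal.ofReal (M ^ 2) *
          ENNReal.ofReal (4 * (A ^ 2 * (ε + layerExp κ ε h z) + J ^ 2)) := by
        refine setLIntegral_mono' measurableSet_Ioo fun z hz => ?_
        rw [← ENNReal.ofReal_mul (sq_nonneg M)]
        refine ENNReal.ofReal_le_ofReal ?_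
        rw [mul_pow]
        refine mul_le_mul_of_nonneg_left ?_ (sq_nonneg M)
        set x := Real.exp (-(κ * (-z / ε))) with hx
        set y := Real.exp (-(κ * ((z + h) / ε))) with hy
        have hx0 : 0 < x := Real.exp_pos _
        have hy0 : 0 < y := Real.exp_pos _
        have hx1 : x ≤ 1 := Real.exp_le_one_iff.2 (neg_nonpos.2
          (mul_nonneg hκ.le (div_nonneg (by linarith [hz.2]) hε.le)))
        have hy1 : y ≤ 1 := Real.exp_le_one_iff.2 (neg_nonpos.2
          (mul_nonneg hκ.le (div_nonneg (by linarith [hz.1]) hε.le)))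
        have e : layerExp κ ε h z = x + y := rfl
        rw [e]
        have h1 : (A * (ε + (x + y)) + J) ^ 2 ≤ 4 * (A ^ 2 * (ε ^ 2 + x ^ 2 + y ^ 2) + J ^ 2) := by
          nlinarith [sq_nonneg (A * ε - A * x), sq_nonneg (A * ε - A * y), sq_nonneg (A * ε - J),
            sq_nonneg (A * x - A * y), sq_nonneg (A * x - J), sq_nonneg (A * y - J)]
        have h2 : ε ^ 2 + x ^ 2 + y ^ 2 ≤ ε + (x + y) := by nlinarith
        have h3 := mul_le_mul_of_nonneg_left h2 (sq_nonneg A)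
        linarith
    _ = ENNReal.ofReal (M ^ 2) *
          ENNReal.ofReal (∫ z in Ioo (-h) 0, 4 * (A ^ 2 * (ε + layerExp κ ε h z) + J ^ 2)) := by
        rw [lintegral_const_mul' _ _ ENNReal.ofReal_ne_top, ofReal_integral_eq_lintegral_ofReal]
        · exact (hc.integrableOn_Icc (a := -h) (b := 0)).mono_set Ioo_subset_Icc_self
        · refine Eventually.of_forall fun z => ?_
          have := hL z
          simp only [Pi.zero_apply]
          positivity
    _ ≤ _ := by
        gcongr
        rw [← integral_Ioc_eq_integral_Ioo, ← intervalIntegral.integral_of_le (by linarith)]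
        exact integral_layerExp_le hκ hε

theorem isOpen_omega (hd : d.Admissible) : IsOpen d.Omega := by
  refine isOpen_iff_mem_nhds.2 fun p hp => ?_
  obtain ⟨hp1, hp2, hp3⟩ := hp
  have hcont : ContinuousAt (fun q : Space => d.φ (d.rho q.1)) p :=
    ContinuousAt.comp (g := d.φ) (f := fun q : Space => d.rho q.1)
      ((hd.isFloor.smooth.continuousOn).continuousAt (Ioi_mem_nhds (mem_ocean.1 hp1)))
      ((continuous_rho.comp continuous_fst).continuousAt)
  filter_upwards [(isOpen_ocean.preimage continuous_fst).mem_nhds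
    (show p ∈ Prod.fst ⁻¹' d.ocean from hp1),
    (hcont.neg.prodMk continuousAt_snd).eventually ((isOpen_lt continuous_fst continuous_snd).mem_nhds hp2),
    continuousAt_snd.eventually (gt_mem_nhds hp3)] with q h1 h2 h3
  exact ⟨h1, h2, h3⟩

/-- Fubini on the domain. -/
theorem lintegral_omega_le (hd : d.Admissible) (f : Space → ℝ≥0∞) (g : Plane → ℝ≥0∞)
    (h : ∀ x ∈ d.ocean, ∫⁻ z in Ioo (-d.φ (d.rho x)) 0, f (x, z) ≤ g x) :
    ∫⁻ p in d.Omega, f p ≤ ∫⁻ x in d.ocean, g x := by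
  rw [← lintegral_indicator (isOpen_omega hd).measurableSet,
    ← lintegral_indicator (isOpen_ocean (d := d)).measurableSet, Measure.volume_eq_prod]
  -- Only the inequality in Tonelli's theorem is used; it holds without measurability of the
  -- integrand, so none is required of f.
  refine (lintegral_prod_le _).trans (lintegral_mono fun x => ?_)
  by_cases hx : x ∈ d.ocean
  · rw [indicator_of_mem hx]
    refine le_trans (le_of_eq ?_) (h x hx)
    rw [← lintegral_indicator measurableSet_Ioo]
    refine lintegral_congr fun z => ?_
    by_cases hz : z ∈ Ioo (-d.φ (d.rho x)) 0
    · rw [indicator_of_mem hz, indicator_of_mem (show (x, z) ∈ d.Omega from ⟨hx, hz⟩)]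
    · rw [indicator_of_notMem hz, indicator_of_notMem fun h => hz h.2]
  · rw [indicator_of_notMem hx]
    refine le_of_eq ((lintegral_congr fun z => ?_).trans lintegral_zero)
    exact indicator_of_notMem (fun h => hx h.1) _

/-- One term of the exponential series gives (c(1 + t)/2)^11 ≤ 11! exp(c(1 + t)/2); half of the
decay pays for it and the other half remains integrable. -/
theorem integrableOn_time {c : ℝ} (hc : 0 < c) :
    IntegrableOn (fun t : ℝ => (1 + t) ^ 11 * Real.exp (-(c * t))) (Ioi 0) := by
  have h1 := (exp_neg_integrableOn_Ioi 0 (half_pos hc)).const_mul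
    ((2 / c) ^ 11 * Nat.factorial 11 * Real.exp (c / 2))
  refine Integrable.mono' h1 (Continuous.aestronglyMeasurable (by fun_prop)) ?_
  refine (ae_restrict_iff' measurableSet_Ioi).2 (Eventually.of_forall fun t ht => ?_)
  have ht' : (0 : ℝ) < t := ht
  have h2 := Real.pow_div_factorial_le_exp (x := c / 2 * (1 + t)) (by positivity) 11
  rw [div_le_iff₀ (by positivity), mul_pow] at h2
  rw [Real.norm_eq_abs, abs_of_nonneg (by positivity)]
  have h3 : (1 + t) ^ 11 = (2 / c) ^ 11 * ((c / 2) ^ 11 * (1 + t) ^ 11) := by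
    rw [← mul_assoc, ← mul_pow]
    field_simp
  have h4 : Real.exp (-(c * t)) * Real.exp (c / 2 * (1 + t)) =
      Real.exp (c / 2) * Real.exp (-(c / 2) * t) := by
    rw [← Real.exp_add, ← Real.exp_add]
    congr 1
    ring
  calc (1 + t) ^ 11 * Real.exp (-(c * t))
      ≤ ((2 / c) ^ 11 * (Real.exp (c / 2 * (1 + t)) * Nat.factorial 11)) * Real.exp (-(c * t)) := by
        rw [h3]
        gcongr
    _ = (2 / c) ^ 11 * Nat.factorial 11 *
          (Real.exp (-(c * t)) * Real.exp (c / 2 * (1 + t))) := by ring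
    _ = _ := by rw [h4]; ring

/-- The square of the spatial norm of the error, for fixed time. -/
def gauge (d : Data) (κ ε : ℝ) : ℝ :=
  4 * ((d.cut ε)⁻¹ ^ 22 * ε * (d.H + 2 / κ) + 4 * d.cut ε)

/-- The first term is a multiple of ε^(1 − 22(1−a)): the exponent 1 is the gain from the layers, and
22 is the square of eleven losses. It is positive exactly when a > 21/22. -/
theorem tendsto_gauge (ha0 : 21 / 22 < d.a) (ha : d.a < 1) (κ : ℝ) :
    Tendsto (d.gauge κ) (𝓝[>] 0) (𝓝 0) := by
  have hpow : ∀ q : ℝ, 0 < q → Tendsto (fun ε : ℝ => ε ^ q) (𝓝[>] 0) (𝓝 0) := by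
    intro q hq
    have := (Real.continuousAt_rpow_const 0 q (Or.inr hq.le)).tendsto
    rw [Real.zero_rpow hq.ne'] at this
    exact this.mono_left nhdsWithin_le_nhds
  have h1 := hpow (1 - 22 * (1 - d.a)) (by linarith)
  have h2 := hpow (1 - d.a) (by linarith)
  have h3 := ((h1.mul_const (d.H + 2 / κ)).add (h2.const_mul 4)).const_mul 4
  simp only [zero_mul, mul_zero, add_zero] at h3
  refine h3.congr' ?_
  filter_upwards [self_mem_nhdsWithin] with ε hε
  have hε' : (0 : ℝ) < ε := hε
  have e : (d.cut ε)⁻¹ ^ 22 * ε = ε ^ (1 - 22 * (1 - d.a)) := by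
    rw [Real.rpow_sub hε', Real.rpow_one, mul_comm (22 : ℝ), Real.rpow_mul hε'.le, cut, inv_pow,
      div_eq_inv_mul]
    norm_cast
  rw [gauge, e]
  rfl

theorem wt_two_eq (ε t : ℝ) (p : Space) :
    d.wt 2 ε t p = Real.exp (-(d.rate * t)) * d.major (d.rho p.1) := by
  simp [wt, weight, major, Finset.sum_range_succ]

/-- Time and space separate: loss^11 splits into (1 + t)^11, which together with exp(−`rate` t) is
integrated into the finite constant K, and a power of ε, which goes into `gauge`. -/
theorem normL1L2_error_le (hd : d.Admissible) (ha0 : 0 < d.a) (ha : d.a < 1) :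
    ∃ κ > 0, ∃ K : ℝ≥0∞, K ≠ ⊤ ∧ ∀ᶠ ε in 𝓝[>] 0,
      normL1L2 d.Omega (fun t p => advection (d.Uapp ε t) p + d.limitTerm t p) ≤
        K * (ENNReal.ofReal (d.gauge κ ε) *
          ∫⁻ x in d.ocean, ENNReal.ofReal (d.major (d.rho x) ^ 2)) ^ (1 / 2 : ℝ) := by
  obtain ⟨κ, hκ, C, hC0, hC⟩ := error_bound hd ha0 ha
  refine ⟨κ, hκ, ∫⁻ t in Ioi (0 : ℝ), ENNReal.ofReal
    (C * ((1 + t) ^ 11 * Real.exp (-(d.rate * t)))), ?_, ?_⟩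
  · exact ((integrableOn_time hd.rate_pos).const_mul C).lintegral_lt_top.ne
  filter_upwards [hC, self_mem_nhdsWithin,
    nhdsWithin_le_nhds (gt_mem_nhds (zero_lt_one (α := ℝ)))] with ε hε hε0 hε1
  have hε' : 0 < ε := hε0
  have hc := cut_pos (d := d) hε'
  rw [← lintegral_mul_const _ (by fun_prop)]
  refine setLIntegral_mono' measurableSet_Ioi fun t ht => ?_
  have ht' : (0 : ℝ) < t := ht
  set B := C * ((1 + t) ^ 11 * Real.exp (-(d.rate * t))) with hB
  have hB0 : 0 ≤ B := by positivity
  have hmain : ∫⁻ p in d.Omega, ENNReal.ofReal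
      (‖(advection (d.Uapp ε t) p + d.limitTerm t p).1‖ ^ 2
        + (advection (d.Uapp ε t) p + d.limitTerm t p).2 ^ 2) ≤
      ENNReal.ofReal (B ^ 2) * (ENNReal.ofReal (d.gauge κ ε) *
          ∫⁻ x in d.ocean, ENNReal.ofReal (d.major (d.rho x) ^ 2)) := by
    calc _ ≤ ∫⁻ p in d.Omega, ENNReal.ofReal (B ^ 2) * ENNReal.ofReal
          ((d.major (d.rho p.1) * ((d.cut ε)⁻¹ ^ 11 * (ε + layerExp κ ε (d.φ (d.rho p.1)) p.2)
            + if d.φ (d.rho p.1) < 4 * d.cut ε then 1 else 0)) ^ 2) := by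
          refine setLIntegral_mono' (isOpen_omega hd).measurableSet fun p hp => ?_
          rw [← ENNReal.ofReal_mul (sq_nonneg B), ← mul_pow]
          refine ENNReal.ofReal_le_ofReal ((hε t p ht'.le hp).trans ?_)
          have hw := wt_nonneg (d := d) 2 ε t p
          have hl : 0 ≤ d.loss ε t := div_nonneg (by linarith) hc.le
          have hL : 0 ≤ layerExp κ ε (d.φ (d.rho p.1)) p.2 := by unfold layerExp; positivity
          set J : ℝ := if d.φ (d.rho p.1) < 4 * d.cut ε then 1 else 0 with hJ
          have hJ0 : 0 ≤ J := by rw [hJ]; split_ifs <;> norm_num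
          refine pow_le_pow_left₀ (by positivity) ?_ 2
          have hM : 0 ≤ d.major (d.rho p.1) := by unfold major; positivity
          have h1 : (1 : ℝ) ≤ (1 + t) ^ 11 := one_le_pow₀ (by linarith)
          have e : d.loss ε t ^ 11 = (1 + t) ^ 11 * (d.cut ε)⁻¹ ^ 11 := by
            rw [loss, div_eq_mul_inv, mul_pow]
          rw [wt_two_eq, e, hB]
          have h2 : J ≤ (1 + t) ^ 11 * J := le_mul_of_one_le_left hJ0 h1
          calc _ ≤ C * (Real.exp (-(d.rate * t)) * d.major (d.rho p.1) *
                ((1 + t) ^ 11 * (d.cut ε)⁻¹ ^ 11 * (ε + layerExp κ ε (d.φ (d.rho p.1)) p.2)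
                  + (1 + t) ^ 11 * J)) := by gcongr
            _ = _ := by ring
      _ = ENNReal.ofReal (B ^ 2) * ∫⁻ p in d.Omega, ENNReal.ofReal
          ((d.major (d.rho p.1) * ((d.cut ε)⁻¹ ^ 11 * (ε + layerExp κ ε (d.φ (d.rho p.1)) p.2)
            + if d.φ (d.rho p.1) < 4 * d.cut ε then 1 else 0)) ^ 2) :=
          lintegral_const_mul' _ _ ENNReal.ofReal_ne_top
      _ ≤ _ := by
          gcongr
          rw [← lintegral_const_mul' _ _ ENNReal.ofReal_ne_top]
          refine lintegral_omega_le hd _ _ fun x hx => ?_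
          have hr := mem_ocean.1 hx
          have hφ := hd.phi_pos hr
          refine (lintegral_vertical_le (A := (d.cut ε)⁻¹ ^ 11) (M := d.major (d.rho x))
            (J := if d.φ (d.rho x) < 4 * d.cut ε then 1 else 0)
            hκ hε' (le_of_lt hε1) hφ).trans ?_
          rw [mul_comm]
          gcongr
          rw [gauge]
          have h1 : ((d.cut ε)⁻¹ ^ 11) ^ 2 * (ε * (d.φ (d.rho x) + 2 / κ)) ≤
              (d.cut ε)⁻¹ ^ 22 * ε * (d.H + 2 / κ) := by
            rw [← pow_mul, ← mul_assoc]
            have := hd.phi_le hr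
            gcongr
          -- The truncation error is supported on columns of depth less than 4ε^(1-a); it is small
          -- because these columns are short, and no estimate of the area of the shore region is
          -- needed.
          have h2 : (if d.φ (d.rho x) < 4 * d.cut ε then (1 : ℝ) else 0) ^ 2 * d.φ (d.rho x) ≤
              4 * d.cut ε := by
            split_ifs with h
            · linarith
            · rw [zero_pow two_ne_zero, zero_mul]; positivity
          linarith
  calc _ ≤ (ENNReal.ofReal (B ^ 2) * (ENNReal.ofReal (d.gauge κ ε) *
          ∫⁻ x in d.ocean, ENNReal.ofReal (d.major (d.rho x) ^ 2))) ^ (1 / 2 : ℝ) :=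
        ENNReal.rpow_le_rpow hmain (by norm_num)
    _ = _ := by
        rw [ENNReal.mul_rpow_of_nonneg _ _ (by norm_num : (0 : ℝ) ≤ 1 / 2),
          ENNReal.ofReal_rpow_of_nonneg (sq_nonneg B) (by norm_num), ← Real.sqrt_eq_rpow,
          Real.sqrt_sq hB0]

/-- Convergence of the error. -/
theorem tendsto_error (hd : d.Admissible) (ha0 : 21 / 22 < d.a) (ha : d.a < 1) :
    Tendsto (fun ε : ℝ => normL1L2 d.Omega
      (fun t p => advection (d.Uapp ε t) p + d.limitTerm t p)) (𝓝[>] 0) (𝓝 0) := by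
  obtain ⟨κ, hκ, K, hK, h⟩ := normL1L2_error_le hd (by linarith) ha
  have h1 : Tendsto (fun ε => ENNReal.ofReal (d.gauge κ ε)) (𝓝[>] 0) (𝓝 0) := by
    have := ENNReal.tendsto_ofReal (tendsto_gauge ha0 ha κ)
    rwa [ENNReal.ofReal_zero] at this
  have h2 := ENNReal.Tendsto.mul_const (b := ∫⁻ x in d.ocean, ENNReal.ofReal
    (d.major (d.rho x) ^ 2)) h1 (Or.inr hd.lintegral_major_sq_lt_top.ne)
  rw [zero_mul] at h2
  have h3 := (ENNReal.continuous_rpow_const (y := 1 / 2)).tendsto 0 |>.comp h2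
  rw [ENNReal.zero_rpow_of_pos (by norm_num)] at h3
  have h4 := ENNReal.Tendsto.const_mul (a := K) h3 (Or.inr hK)
  rw [mul_zero] at h4
  exact tendsto_of_tendsto_of_tendsto_of_le_of_le' tendsto_const_nhds h4
    (Eventually.of_forall fun _ => zero_le) h

end Integration

end Data

end Ekman

end

theorem proposition2p3 :
    ∃ a₀ : ℝ, 0 < a₀ ∧ a₀ < 1 ∧
      ∀ d : Ekman.Data, d.Admissible → a₀ < d.a → d.a < 1 →
        (∀ ε : ℝ, 0 < ε →
          ContDiffOn ℝ ∞ (fun q : ℝ × Ekman.Space => d.Uapp ε q.1 q.2) (Ici 0 ×ˢ d.Omega)) ∧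
        Tendsto
          (fun ε : ℝ => Ekman.normL1L2 d.Omega
            (fun t p => Ekman.advection (d.Uapp ε t) p + d.limitTerm t p))
          (𝓝[>] 0) (𝓝 0) := by
  -- Any number of [21/22, 1[ would do: `tendsto_error` only needs a > 21/22.
  refine ⟨22 / 23, by norm_num, by norm_num, fun d hd ha0 ha => ⟨fun ε hε => ?_, ?_⟩⟩
  · exact (Ekman.Data.smP_uApp hd ha).contDiffOn hε fun q hq => hq.2.1
  · exact Ekman.Data.tendsto_error hd (by linarith) ha
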